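/- Let $\varphi\in C^\infty(\mathbb R^d\times\mathbb R^d)$ be real valued, let $\sigma\in C_c^\infty(\mathbb R^d\times\mathbb R^d)$ be complex valued, and put $h(x,y)=\det\varphi_{xy}(x,y)$, where $\varphi_{xy}=(\partial_{x_i}\partial_{y_j}\varphi)_{i,j}$. Let $\pi_L(x,y)=(x,\varphi_x(x,y))$ and $\pi_R(x,y)=(y,\varphi_y(x,y))$. Assume that on some open set $U\supseteq\operatorname{supp}\sigma$ the map $\pi_L$ is a Whitney fold and $\pi_R$ is a blowdown. Here a smooth map $g$ from $U$ to a space of the same dimension is called a Whitney fold (respectively a blowdown) on $U$ if it has corank $\le 1$ on $U$, $d(\det dg)\ne0$ at every point of $\mathcal L=\{P\in U:\det dg_P=0\}$, and $V(\det dg)\neq0$ on $\mathcal L$ (respectively $V$ is tangent to $\mathcal L$ along $\mathcal L$, i.e. $V(\det dg)=0$ on $\mathcal L$) for every kernel field $V$ of $g$, that is, every nowhere vanishing smooth vector field $V$ on an open subset of $U$ with $V|_P\in\ker dg_P$ at the points $P$ of $\mathcal L$ in that subset. Let $\chi\in C_c^\infty(\mathbb R)$ be complex valued with $0\notin\operatorname{supp}\chi$.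 For integers $k,\ell\ge 0$ define $$\mathcal A_{k,\ell}f(x)=\int_{\mathbb R^d} e^{i2^k\varphi(x,y)}f(y)\,\sigma(x,y)\,\chi(2^\ell h(x,y))\,dy .$$ Let $\varepsilon>0$. Then there is a constant $C_\varepsilon$, depending only on $d$, $\varphi$, $\sigma$, $\chi$ and $\varepsilon$, such that for all integers $k\ge0$, with $\ell_0=\lfloor k/(2+\varepsilon)\rfloor$, and all integers $0\le\ell\le\ell_0$, $$\|\mathcal A_{k,\ell}f\|_{L^2(\mathbb R^d)}\le C_\varepsilon\,2^{(\ell-dk)/2+\ell\varepsilon}\,\|f\|_{L^2(\mathbb R^d)}\qquad\text{for all } f\in L^2(\mathbb R^d).$$ Moreover, the same estimate with $\ell=\ell_0$ holds for the remaining piece at the endpoint, that is, for the operator obtained from $\mathcal A_{k,\ell_0}$ by replacing $\chi(2^{\ell_0}h(x,y))$ with $1-\sum_{0\le j<\ell_0}\chi(2^{j}h(x,y))$. -/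

import Mathlib

open MeasureTheory
open scoped ContDiff

noncomputable section

/-! ### Whitney folds and blowdowns -/

section Singularities

variable {M : Type*} [NormedAddCommGroup M] [NormedSpace ℝ M]

/-- The Jacobian determinant `det (dg)_P` of a map between spaces of equal dimension. -/
def jacDet (g : M → M) (P : M) : ℝ := (fderiv ℝ g P).det

/-- The singular variety of `g` in `U`: the points where `det (dg)` vanishes. -/
def singularSet (g : M → M) (U : Set M) : Set M := {P | P ∈ U ∧ jacDet g P = 0}

/-- On the open set `U`, `g` is smooth, has corank at most one, and `d (det dg) ≠ 0` wherever
`det dg = 0`; the singular variety is then a smooth hypersurface, whose tangent space at `P` is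
the kernel of `d (det dg)_P`. -/
structure HasCorankOneSingularities (g : M → M) (U : Set M) : Prop where
  smooth : ContDiffOn ℝ ∞ g U
  corank_le_one : ∀ P ∈ U, Module.finrank ℝ (fderiv ℝ g P).ker ≤ 1
  fderiv_jacDet_ne_zero : ∀ P ∈ singularSet g U, fderiv ℝ (jacDet g) P ≠ 0

/-- `V` is a kernel field of `g` on the open set `W`: a nowhere vanishing smooth vector field on
`W` which lies in `ker (dg)` along the singular variety. -/
structure IsKernelFieldOn (g : M → M) (W : Set M) (V : M → M) : Prop where
  smooth : ContDiffOn ℝ ∞ V W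
  ne_zero : ∀ P ∈ W, V P ≠ 0
  mem_ker : ∀ P ∈ singularSet g W, V P ∈ (fderiv ℝ g P).ker

/-- `g` is a Whitney fold on `U`: each kernel field `V` satisfies `V (det dg) ≠ 0` on the singular
variety. Kernel fields are taken on arbitrary open subsets of `U`, since a global one need not
exist. -/
structure IsWhitneyFoldOn (g : M → M) (U : Set M) : Prop
    extends HasCorankOneSingularities g U where
  fold : ∀ W : Set M, IsOpen W → W ⊆ U → ∀ V : M → M, IsKernelFieldOn g W V →
    ∀ P ∈ singularSet g W, fderiv ℝ (jacDet g) P (V P) ≠ 0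

/-- `g` is a blowdown on `U`: each kernel field is tangential to the singular variety
`{det dg = 0}` at each of its points. -/
structure IsBlowdownOn (g : M → M) (U : Set M) : Prop
    extends HasCorankOneSingularities g U where
  tangential : ∀ W : Set M, IsOpen W → W ⊆ U → ∀ V : M → M, IsKernelFieldOn g W V →
    ∀ P ∈ singularSet g W, fderiv ℝ (jacDet g) P (V P) = 0

end Singularities

/-! ### Oscillatory integral operators on `ℝ^d` -/

/-- `ℝ^d` with its Euclidean norm. -/
abbrev Rn (d : ℕ) : Type := EuclideanSpace ℝ (Fin d)

section Operators

variable {d : ℕ}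

/-- `π_L : (x, y) ↦ (x, φ_x(x, y))`. -/
def projL (φ : Rn d × Rn d → ℝ) (P : Rn d × Rn d) : Rn d × Rn d :=
  (P.1, gradient (fun x => φ (x, P.2)) P.1)

/-- `π_R : (x, y) ↦ (y, φ_y(x, y))`. -/
def projR (φ : Rn d × Rn d → ℝ) (P : Rn d × Rn d) : Rn d × Rn d :=
  (P.2, gradient (fun y => φ (P.1, y)) P.2)

/-- The mixed Hessian `φ_{xy}`, with entries `∂_{x_i} ∂_{y_j} φ`. -/
def mixedHessian (φ : Rn d × Rn d → ℝ) (P : Rn d × Rn d) : Matrix (Fin d) (Fin d) ℝ :=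
  Matrix.of fun i j =>
    fderiv ℝ (fun x => fderiv ℝ (fun y => φ (x, y)) P.2 (EuclideanSpace.single j 1)) P.1
      (EuclideanSpace.single i 1)

/-- `h(x, y) = det φ_{xy}(x, y)`. -/
def mixedHessianDet (φ : Rn d × Rn d → ℝ) (P : Rn d × Rn d) : ℝ := (mixedHessian φ P).det

/-- The oscillatory integral operator `f ↦ ∫ e^{i lam φ(x, y)} f(y) a(x, y) dy`. -/
def oscOp (lam : ℝ) (φ : Rn d × Rn d → ℝ) (a : Rn d × Rn d → ℂ) (f : Rn d → ℂ) (x : Rn d) : ℂ :=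
  ∫ y, Complex.exp (Complex.I * ((lam * φ (x, y) : ℝ) : ℂ)) * f y * a (x, y)

/-- The piece `𝒜_{k,ℓ}` localized to `|h| ~ 2^{-ℓ}`: the amplitude is `σ χ(2^ℓ h)`. -/
def pieceOp (φ : Rn d × Rn d → ℝ) (σ : Rn d × Rn d → ℂ) (χ : ℝ → ℂ) (k ℓ : ℕ) :
    (Rn d → ℂ) → Rn d → ℂ :=
  oscOp (2 ^ k) φ fun P => σ P * χ (2 ^ ℓ * mixedHessianDet φ P)

/-- The remaining piece at the endpoint `ℓ₀`: the amplitude is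
`σ (1 - ∑_{0 ≤ j < ℓ₀} χ(2^j h))`. -/
def endpointOp (φ : Rn d × Rn d → ℝ) (σ : Rn d × Rn d → ℂ) (χ : ℝ → ℂ) (k ℓ₀ : ℕ) :
    (Rn d → ℂ) → Rn d → ℂ :=
  oscOp (2 ^ k) φ fun P =>
    σ P * (1 - ∑ j ∈ Finset.range ℓ₀, χ (2 ^ j * mixedHessianDet φ P))

/-- `T` maps `L²(ℝ^d)` to itself with operator norm at most `B`. -/
def BoundedOnL2 (T : (Rn d → ℂ) → Rn d → ℂ) (B : ℝ) : Prop :=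
  ∀ f : Rn d → ℂ, MemLp f 2 volume →
    MemLp (T f) 2 volume ∧ eLpNorm (T f) 2 volume ≤ ENNReal.ofReal B * eLpNorm f 2 volume

end Operators

end

/-! Write `λ = 2^k` and `δ = 2^{-ℓ}`. After a smooth partition of unity, everything happens on a
small ball, and the phase enters only through three inequalities there (`exists_local_geometry`):
(a) `|y - z| ≲ |φ_x(x,y) - φ_x(x,z)| + |h(x,y) - h(x,z)|`, because on a Whitney fold `(x, y) ↦ (x,
φ_x, h)` is an immersion; (b) `|h(x,y)| |x - z| ≲ |φ_y(x,y) - φ_y(z,y)|`, from the blowdown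
condition; (c) `|x - z| ≲ |φ_y(x,y) - φ_y(z,y)| + |⟨x - z, u₀⟩|`, from corank one. For (b), let `W`
be a smooth field in the `x` variables that spans the kernel of `D_x φ_y` where `h = 0`. Tangency
says that `W h` vanishes on `{h = 0}`, and `dh ≠ 0` there, so `W h = O(h)`. By Gronwall, `h` stays
comparable along the integral curves of `W`, while one component of `φ_y` moves along them at speed
about `|h|`. The quantitative form is `exists_eventually_blowdown_le`.

The operator bound is a combination of `T*T` and `T T*` (`exists_sqNorm_locAmp_le`). The `y` space
is cut into cubes of side comparable to `δ`. For two distant cubes, `|h| ≲ δ` on the support lets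
(a) bound the `x` gradient of the phase of the `T*T` kernel from below, and integration by parts
gains `(λδ²)^{-N}`. Since `ℓ (2 + ε) ≤ k`, the quantity `λδ²` is a positive power of `2^k`, and a
large `N` makes this term negligible (`far_term_le`). On a single cube, `T T*` and Schur's test are
used. Its kernel at `(x, z)` is at most the `y` integral of `(1 + λδ |φ_y(x,y) -
φ_y(z,y)|)^{-(d+1)}`. Where `|h| ~ δ`, (b) makes `z ↦ φ_y(z, y)` injective with Jacobian at least a
multiple of `δ`, so the `z` integral is `O(δ^{-1} (λδ)^{-d})`. The volume `δ^d` of the cube turns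
this into `δ^{-1} λ^{-d} = 2^{ℓ - dk}` for the square of the norm.

At the endpoint `|h|` has no lower bound. Integration by parts is then done at scale `λ^{-1/2}`, and
(c) is used on slabs of width `λ^{-1/2}` in the direction `u₀`; this gives `δ^d λ^{1/2} λ^{-d/2}`.
Since `χ` need not generate a dyadic partition of unity, `1 - ∑ χ(2^j h)` is not localized near `h =
0`. The function `1` is therefore split by a separate cutoff, down to `|h| ≲ 2^{-l₁}` with `l₁ =
⌊k/(2 + ε')⌋` and `ε'` much smaller than `ε`, and the pieces `χ(2^j h)` are subtracted again one by
one. The resulting excess over `2^{(ℓ₀ - dk)/2}` is paid for by `2^{ℓ₀ ε}`. -/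

noncomputable section

/-! ### Calculus of derivative bounds at a fixed scale. -/

section DerivBounds

variable {E F : Type*} [NormedAddCommGroup E] [NormedSpace ℝ E]
  [NormedAddCommGroup F] [NormedSpace ℝ F]

/-- The derivatives of `f` at `y` of order at most `M`, measured at scale `s`, are bounded by
`B`. -/
def DerivBound (s : ℝ) (M : ℕ) (f : E → F) (y : E) (B : ℝ) : Prop :=
  ∀ m ≤ M, s ^ m * ‖iteratedFDeriv ℝ m f y‖ ≤ B

namespace DerivBound

variable {s : ℝ} {M : ℕ} {y : E} {B B' : ℝ}

lemma norm_le {f : E → F} (h : DerivBound s M f y B) : ‖f y‖ ≤ B := by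
  simpa using h 0 (Nat.zero_le _)

lemma nonneg {f : E → F} (h : DerivBound s M f y B) : 0 ≤ B :=
  (norm_nonneg _).trans h.norm_le

lemma mono {f : E → F} (h : DerivBound s M f y B) (hB : B ≤ B') : DerivBound s M f y B' :=
  fun m hm => (h m hm).trans hB

lemma of_le {f : E → F} {M' : ℕ} (h : DerivBound s M f y B) (hM : M' ≤ M) :
    DerivBound s M' f y B :=
  fun m hm => h m (hm.trans hM)

lemma smul {R : Type*} [NormedField R] [NormedAlgebra ℝ R] [NormedSpace R F]
    [IsScalarTower ℝ R F] {f : E → R} {g : E → F} (hs : 0 ≤ s) (hf : ContDiff ℝ ∞ f) (hg : ContDiff ℝ ∞ g)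
    (h : DerivBound s M f y B) (h' : DerivBound s M g y B') :
    DerivBound s M (fun z => f z • g z) y (2 ^ M * B * B') := by
  intro m hm
  have hB := h.nonneg
  have hB' := h'.nonneg
  calc s ^ m * ‖iteratedFDeriv ℝ m (fun z => f z • g z) y‖
      ≤ s ^ m * ∑ i ∈ Finset.range (m + 1), (m.choose i : ℝ) * ‖iteratedFDeriv ℝ i f y‖ *
          ‖iteratedFDeriv ℝ (m - i) g y‖ := by
        gcongr
        exact norm_iteratedFDeriv_smul_le hf hg y (by exact_mod_cast le_top)
    _ = ∑ i ∈ Finset.range (m + 1), (m.choose i : ℝ) * (s ^ i * ‖iteratedFDeriv ℝ i f y‖) *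
          (s ^ (m - i) * ‖iteratedFDeriv ℝ (m - i) g y‖) := by
        rw [Finset.mul_sum]
        refine Finset.sum_congr rfl fun i hi => ?_
        have : s ^ m = s ^ i * s ^ (m - i) := by
          rw [← pow_add, Nat.add_sub_cancel' (Nat.lt_succ_iff.mp (Finset.mem_range.mp hi))]
        rw [this]; ring
    _ ≤ ∑ i ∈ Finset.range (m + 1), (m.choose i : ℝ) * B * B' := by
        refine Finset.sum_le_sum fun i hi => ?_
        have hi' := Nat.lt_succ_iff.mp (Finset.mem_range.mp hi)
        gcongr
        · exact h i (hi'.trans hm)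
        · exact h' (m - i) ((Nat.sub_le _ _).trans hm)
    _ = 2 ^ m * B * B' := by
        rw [← Finset.sum_mul, ← Finset.sum_mul]
        congr 2
        exact_mod_cast Nat.sum_range_choose m
    _ ≤ 2 ^ M * B * B' := by
        gcongr
        norm_num

lemma add {f g : E → F} (hs : 0 ≤ s) (hf : ContDiff ℝ ∞ f) (hg : ContDiff ℝ ∞ g)
    (h : DerivBound s M f y B) (h' : DerivBound s M g y B') :
    DerivBound s M (fun z => f z + g z) y (B + B') := by
  intro m hm
  have : iteratedFDeriv ℝ m (fun z => f z + g z) y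
      = iteratedFDeriv ℝ m f y + iteratedFDeriv ℝ m g y :=
    iteratedFDeriv_add_apply (hf.of_le (by exact_mod_cast le_top)).contDiffAt
      (hg.of_le (by exact_mod_cast le_top)).contDiffAt
  rw [this]
  calc _ ≤ s ^ m * (‖iteratedFDeriv ℝ m f y‖ + ‖iteratedFDeriv ℝ m g y‖) := by
        gcongr; exact norm_add_le _ _
    _ ≤ _ := by rw [mul_add]; exact add_le_add (h m hm) (h' m hm)

lemma const (c : F) : DerivBound s M (fun _ : E => c) y ‖c‖ := by
  intro m _
  rcases m with _ | m
  · simp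
  · simp [iteratedFDeriv_succ_const]

lemma sum {ι : Type*} (u : Finset ι) {f : ι → E → F} (hs : 0 ≤ s)
    (hf : ∀ i, ContDiff ℝ ∞ (f i)) (h : ∀ i, DerivBound s M (f i) y B) :
    DerivBound s M (fun z => ∑ i ∈ u, f i z) y (u.card * B) := by
  classical
  induction u using Finset.induction_on with
  | empty => simpa using const (E := E) (s := s) (y := y) (M := M) (0 : F)
  | insert i u hi ih =>
    simp only [Finset.sum_insert hi, Finset.card_insert_of_notMem hi]
    refine ((h i).add hs (hf i) (ContDiff.sum fun j _ => hf j) ih).mono (le_of_eq ?_)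
    push_cast; ring

lemma const_smul {R : Type*} [NormedField R] [NormedSpace R F] [SMulCommClass ℝ R F]
    {f : E → F} (c : R)
    (hf : ContDiff ℝ ∞ f) (h : DerivBound s M f y B) :
    DerivBound s M (fun z => c • f z) y (‖c‖ * B) := by
  intro m hm
  have : iteratedFDeriv ℝ m (fun z => c • f z) y = c • iteratedFDeriv ℝ m f y :=
    iteratedFDeriv_const_smul_apply (hf.of_le (by exact_mod_cast le_top)).contDiffAt
  rw [this]
  calc _ = s ^ m * (‖c‖ * ‖iteratedFDeriv ℝ m f y‖) := by rw [norm_smul]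
    _ = ‖c‖ * (s ^ m * ‖iteratedFDeriv ℝ m f y‖) := by ring
    _ ≤ _ := by gcongr; exact h m hm

/-- Directional derivatives at scale `s`. -/
lemma dirDeriv {f : E → F} (hs : 0 ≤ s) (hf : ContDiff ℝ ∞ f) (v : E)
    (h : ∀ m, 1 ≤ m → m ≤ M + 1 → s ^ m * ‖iteratedFDeriv ℝ m f y‖ ≤ B) :
    DerivBound s M (fun z => s • fderiv ℝ f z v) y (‖v‖ * B) := by
  have hf' : ContDiff ℝ ∞ (fderiv ℝ f) := hf.fderiv_right (by simp)
  intro m hm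
  have h1 : iteratedFDeriv ℝ m (fun z => s • fderiv ℝ f z v) y
      = s • iteratedFDeriv ℝ m (fun z => fderiv ℝ f z v) y :=
    iteratedFDeriv_const_smul_apply
      ((hf'.clm_apply contDiff_const).of_le (by exact_mod_cast le_top)).contDiffAt
  rw [h1, norm_smul, Real.norm_of_nonneg hs]
  calc _ ≤ s ^ m * (s * (‖v‖ * ‖iteratedFDeriv ℝ m (fderiv ℝ f) y‖)) := by
        gcongr
        exact norm_iteratedFDeriv_clm_apply_const hf'.contDiffAt (by exact_mod_cast le_top)
    _ = ‖v‖ * (s ^ (m + 1) * ‖iteratedFDeriv ℝ (m + 1) f y‖) := by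
        rw [norm_iteratedFDeriv_fderiv]; ring
    _ ≤ _ := by gcongr; exact h (m + 1) (by omega) (by omega)

/-- Composition with a fixed smooth function. -/
lemma comp_left {G : Type*} [NormedAddCommGroup G] [NormedSpace ℝ G] {f : E → F} {g : F → G}
    {A : ℝ} (hs : 0 < s) (hf : ContDiff ℝ ∞ f) {t : Set F} (ht : Set.range f ⊆ t)
    (ht' : UniqueDiffOn ℝ t) (hg : ContDiffOn ℝ ∞ g t) (hA : 1 ≤ A)
    (hgB : ∀ i ≤ M, ‖iteratedFDerivWithin ℝ i g t (f y)‖ ≤ B')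
    (h : ∀ m, 1 ≤ m → m ≤ M → s ^ m * ‖iteratedFDeriv ℝ m f y‖ ≤ A) :
    DerivBound s M (fun z => g (f z)) y (M.factorial * B' * A ^ M) := by
  have hB' : 0 ≤ B' := (norm_nonneg _).trans (hgB 0 (Nat.zero_le _))
  intro m hm
  have key : ‖iteratedFDeriv ℝ m (g ∘ f) y‖ ≤ m.factorial * B' * (A / s) ^ m := by
    refine norm_iteratedFDeriv_comp_le' (N := ∞) ht ht' hg hf (by exact_mod_cast le_top) y
      (fun i hi => hgB i (hi.trans hm)) fun i hi hi' => ?_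
    have hsi : (0 : ℝ) < s ^ i := pow_pos hs i
    rw [div_pow, le_div_iff₀ hsi, mul_comm]
    exact (h i hi (hi'.trans hm)).trans (le_self_pow₀ hA (by omega))
  calc s ^ m * ‖iteratedFDeriv ℝ m (fun z => g (f z)) y‖
      ≤ s ^ m * (m.factorial * B' * (A / s) ^ m) := by
        gcongr; exact key
    _ = m.factorial * B' * A ^ m := by
        rw [div_pow]; field_simp
    _ ≤ M.factorial * B' * A ^ M := by
        gcongr

end DerivBound

/-- Reciprocals of positive functions. -/
lemma DerivBound.inv (M : ℕ) {A : ℝ} (hA : 1 ≤ A) : ∃ C, 0 ≤ C ∧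
    ∀ {E : Type*} [NormedAddCommGroup E] [NormedSpace ℝ E] {s : ℝ} {y : E} {f : E → ℝ}, 0 < s →
      ContDiff ℝ ∞ f → (∀ z, 0 < f z) → DerivBound s M f y (A * f y) →
        DerivBound s M (fun z => (f z)⁻¹) y (C * (f y)⁻¹) := by
  set Cg := ∑ i ∈ Finset.range (M + 1),
    ‖iteratedFDerivWithin ℝ i (fun t : ℝ => t⁻¹) (Set.Ioi 0) 1‖ with hCg
  have hCg0 : 0 ≤ Cg := Finset.sum_nonneg fun _ _ => norm_nonneg _
  refine ⟨M.factorial * Cg * A ^ M, by positivity, ?_⟩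
  intro E _ _ s y f hs hf hpos hb
  have hy := hpos y
  -- Normalizing by the value `f y` reduces to inversion near the point `1`, so the constant does
  -- not depend on the size of `f y`.
  have hF : ContDiff ℝ ∞ (fun z => (f y)⁻¹ • f z) := hf.const_smul _
  have h1 : DerivBound s M (fun z => ((f y)⁻¹ • f z)⁻¹) y (M.factorial * Cg * A ^ M) := by
    refine DerivBound.comp_left (g := fun t : ℝ => t⁻¹) (t := Set.Ioi 0) hs hF ?_
      (uniqueDiffOn_Ioi 0) ?_ hA ?_ ?_
    · rintro _ ⟨z, rfl⟩
      exact mul_pos (inv_pos.mpr hy) (hpos z)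
    · exact fun t ht => (contDiffAt_inv ℝ (ne_of_gt ht)).contDiffWithinAt
    · intro i hi
      have : (f y)⁻¹ • f y = 1 := inv_mul_cancel₀ hy.ne'
      rw [this, hCg]
      exact Finset.single_le_sum (f := fun i =>
        ‖iteratedFDerivWithin ℝ i (fun t : ℝ => t⁻¹) (Set.Ioi 0) 1‖)
        (fun _ _ => norm_nonneg _) (Finset.mem_range.mpr (by omega))
    · intro m _ hm
      have := hb.const_smul (f y)⁻¹ hf m hm
      refine this.trans (le_of_eq ?_)
      rw [norm_inv, Real.norm_of_nonneg hy.le]; field_simp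
  have h2 : ContDiff ℝ ∞ (fun z => ((f y)⁻¹ • f z)⁻¹) :=
    hF.fun_inv fun z => (mul_pos (inv_pos.mpr hy) (hpos z)).ne'
  have h3 := h1.const_smul (f y)⁻¹ h2
  have h4 : (fun z => (f z)⁻¹) = fun z => (f y)⁻¹ • ((f y)⁻¹ • f z)⁻¹ := by
    funext z
    have := hpos z
    simp only [smul_eq_mul, mul_inv, inv_inv]
    field_simp
  rw [h4]
  refine h3.mono (le_of_eq ?_)
  rw [norm_inv, Real.norm_of_nonneg hy.le]; ring

end DerivBounds

/-! ### Integration by parts with a pointwise gain. -/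

section NonstationaryPhase

variable {d : ℕ}

/-- The `j`-th unit vector. -/
abbrev unitVec (j : Fin d) : Rn d := EuclideanSpace.single j 1

lemma sq_norm_dual (L : Rn d →L[ℝ] ℝ) : ‖L‖ ^ 2 = ∑ j, (L (unitVec j)) ^ 2 := by
  obtain ⟨v, rfl⟩ := (InnerProductSpace.toDual ℝ (Rn d)).surjective L
  rw [LinearIsometryEquiv.norm_map, EuclideanSpace.norm_sq_eq]
  refine Finset.sum_congr rfl fun j _ => ?_
  rw [InnerProductSpace.toDual_apply_apply, EuclideanSpace.inner_single_right]
  simp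

/-- `1 + s² |∇ψ|²`. -/
def phaseWeight (s : ℝ) (ψ : Rn d → ℝ) (y : Rn d) : ℝ :=
  1 + ∑ j, (s • fderiv ℝ ψ y (unitVec j)) • (s • fderiv ℝ ψ y (unitVec j))

lemma phaseWeight_eq (s : ℝ) (ψ : Rn d → ℝ) (y : Rn d) :
    phaseWeight s ψ y = 1 + s ^ 2 * ‖fderiv ℝ ψ y‖ ^ 2 := by
  rw [phaseWeight, sq_norm_dual, Finset.mul_sum]
  congr 1
  refine Finset.sum_congr rfl fun j _ => ?_
  simp only [smul_eq_mul]; ring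

lemma phaseWeight_pos (s : ℝ) (ψ : Rn d → ℝ) (y : Rn d) : 0 < phaseWeight s ψ y := by
  rw [phaseWeight_eq]; positivity

lemma contDiff_dirDeriv {F : Type*} [NormedAddCommGroup F] [NormedSpace ℝ F] {f : Rn d → F}
    (hf : ContDiff ℝ ∞ f) (v : Rn d) : ContDiff ℝ ∞ (fun z => fderiv ℝ f z v) :=
  (hf.fderiv_right (m := ∞) (by simp)).clm_apply contDiff_const

lemma contDiff_phaseWeight {s : ℝ} {ψ : Rn d → ℝ} (hψ : ContDiff ℝ ∞ ψ) :
    ContDiff ℝ ∞ (phaseWeight s ψ) := by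
  unfold phaseWeight
  refine contDiff_const.add (ContDiff.sum fun j _ => ?_)
  have := contDiff_dirDeriv hψ (unitVec j)
  exact (this.const_smul s).fun_smul (this.const_smul s)

/-- The `j`-th component of the amplitude under the divergence in `phaseTranspose`. -/
def phaseFlux (s : ℝ) (ψ : Rn d → ℝ) (a : Rn d → ℂ) (j : Fin d) (y : Rn d) : ℂ :=
  (s • fderiv ℝ ψ y (unitVec j)) • ((phaseWeight s ψ y)⁻¹ • a y)

/-- The transpose of the operator `(1 + s² |∇ψ|²)⁻¹ (1 - i s² ∇ψ · ∇)`, which fixes `e^{iψ}`. -/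
def phaseTranspose (s : ℝ) (ψ : Rn d → ℝ) (a : Rn d → ℂ) (y : Rn d) : ℂ :=
  (phaseWeight s ψ y)⁻¹ • a y +
    Complex.I • ∑ j, s • fderiv ℝ (phaseFlux s ψ a j) y (unitVec j)

variable {s : ℝ} {ψ : Rn d → ℝ} {a : Rn d → ℂ}

lemma contDiff_phaseFlux (hψ : ContDiff ℝ ∞ ψ) (ha : ContDiff ℝ ∞ a) (j : Fin d) :
    ContDiff ℝ ∞ (phaseFlux s ψ a j) :=
  ((contDiff_dirDeriv hψ _).const_smul s).fun_smul
    (((contDiff_phaseWeight hψ).fun_inv fun z => (phaseWeight_pos s ψ z).ne').fun_smul ha)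

lemma contDiff_phaseTranspose (hψ : ContDiff ℝ ∞ ψ) (ha : ContDiff ℝ ∞ a) :
    ContDiff ℝ ∞ (phaseTranspose s ψ a) := by
  unfold phaseTranspose
  refine (((contDiff_phaseWeight hψ).fun_inv fun z => (phaseWeight_pos s ψ z).ne').fun_smul ha).add
    (ContDiff.const_smul _ (ContDiff.sum fun j _ => ContDiff.const_smul _ ?_))
  exact contDiff_dirDeriv (contDiff_phaseFlux hψ ha j) _

lemma tsupport_phaseFlux_subset (j : Fin d) : tsupport (phaseFlux s ψ a j) ⊆ tsupport a := by
  refine closure_mono fun y hy => ?_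
  rw [Function.mem_support] at hy ⊢
  contrapose! hy
  simp [phaseFlux, hy]

lemma tsupport_phaseTranspose_subset : tsupport (phaseTranspose s ψ a) ⊆ tsupport a := by
  refine closure_minimal (fun y hy => ?_) (isClosed_tsupport _)
  by_contra hy'
  refine hy ?_
  have h1 : ∀ j, fderiv ℝ (phaseFlux s ψ a j) y = 0 := fun j =>
    image_eq_zero_of_notMem_tsupport fun h =>
      hy' (tsupport_phaseFlux_subset j (tsupport_fderiv_subset ℝ h))
  simp [phaseTranspose, h1, image_eq_zero_of_notMem_tsupport hy']

lemma integral_mul_fderiv_compactSupport {e g : Rn d → ℂ} (he : ContDiff ℝ ∞ e)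
    (hg : ContDiff ℝ ∞ g) (hgc : HasCompactSupport g) (v : Rn d) :
    ∫ y, e y * fderiv ℝ g y v = - ∫ y, fderiv ℝ e y v * g y := by
  have h1 : Integrable (fun y => fderiv ℝ e y v * g y) :=
    ((contDiff_dirDeriv he v).continuous.mul hg.continuous).integrable_of_hasCompactSupport
      hgc.mul_left
  have h2 : Integrable (fun y => e y * fderiv ℝ g y v) :=
    (he.continuous.mul (contDiff_dirDeriv hg v).continuous).integrable_of_hasCompactSupport
      (hgc.fderiv_apply ℝ v).mul_left
  have h3 : Integrable (fun y => e y * g y) :=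
    (he.continuous.mul hg.continuous).integrable_of_hasCompactSupport hgc.mul_left
  exact integral_mul_fderiv_eq_neg_fderiv_mul_of_integrable h1 h2 h3
    (fun x _ => he.differentiable (by simp) x) (fun x _ => hg.differentiable (by simp) x)

/-- Moving the derivatives back onto `e^{iψ}` produces `i ∂_jψ e^{iψ}`, so the flux terms contribute
`s²|∇ψ|²` over the weight. Together with the undifferentiated term they restore the amplitude
exactly. The weight never vanishes, so critical points of `ψ` do no harm. -/
lemma integral_exp_phaseTranspose (hψ : ContDiff ℝ ∞ ψ) (ha : ContDiff ℝ ∞ a)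
    (hac : HasCompactSupport a) :
    ∫ y, Complex.exp (Complex.I * ψ y) * a y
      = ∫ y, Complex.exp (Complex.I * ψ y) * phaseTranspose s ψ a y := by
  set e : Rn d → ℂ := fun y => Complex.exp (Complex.I * ψ y) with he
  have hed : ∀ y, HasFDerivAt e
      (Complex.exp (Complex.I * ψ y) • (Complex.I • (Complex.ofRealCLM.comp (fderiv ℝ ψ y)))) y := by
    intro y
    have h1 : HasFDerivAt ψ (fderiv ℝ ψ y) y :=
      (hψ.differentiable (by simp)).differentiableAt.hasFDerivAt
    have h2 : HasFDerivAt (fun y => (ψ y : ℂ)) (Complex.ofRealCLM.comp (fderiv ℝ ψ y)) y :=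
      Complex.ofRealCLM.hasFDerivAt.comp y h1
    exact (h2.const_mul Complex.I).cexp
  have hediff : Differentiable ℝ e := fun y => (hed y).differentiableAt
  have hec : Continuous e := hediff.continuous
  have hefd : ∀ y v, fderiv ℝ e y v = e y * (Complex.I * (fderiv ℝ ψ y v : ℝ)) := by
    intro y v
    rw [(hed y).fderiv]
    simp [he]
  have hflux : ∀ j, ContDiff ℝ ∞ (phaseFlux s ψ a j) := contDiff_phaseFlux hψ ha
  have hfluxc : ∀ j, HasCompactSupport (phaseFlux s ψ a j) := fun j =>
    hac.mono' ((subset_tsupport _).trans (tsupport_phaseFlux_subset j))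
  have hdfluxc : ∀ j v, HasCompactSupport (fun y => fderiv ℝ (phaseFlux s ψ a j) y v) := by
    intro j v
    exact (hfluxc j).fderiv_apply ℝ v
  have hdflux : ∀ j v, Continuous (fun y => fderiv ℝ (phaseFlux s ψ a j) y v) := fun j v =>
    (contDiff_dirDeriv (hflux j) v).continuous
  have hes : ContDiff ℝ ∞ e :=
    (contDiff_const.mul (Complex.ofRealCLM.contDiff.comp hψ)).cexp
  have hparts : ∀ j, ∫ y, e y * fderiv ℝ (phaseFlux s ψ a j) y (unitVec j)
      = - ∫ y, fderiv ℝ e y (unitVec j) * phaseFlux s ψ a j y := fun j =>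
    integral_mul_fderiv_compactSupport hes (hflux j) (hfluxc j) (unitVec j)
  have hq : Continuous (fun y => (phaseWeight s ψ y)⁻¹) :=
    ((contDiff_phaseWeight hψ).fun_inv fun z => (phaseWeight_pos s ψ z).ne').continuous
  have hqa : Continuous (fun y => (phaseWeight s ψ y)⁻¹ • a y) := hq.smul ha.continuous
  have hqac : HasCompactSupport (fun y => (phaseWeight s ψ y)⁻¹ • a y) :=
    hac.mono fun y hy => by
      rw [Function.mem_support] at hy ⊢
      exact right_ne_zero_of_smul hy
  have hI1 : Integrable (fun y => e y * ((phaseWeight s ψ y)⁻¹ • a y)) :=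
    (hec.mul hqa).integrable_of_hasCompactSupport hqac.mul_left
  have hI2 : ∀ j, Integrable
      (fun y => e y * fderiv ℝ (phaseFlux s ψ a j) y (unitVec j)) := fun j =>
    (hec.mul (hdflux j _)).integrable_of_hasCompactSupport (hdfluxc j _).mul_left
  have hI3 : ∀ j, Integrable
      (fun y => fderiv ℝ e y (unitVec j) * phaseFlux s ψ a j y) := fun j =>
    ((contDiff_dirDeriv hes _).continuous.mul (hflux j).continuous).integrable_of_hasCompactSupport
      (hfluxc j).mul_left
  have hR : ∫ y, e y * phaseTranspose s ψ a y
      = (∫ y, e y * ((phaseWeight s ψ y)⁻¹ • a y))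
        + ∑ j, (Complex.I * s) * ∫ y, e y * fderiv ℝ (phaseFlux s ψ a j) y (unitVec j) := by
    simp_rw [← integral_const_mul]
    rw [← integral_finsetSum _ (fun j _ => (hI2 j).const_mul _), ← integral_add hI1
      (integrable_finsetSum _ fun j _ => (hI2 j).const_mul _)]
    refine integral_congr_ae (Filter.Eventually.of_forall fun y => ?_)
    simp only [phaseTranspose, mul_add, Finset.mul_sum, smul_eq_mul,
      Complex.real_smul]
    congr 1
    refine Finset.sum_congr rfl fun j _ => by ring
  rw [hR]
  have hI4 : ∀ j ∈ (Finset.univ : Finset (Fin d)), Integrable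
      (fun y => -(Complex.I * s * (fderiv ℝ e y (unitVec j) * phaseFlux s ψ a j y))) :=
    fun j _ => ((hI3 j).const_mul _).neg
  simp_rw [hparts, mul_neg, ← integral_const_mul, ← integral_neg]
  rw [← integral_finsetSum _ hI4, ← integral_add hI1 (integrable_finsetSum _ hI4)]
  refine integral_congr_ae (Filter.Eventually.of_forall fun y => ?_)
  have hw := (phaseWeight_pos s ψ y).ne'
  have hw' : (phaseWeight s ψ y : ℂ) = 1 + ∑ j, (s : ℂ) * (fderiv ℝ ψ y (unitVec j) : ℝ)
      * (s * (fderiv ℝ ψ y (unitVec j) : ℝ)) := by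
    simp [phaseWeight]
  have hwc : (phaseWeight s ψ y : ℂ) ≠ 0 := by exact_mod_cast hw
  simp only [hefd, phaseFlux, Complex.real_smul, smul_eq_mul, Complex.ofReal_inv,
    Complex.ofReal_mul]
  -- The two factors `I` cancel the minus sign from integration by parts, and the sum over `j` is
  -- the weight minus `1`.
  have hsum : ∑ j, -(Complex.I * s * (e y * (Complex.I * (fderiv ℝ ψ y (unitVec j) : ℝ)) *
      ((s : ℂ) * (fderiv ℝ ψ y (unitVec j) : ℝ) * ((phaseWeight s ψ y : ℂ)⁻¹ * a y))))
      = (phaseWeight s ψ y - 1 : ℂ) * (e y * ((phaseWeight s ψ y : ℂ)⁻¹ * a y)) := by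
    rw [hw', add_sub_cancel_left, Finset.sum_mul]
    refine Finset.sum_congr rfl fun j _ => ?_
    linear_combination (-(s : ℂ) * (e y * (fderiv ℝ ψ y (unitVec j) : ℝ)) *
      ((s : ℂ) * (fderiv ℝ ψ y (unitVec j) : ℝ) *
        ((1 + ∑ j, (s : ℂ) * (fderiv ℝ ψ y (unitVec j) : ℝ)
      * (s * (fderiv ℝ ψ y (unitVec j) : ℝ)))⁻¹ * a y))) * Complex.I_mul_I
  rw [hsum]
  field_simp
  ring

/-- One integration by parts gains a factor `(1 + s |∇ψ|)⁻¹`. -/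
lemma derivBound_phaseTranspose (d M : ℕ) {A : ℝ} (hA : 1 ≤ A) : ∃ C, 0 ≤ C ∧
    ∀ {s : ℝ} {ψ : Rn d → ℝ} {a : Rn d → ℂ} {y : Rn d} {B : ℝ}, 0 < s → ContDiff ℝ ∞ ψ →
      ContDiff ℝ ∞ a →
      (∀ m, 1 ≤ m → m ≤ M + 2 →
        s ^ m * ‖iteratedFDeriv ℝ m ψ y‖ ≤ A * (1 + s * ‖fderiv ℝ ψ y‖)) →
      DerivBound s (M + 1) a y B →
      DerivBound s M (phaseTranspose s ψ a) y (C * B * (1 + s * ‖fderiv ℝ ψ y‖)⁻¹) := by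
  -- The weight is `1` plus `d` squares, each bounded by `2^(M+1) (A w)²`; the last factor `2` comes
  -- from `w² ≤ 2 * phaseWeight`.
  set A' : ℝ := 1 + d * (2 ^ (M + 1) * A * A) * 2 with hA'
  have hA'1 : 1 ≤ A' := by
    have : 0 ≤ (d : ℝ) * (2 ^ (M + 1) * A * A) * 2 := by positivity
    linarith
  obtain ⟨Ci, hCi, hinv⟩ := DerivBound.inv.{0} (M + 1) hA'1
  set C1 : ℝ := 2 ^ (M + 1) * (Ci * 2)
  set C2 : ℝ := 2 ^ (M + 1) * A * C1
  refine ⟨C1 + d * C2, by positivity, ?_⟩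
  intro s ψ a y B hs hψ ha hphase hamp
  set w : ℝ := 1 + s * ‖fderiv ℝ ψ y‖ with hw
  have hw1 : 1 ≤ w := by
    have : 0 ≤ s * ‖fderiv ℝ ψ y‖ := by positivity
    linarith
  have hw0 : 0 < w := by linarith
  have hB := hamp.nonneg
  have hQw : w ^ 2 ≤ 2 * phaseWeight s ψ y := by
    rw [phaseWeight_eq, hw]
    nlinarith [sq_nonneg (1 - s * ‖fderiv ℝ ψ y‖)]
  have hQ0 := phaseWeight_pos s ψ y
  have hp : ∀ j, DerivBound s (M + 1) (fun z => s • fderiv ℝ ψ z (unitVec j)) y (A * w) := by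
    intro j
    refine (DerivBound.dirDeriv hs.le hψ (unitVec j) (fun m h1 h2 => hphase m h1 h2)).mono ?_
    simp
  have hpc : ∀ j, ContDiff ℝ ∞ (fun z => s • fderiv ℝ ψ z (unitVec j)) := fun j =>
    (contDiff_dirDeriv hψ _).const_smul s
  have hQ : DerivBound s (M + 1) (phaseWeight s ψ) y (A' * phaseWeight s ψ y) := by
    have h1 := DerivBound.sum (Finset.univ : Finset (Fin d)) hs.le
      (fun j => (hpc j).fun_smul (hpc j)) (fun j => (hp j).smul hs.le (hpc j) (hpc j) (hp j))
    have h2 := (DerivBound.const (s := s) (M := M + 1) (y := y) (1 : ℝ)).add hs.le contDiff_const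
      (ContDiff.sum fun j _ => (hpc j).fun_smul (hpc j)) h1
    refine DerivBound.mono h2 ?_
    have h3 : 1 ≤ phaseWeight s ψ y := by
      rw [phaseWeight_eq]
      have : 0 ≤ s ^ 2 * ‖fderiv ℝ ψ y‖ ^ 2 := by positivity
      linarith
    rw [hA', norm_one, Finset.card_univ, Fintype.card_fin, add_mul, one_mul]
    refine add_le_add h3 ?_
    calc (d : ℝ) * (2 ^ (M + 1) * (A * w) * (A * w)) = d * (2 ^ (M + 1) * A * A) * w ^ 2 := by ring
      _ ≤ d * (2 ^ (M + 1) * A * A) * (2 * phaseWeight s ψ y) := by gcongr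
      _ = _ := by ring
  have hQc := contDiff_phaseWeight (s := s) hψ
  have hqc : ContDiff ℝ ∞ (fun z => (phaseWeight s ψ z)⁻¹) :=
    hQc.fun_inv fun z => (phaseWeight_pos s ψ z).ne'
  have hq : DerivBound s (M + 1) (fun z => (phaseWeight s ψ z)⁻¹) y (Ci * 2 * (w⁻¹ * w⁻¹)) := by
    refine (hinv hs hQc (phaseWeight_pos s ψ) hQ).mono ?_
    have : (phaseWeight s ψ y)⁻¹ ≤ 2 * (w⁻¹ * w⁻¹) := by
      rw [← mul_inv, ← div_eq_mul_inv, ← one_div, div_le_div_iff₀ hQ0 (by positivity)]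
      nlinarith
    calc Ci * (phaseWeight s ψ y)⁻¹ ≤ Ci * (2 * (w⁻¹ * w⁻¹)) := by gcongr
      _ = _ := by ring
  have hqa : DerivBound s (M + 1) (fun z => (phaseWeight s ψ z)⁻¹ • a z) y
      (C1 * B * (w⁻¹ * w⁻¹)) := by
    refine (hq.smul hs.le hqc ha hamp).mono (le_of_eq ?_)
    simp only [C1]; ring
  -- The factor `s ∂_jψ` costs `w` and the reciprocal weight gains `w⁻²`, which leaves the single
  -- `w⁻¹` of the conclusion.
  have hflux : ∀ j, DerivBound s (M + 1) (phaseFlux s ψ a j) y (C2 * B * w⁻¹) := by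
    intro j
    refine ((hp j).smul hs.le (hpc j) (hqc.fun_smul ha) hqa).mono (le_of_eq ?_)
    simp only [C2]; field_simp
  have hfl := contDiff_phaseFlux (s := s) hψ ha
  have hd : ∀ j, DerivBound s M (fun z => s • fderiv ℝ (phaseFlux s ψ a j) z (unitVec j)) y
      (C2 * B * w⁻¹) := by
    intro j
    refine (DerivBound.dirDeriv hs.le (hfl j) (unitVec j) (fun m _ h2 => hflux j m h2)).mono ?_
    simp
  have hdc : ∀ j, ContDiff ℝ ∞ (fun z => s • fderiv ℝ (phaseFlux s ψ a j) z (unitVec j)) :=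
    fun j => (contDiff_dirDeriv (hfl j) _).const_smul s
  have hsum := (DerivBound.sum (Finset.univ : Finset (Fin d)) hs.le hdc hd).const_smul
    Complex.I (ContDiff.sum fun j _ => hdc j)
  refine ((hqa.of_le (Nat.le_succ M)).add hs.le (hqc.fun_smul ha)
    ((ContDiff.sum fun j _ => hdc j).const_smul Complex.I) hsum).mono ?_
  rw [Complex.norm_I, Finset.card_univ, Fintype.card_fin, one_mul]
  have h5 : w⁻¹ * w⁻¹ ≤ w⁻¹ := mul_le_of_le_one_left (by positivity) (inv_le_one_of_one_le₀ hw1)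
  calc C1 * B * (w⁻¹ * w⁻¹) + d * (C2 * B * w⁻¹) ≤ C1 * B * w⁻¹ + d * (C2 * B * w⁻¹) := by gcongr
    _ = _ := by ring

/-- **Nonstationary phase estimate** with a pointwise gain. -/
theorem nonstationary_phase (d N : ℕ) {A : ℝ} (hA : 1 ≤ A) : ∃ C, 0 ≤ C ∧
    ∀ {s : ℝ} {ψ : Rn d → ℝ} {a : Rn d → ℂ} {S : Set (Rn d)}, 0 < s → ContDiff ℝ ∞ ψ →
      ContDiff ℝ ∞ a → HasCompactSupport a → MeasurableSet S → tsupport a ⊆ S →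
      (∀ y ∈ S, ∀ m, 1 ≤ m → m ≤ N + 1 →
        s ^ m * ‖iteratedFDeriv ℝ m ψ y‖ ≤ A * (1 + s * ‖fderiv ℝ ψ y‖)) →
      (∀ y ∈ S, DerivBound s N a y A) →
      ‖∫ y, Complex.exp (Complex.I * ψ y) * a y‖ₑ
        ≤ ENNReal.ofReal C * ∫⁻ y in S, ENNReal.ofReal (((1 + s * ‖fderiv ℝ ψ y‖)⁻¹) ^ N) := by
  -- Each transposition gains one factor `(1 + s|∇ψ|)⁻¹` and uses up one derivative of the
  -- amplitude, hence the order `N - n` after `n` steps.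
  have step : ∀ n ≤ N, ∃ C, 0 ≤ C ∧
      ∀ {s : ℝ} {ψ : Rn d → ℝ} {a : Rn d → ℂ} {S : Set (Rn d)}, 0 < s → ContDiff ℝ ∞ ψ →
      ContDiff ℝ ∞ a → HasCompactSupport a → tsupport a ⊆ S →
      (∀ y ∈ S, ∀ m, 1 ≤ m → m ≤ N + 1 →
        s ^ m * ‖iteratedFDeriv ℝ m ψ y‖ ≤ A * (1 + s * ‖fderiv ℝ ψ y‖)) →
      (∀ y ∈ S, DerivBound s N a y A) →
      ∃ b : Rn d → ℂ, ContDiff ℝ ∞ b ∧ HasCompactSupport b ∧ tsupport b ⊆ S ∧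
        (∫ y, Complex.exp (Complex.I * ψ y) * a y = ∫ y, Complex.exp (Complex.I * ψ y) * b y) ∧
        ∀ y ∈ S, DerivBound s (N - n) b y (C * ((1 + s * ‖fderiv ℝ ψ y‖)⁻¹) ^ n) := by
    intro n
    induction n with
    | zero =>
      intro _
      refine ⟨A, by linarith, ?_⟩
      intro s ψ a S hs hψ ha hac haS hp hb
      exact ⟨a, ha, hac, haS, rfl, fun y hy => by simpa using hb y hy⟩
    | succ n ih =>
      intro hn
      obtain ⟨C, hC, hstep⟩ := ih (by omega)
      obtain ⟨C', hC', htr⟩ := derivBound_phaseTranspose d (N - (n + 1)) hA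
      refine ⟨C' * C, by positivity, ?_⟩
      intro s ψ a S hs hψ ha hac haS hp hb
      obtain ⟨b, hbc, hbs, hbS, hint, hbb⟩ := hstep hs hψ ha hac haS hp hb
      refine ⟨phaseTranspose s ψ b, contDiff_phaseTranspose hψ hbc,
        hbs.mono' ((subset_tsupport _).trans tsupport_phaseTranspose_subset),
        tsupport_phaseTranspose_subset.trans hbS,
        hint.trans (integral_exp_phaseTranspose hψ hbc hbs), fun y hy => ?_⟩
      have h1 := hbb y hy
      rw [show N - n = N - (n + 1) + 1 by omega] at h1
      refine (htr hs hψ hbc (fun m h1 h2 => hp y hy m h1 (by omega)) h1).mono (le_of_eq ?_)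
      ring
  obtain ⟨C, hC, h⟩ := step N le_rfl
  refine ⟨C, hC, ?_⟩
  intro s ψ a S hs hψ ha hac hSm haS hp hb
  obtain ⟨b, hbc, hbs, hbS, hint, hbb⟩ := h hs hψ ha hac haS hp hb
  rw [hint]
  calc ‖∫ y, Complex.exp (Complex.I * ψ y) * b y‖ₑ
      ≤ ∫⁻ y, ‖Complex.exp (Complex.I * ψ y) * b y‖ₑ := enorm_integral_le_lintegral_enorm _
    _ = ∫⁻ y in S, ‖Complex.exp (Complex.I * ψ y) * b y‖ₑ := by
        rw [setLIntegral_eq_of_support_subset]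
        intro y hy
        refine hbS (subset_tsupport _ ?_)
        rw [Function.mem_support] at hy ⊢
        contrapose! hy
        simp [hy]
    _ ≤ ∫⁻ y in S, ENNReal.ofReal C *
          ENNReal.ofReal (((1 + s * ‖fderiv ℝ ψ y‖)⁻¹) ^ N) := by
        refine setLIntegral_mono' hSm fun y hy => ?_
        rw [← ENNReal.ofReal_mul hC, ← ofReal_norm]
        refine ENNReal.ofReal_le_ofReal ?_
        rw [norm_mul, mul_comm Complex.I, Complex.norm_exp_ofReal_mul_I, one_mul]
        exact (hbb y hy).norm_le
    _ = _ := lintegral_const_mul' _ _ ENNReal.ofReal_ne_top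

end NonstationaryPhase

end

noncomputable section

/-! ### Integral operators on `L²`: adjoints, Schur's test, `T T*`, and cubes. -/

section KernelOperators

open scoped ComplexConjugate

variable {d : ℕ}

/-- The integral operator with kernel `k`. -/
def kernelOp (k : Rn d × Rn d → ℂ) (f : Rn d → ℂ) (x : Rn d) : ℂ := ∫ y, k (x, y) * f y

/-- The kernel of the adjoint. -/
def adjKernel (k : Rn d × Rn d → ℂ) (p : Rn d × Rn d) : ℂ := conj (k (p.2, p.1))

/-- The kernel of a composition. -/
def compKernel (k l : Rn d × Rn d → ℂ) (p : Rn d × Rn d) : ℂ := ∫ y, k (p.1, y) * l (y, p.2)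

/-- The square of the `L²` norm. -/
def sqNorm (f : Rn d → ℂ) : ℝ := ∫ x, ‖f x‖ ^ 2

lemma sqNorm_nonneg (f : Rn d → ℂ) : 0 ≤ sqNorm f := integral_nonneg fun _ => by positivity

lemma MeasureTheory.MemLp.integrable_sq_norm {f : Rn d → ℂ} (hf : MemLp f 2 volume) :
    Integrable (fun x => ‖f x‖ ^ 2) := by
  simpa using hf.integrable_norm_pow (by norm_num)

lemma ofReal_sqNorm {f : Rn d → ℂ} (hf : MemLp f 2 volume) :
    ENNReal.ofReal (sqNorm f) = ∫⁻ x, ‖f x‖ₑ ^ 2 := by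
  rw [sqNorm, ofReal_integral_eq_lintegral_ofReal hf.integrable_sq_norm
    (Filter.Eventually.of_forall fun _ => by positivity)]
  refine lintegral_congr fun x => ?_
  rw [ENNReal.ofReal_pow (norm_nonneg _), ofReal_norm]

variable {k l : Rn d × Rn d → ℂ}

lemma exists_norm_le_of_compactSupport (hk : Continuous k) (hkc : HasCompactSupport k) :
    ∃ C, 0 ≤ C ∧ ∀ p, ‖k p‖ ≤ C := by
  obtain ⟨C, hC⟩ := hkc.exists_bound_of_continuous hk
  exact ⟨C, (norm_nonneg _).trans (hC 0), hC⟩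

lemma continuous_adjKernel (hk : Continuous k) : Continuous (adjKernel k) :=
  Complex.continuous_conj.comp (hk.comp continuous_swap)

lemma hasCompactSupport_adjKernel (hkc : HasCompactSupport k) :
    HasCompactSupport (adjKernel k) := by
  have h1 : HasCompactSupport (k ∘ (Homeomorph.prodComm (Rn d) (Rn d))) :=
    hkc.comp_homeomorph _
  exact h1.mono fun p hp => by
    rw [Function.mem_support] at hp ⊢
    exact fun h => hp (by
      have h' : k (p.2, p.1) = 0 := h
      simp [adjKernel, h'])

/-- The projections of the support of `k` are compact, hence of finite measure, and there `L²`
functions are integrable. This justifies the uses of Fubini for adjoints and compositions. -/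
lemma integrable_kernel_mul (hk : Continuous k) (hkc : HasCompactSupport k) {f g : Rn d → ℂ}
    (hf : MemLp f 2 volume) (hg : MemLp g 2 volume) :
    Integrable (fun p : Rn d × Rn d => k p * (g p.1 * f p.2)) (volume.prod volume) := by
  obtain ⟨C, _, hC⟩ := exists_norm_le_of_compactSupport hk hkc
  have hK1 : IsCompact (Prod.fst '' tsupport k) := hkc.isCompact.image continuous_fst
  have hK2 : IsCompact (Prod.snd '' tsupport k) := hkc.isCompact.image continuous_snd
  set K1 := Prod.fst '' tsupport k
  set K2 := Prod.snd '' tsupport k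
  have hloc : ∀ {K : Set (Rn d)} {h : Rn d → ℂ}, IsCompact K → MemLp h 2 volume →
      Integrable (K.indicator h) := by
    intro K h hK hh
    rw [integrable_indicator_iff hK.measurableSet]
    have _hfin : IsFiniteMeasure (volume.restrict K) :=
      ⟨by simpa using hK.measure_lt_top⟩
    exact (hh.restrict K).integrable (by norm_num)
  have h1 := (hloc hK1 hg).mul_prod (hloc hK2 hf)
  have h2 := h1.bdd_mul (c := C) hk.aestronglyMeasurable (Filter.Eventually.of_forall hC)
  refine h2.congr (Filter.Eventually.of_forall fun p => ?_)
  by_cases hp : p ∈ tsupport k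
  · have e1 : p.1 ∈ K1 := ⟨p, hp, rfl⟩
    have e2 : p.2 ∈ K2 := ⟨p, hp, rfl⟩
    simp [Set.indicator_of_mem e1, Set.indicator_of_mem e2]
  · simp [image_eq_zero_of_notMem_tsupport hp]

lemma memLp_slice (hk : Continuous k) (hkc : HasCompactSupport k) (x : Rn d) :
    MemLp (fun y => k (x, y)) 2 volume := by
  refine Continuous.memLp_of_hasCompactSupport (by fun_prop) ?_
  refine HasCompactSupport.of_support_subset_isCompact
    (hkc.isCompact.image continuous_snd) fun y hy => ?_
  exact ⟨(x, y), subset_tsupport _ hy, rfl⟩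

lemma integrable_slice_mul (hk : Continuous k) (hkc : HasCompactSupport k) {f : Rn d → ℂ}
    (hf : MemLp f 2 volume) (x : Rn d) : Integrable (fun y => k (x, y) * f y) :=
  (memLp_slice hk hkc x).integrable_mul hf

lemma kernelOp_sum (hk : Continuous k) (hkc : HasCompactSupport k) {ι : Type*} (u : Finset ι)
    {f : ι → Rn d → ℂ} (hf : ∀ i, MemLp (f i) 2 volume) (x : Rn d) :
    kernelOp k (fun y => ∑ i ∈ u, f i y) x = ∑ i ∈ u, kernelOp k (f i) x := by
  simp only [kernelOp, Finset.mul_sum]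
  exact integral_finsetSum _ fun i _ => integrable_slice_mul hk hkc (hf i) x

lemma memLp_kernelOp (hk : Continuous k) (hkc : HasCompactSupport k) {f : Rn d → ℂ}
    (hf : MemLp f 2 volume) : MemLp (kernelOp k f) 2 volume := by
  have hmeas : AEStronglyMeasurable (kernelOp k f) volume := by
    have : AEStronglyMeasurable (fun p : Rn d × Rn d => k p * f p.2) (volume.prod volume) :=
      hk.aestronglyMeasurable.mul hf.1.comp_snd
    exact this.integral_prod_right'
  obtain ⟨C, hC0, hC⟩ := exists_norm_le_of_compactSupport hk hkc
  have hK1 : IsCompact (Prod.fst '' tsupport k) := hkc.isCompact.image continuous_fst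
  have hK2 : IsCompact (Prod.snd '' tsupport k) := hkc.isCompact.image continuous_snd
  set K1 := Prod.fst '' tsupport k
  set K2 := Prod.snd '' tsupport k
  have _hfin : IsFiniteMeasure (volume.restrict K2) := ⟨by simpa using hK2.measure_lt_top⟩
  have hfi : IntegrableOn f K2 := (hf.restrict K2).integrable (by norm_num)
  have hbd : ∀ x, ‖kernelOp k f x‖ ≤ ‖K1.indicator (fun _ => C * ∫ y in K2, ‖f y‖) x‖ := by
    intro x
    by_cases hx : x ∈ K1
    · rw [Set.indicator_of_mem hx, Real.norm_of_nonneg (by positivity), kernelOp]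
      have : ∫ y, k (x, y) * f y = ∫ y in K2, k (x, y) * f y := by
        rw [setIntegral_eq_integral_of_forall_compl_eq_zero]
        intro y hy
        have : (x, y) ∉ tsupport k := fun h => hy ⟨_, h, rfl⟩
        simp [image_eq_zero_of_notMem_tsupport this]
      rw [this, ← integral_const_mul]
      refine norm_integral_le_of_norm_le (hfi.norm.const_mul C)
        (Filter.Eventually.of_forall fun y => ?_)
      rw [norm_mul]
      gcongr
      exact hC _
    · have : ∀ y, k (x, y) = 0 := fun y =>
        image_eq_zero_of_notMem_tsupport fun h => hx ⟨_, h, rfl⟩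
      simp [kernelOp, this]
  exact MemLp.of_le (memLp_indicator_const 2 hK1.measurableSet _ (Or.inr hK1.measure_lt_top.ne))
    hmeas (Filter.Eventually.of_forall hbd)

lemma integral_kernelOp_mul_conj (hk : Continuous k) (hkc : HasCompactSupport k)
    {f g : Rn d → ℂ} (hf : MemLp f 2 volume) (hg : MemLp g 2 volume) :
    ∫ x, kernelOp k f x * conj (g x) = ∫ y, f y * conj (kernelOp (adjKernel k) g y) := by
  have hg' : MemLp (fun x => conj (g x)) 2 volume :=
    hg.star
  have hint := integrable_kernel_mul hk hkc hf hg'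
  have h1 : ∀ x, kernelOp k f x * conj (g x) = ∫ y, k (x, y) * (conj (g x) * f y) := by
    intro x
    rw [kernelOp, ← integral_mul_const]
    exact integral_congr_ae (Filter.Eventually.of_forall fun y => by simp only []; ring)
  have h2 : ∀ y, f y * conj (kernelOp (adjKernel k) g y)
      = ∫ x, k (x, y) * (conj (g x) * f y) := by
    intro y
    rw [kernelOp, ← integral_conj, ← integral_const_mul]
    refine integral_congr_ae (Filter.Eventually.of_forall fun x => ?_)
    simp only [adjKernel, map_mul, Complex.conj_conj]; ring
  simp_rw [h1, h2]
  exact integral_integral_swap hint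

lemma kernelOp_kernelOp (hk : Continuous k) (hkc : HasCompactSupport k) (hl : Continuous l)
    (hlc : HasCompactSupport l) {f : Rn d → ℂ} (hf : MemLp f 2 volume) (x : Rn d) :
    kernelOp k (kernelOp l f) x = kernelOp (compKernel k l) f x := by
  have hint := integrable_kernel_mul hl hlc hf (memLp_slice hk hkc x)
  have h1 : ∀ y, k (x, y) * kernelOp l f y = ∫ z, l (y, z) * (k (x, y) * f z) := by
    intro y
    rw [kernelOp, ← integral_const_mul]
    exact integral_congr_ae (Filter.Eventually.of_forall fun z => by simp only []; ring)
  have h2 : ∀ z, compKernel k l (x, z) * f z = ∫ y, l (y, z) * (k (x, y) * f z) := by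
    intro z
    rw [compKernel, ← integral_mul_const]
    exact integral_congr_ae (Filter.Eventually.of_forall fun z => by simp only []; ring)
  rw [kernelOp, kernelOp]
  simp_rw [h1, h2]
  exact integral_integral_swap hint

lemma stronglyMeasurable_compKernel (hk : Continuous k) (hl : Continuous l) :
    StronglyMeasurable (compKernel k l) := by
  have : StronglyMeasurable (fun q : (Rn d × Rn d) × Rn d => k (q.1.1, q.2) * l (q.2, q.1.2)) :=
    (by fun_prop : Continuous _).stronglyMeasurable
  exact this.integral_prod_right

/-- Young's inequality with a free parameter takes the place of Cauchy–Schwarz and keeps everything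
in terms of squared norms. -/
lemma norm_integral_mul_conj_le {f g : Rn d → ℂ} (hf : MemLp f 2 volume)
    (hg : MemLp g 2 volume) {t : ℝ} (ht : 0 < t) :
    ‖∫ x, f x * conj (g x)‖ ≤ (t * sqNorm f + t⁻¹ * sqNorm g) / 2 := by
  have h1 := (hf.integrable_sq_norm.const_mul t)
  have h2 := (hg.integrable_sq_norm.const_mul t⁻¹)
  calc ‖∫ x, f x * conj (g x)‖ ≤ ∫ x, (t * ‖f x‖ ^ 2 + t⁻¹ * ‖g x‖ ^ 2) / 2 := by
        refine norm_integral_le_of_norm_le ((h1.add h2).div_const 2)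
          (Filter.Eventually.of_forall fun x => ?_)
        rw [norm_mul, RCLike.norm_conj]
        have h3 : t⁻¹ * (t * ‖f x‖ - ‖g x‖) ^ 2 = t * ‖f x‖ ^ 2 + t⁻¹ * ‖g x‖ ^ 2
            - 2 * (‖f x‖ * ‖g x‖) := by field_simp; ring
        have h4 : 0 ≤ t⁻¹ * (t * ‖f x‖ - ‖g x‖) ^ 2 := by positivity
        linarith
    _ = _ := by
        rw [integral_div, integral_add h1 h2, integral_const_mul, integral_const_mul]; rfl

lemma integral_mul_conj_self (f : Rn d → ℂ) : ∫ x, f x * conj (f x) = (sqNorm f : ℂ) := by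
  rw [sqNorm, ← integral_complex_ofReal]
  refine integral_congr_ae (Filter.Eventually.of_forall fun x => ?_)
  simp only [Complex.mul_conj, Complex.normSq_eq_norm_sq]

lemma norm_integral_mul_conj_self (f : Rn d → ℂ) : ‖∫ x, f x * conj (f x)‖ = sqNorm f := by
  rw [integral_mul_conj_self, Complex.norm_real, Real.norm_of_nonneg (sqNorm_nonneg f)]

lemma ENNReal.two_mul_le_sq_add_sq (a b : ENNReal) : 2 * (a * b) ≤ a ^ 2 + b ^ 2 := by
  rcases eq_or_ne a ⊤ with rfl | ha
  · simp
  rcases eq_or_ne b ⊤ with rfl | hb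
  · simp
  lift a to NNReal using ha
  lift b to NNReal using hb
  norm_cast
  rw [← NNReal.coe_le_coe]
  push_cast
  nlinarith [sq_nonneg ((a : ℝ) - b)]

/-- **Schur's test** for a quadratic form. -/
lemma norm_integral_kernelOp_mul_conj_le {K : Rn d × Rn d → ℂ} (hK : StronglyMeasurable K)
    {B : ℝ} (hB : 0 ≤ B) (h1 : ∀ x, ∫⁻ z, ‖K (x, z)‖ₑ ≤ ENNReal.ofReal B)
    (h2 : ∀ z, ∫⁻ x, ‖K (x, z)‖ₑ ≤ ENNReal.ofReal B) {g : Rn d → ℂ} (hg : MemLp g 2 volume) :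
    ‖∫ x, kernelOp K g x * conj (g x)‖ ≤ B * sqNorm g := by
  have hKm : Measurable (fun p => ‖K p‖ₑ) := hK.enorm
  have hgm : AEMeasurable (fun x => ‖g x‖ₑ ^ 2) := hg.1.enorm.pow_const 2
  have hm1 : AEMeasurable (fun p : Rn d × Rn d => ‖K p‖ₑ * ‖g p.2‖ₑ ^ 2)
      (volume.prod volume) := hKm.aemeasurable.mul hgm.comp_snd
  have hm2 : AEMeasurable (fun p : Rn d × Rn d => ‖K p‖ₑ * ‖g p.1‖ₑ ^ 2)
      (volume.prod volume) := hKm.aemeasurable.mul hgm.comp_fst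
  have e1 : ∫⁻ p, ‖K p‖ₑ * ‖g p.2‖ₑ ^ 2 ∂(volume.prod volume)
      ≤ ENNReal.ofReal B * ∫⁻ x, ‖g x‖ₑ ^ 2 := by
    rw [lintegral_prod_symm _ hm1, ← lintegral_const_mul' _ _ ENNReal.ofReal_ne_top]
    refine lintegral_mono fun z => ?_
    have := lintegral_mul_const (μ := volume) (‖g z‖ₑ ^ 2)
      (hKm.comp (measurable_prodMk_right (y := z)))
    simp only [Function.comp_apply] at this
    simp only [this]
    exact mul_le_mul_left (h2 z) _
  have e2 : ∫⁻ p, ‖K p‖ₑ * ‖g p.1‖ₑ ^ 2 ∂(volume.prod volume)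
      ≤ ENNReal.ofReal B * ∫⁻ x, ‖g x‖ₑ ^ 2 := by
    rw [lintegral_prod _ hm2, ← lintegral_const_mul' _ _ ENNReal.ofReal_ne_top]
    refine lintegral_mono fun x => ?_
    have := lintegral_mul_const (μ := volume) (‖g x‖ₑ ^ 2)
      (hKm.comp (measurable_prodMk_left (x := x)))
    simp only [Function.comp_apply] at this
    simp only [this]
    exact mul_le_mul_left (h1 x) _
  -- From `2ab ≤ a² + b²` the form splits into two halves, each controlled by one marginal of the
  -- kernel.
  have e3 : 2 * ‖∫ x, kernelOp K g x * conj (g x)‖ₑ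
      ≤ 2 * (ENNReal.ofReal B * ∫⁻ x, ‖g x‖ₑ ^ 2) := by
    calc 2 * ‖∫ x, kernelOp K g x * conj (g x)‖ₑ
        ≤ 2 * ∫⁻ x, ∫⁻ z, ‖K (x, z)‖ₑ * (‖g z‖ₑ * ‖g x‖ₑ) := by
          gcongr
          refine (enorm_integral_le_lintegral_enorm _).trans (lintegral_mono fun x => ?_)
          simp only []
          rw [enorm_mul, RCLike.enorm_conj]
          calc ‖kernelOp K g x‖ₑ * ‖g x‖ₑ
              ≤ (∫⁻ z, ‖K (x, z) * g z‖ₑ) * ‖g x‖ₑ := by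
                gcongr; exact enorm_integral_le_lintegral_enorm _
            _ = ∫⁻ z, ‖K (x, z)‖ₑ * (‖g z‖ₑ * ‖g x‖ₑ) := by
                rw [← lintegral_mul_const' _ _ enorm_ne_top]
                exact lintegral_congr fun z => by rw [enorm_mul, mul_assoc]
      _ ≤ ∫⁻ x, ∫⁻ z, (‖K (x, z)‖ₑ * ‖g z‖ₑ ^ 2 + ‖K (x, z)‖ₑ * ‖g x‖ₑ ^ 2) := by
          rw [← lintegral_const_mul' _ _ (by norm_num)]
          refine lintegral_mono fun x => ?_
          simp only []
          rw [← lintegral_const_mul' _ _ (by norm_num)]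
          refine lintegral_mono fun z => ?_
          simp only []
          rw [mul_left_comm, ← mul_add]
          gcongr
          exact ENNReal.two_mul_le_sq_add_sq _ _
      _ = ∫⁻ p, (‖K p‖ₑ * ‖g p.2‖ₑ ^ 2 + ‖K p‖ₑ * ‖g p.1‖ₑ ^ 2) ∂(volume.prod volume) :=
          (lintegral_prod _ (hm1.add hm2)).symm
      _ ≤ 2 * (ENNReal.ofReal B * ∫⁻ x, ‖g x‖ₑ ^ 2) := by
          rw [lintegral_add_left' hm1, two_mul]
          exact add_le_add e1 e2
  rw [ENNReal.mul_le_mul_iff_right (by norm_num) (by norm_num), ← ofReal_sqNorm hg,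
    ← ENNReal.ofReal_mul hB, ← ofReal_norm,
    ENNReal.ofReal_le_ofReal_iff (mul_nonneg hB (sqNorm_nonneg g))] at e3
  exact e3

/-- The `T T*` method. -/
theorem sqNorm_kernelOp_le_of_schur (hk : Continuous k) (hkc : HasCompactSupport k) {B : ℝ}
    (hB : 0 < B)
    (h : ∀ x, ∫⁻ z, ‖∫ y, k (x, y) * conj (k (z, y))‖ₑ ≤ ENNReal.ofReal B)
    {f : Rn d → ℂ} (hf : MemLp f 2 volume) : sqNorm (kernelOp k f) ≤ B * sqNorm f := by
  have hk' := continuous_adjKernel hk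
  have hkc' := hasCompactSupport_adjKernel hkc
  set g := kernelOp k f with hg
  have hgL : MemLp g 2 volume := memLp_kernelOp hk hkc hf
  set u := kernelOp (adjKernel k) g with hu
  have huL : MemLp u 2 volume := memLp_kernelOp hk' hkc' hgL
  -- With `g = T f` and `u = T* g`, one has `‖u‖² = ⟨T T* g, g⟩`, to which Schur's test applies.
  have e1 : sqNorm u ≤ B * sqNorm g := by
    rw [← norm_integral_mul_conj_self u]
    have := integral_kernelOp_mul_conj hk hkc huL hgL
    rw [← hu] at this
    rw [← this, hu]
    simp_rw [kernelOp_kernelOp hk hkc hk' hkc' hgL]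
    -- The kernel of `T T*` is Hermitian, so one marginal bound gives the other.
    have hsym : ∀ x z, ‖compKernel k (adjKernel k) (x, z)‖ₑ
        = ‖compKernel k (adjKernel k) (z, x)‖ₑ := by
      intro x z
      rw [← RCLike.enorm_conj, compKernel, ← integral_conj]
      congr 1
      refine integral_congr_ae (Filter.Eventually.of_forall fun y => ?_)
      simp only [adjKernel, map_mul, Complex.conj_conj]; ring
    refine norm_integral_kernelOp_mul_conj_le (stronglyMeasurable_compKernel hk hk') hB.le
      h (fun z => ?_) hgL
    simp_rw [hsym _ z]
    exact h z
  -- Here `‖g‖² = ⟨f, u⟩`. With the parameter `B`, the term in `u` is at most `‖g‖²/2` and is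
  -- absorbed on the left, which is legitimate because `‖g‖` is finite.
  have e2 : sqNorm g ≤ (B * sqNorm f + B⁻¹ * sqNorm u) / 2 := by
    rw [← norm_integral_mul_conj_self g]
    have := integral_kernelOp_mul_conj hk hkc hf hgL
    rw [← hg, ← hu] at this
    rw [this]
    exact norm_integral_mul_conj_le hf huL hB
  have e3 : B⁻¹ * sqNorm u ≤ sqNorm g := by
    rw [inv_mul_le_iff₀ hB]; exact e1
  linarith

/-- Passing to `T*T` leaves a kernel that only has to be small on the product of the supports. The
price is that `L¹` norms appear instead of `L²` norms. -/
lemma norm_integral_kernelOp_mul_conj_kernelOp_le (hk : Continuous k)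
    (hkc : HasCompactSupport k) {f g : Rn d → ℂ} (hf : MemLp f 2 volume) (hg : MemLp g 2 volume)
    (hfi : Integrable f) (hgi : Integrable g) {τ : ℝ}
    (h : ∀ y z, f y ≠ 0 → g z ≠ 0 → ‖∫ x, conj (k (x, y)) * k (x, z)‖ ≤ τ) :
    ‖∫ x, kernelOp k f x * conj (kernelOp k g x)‖ ≤ τ * ((∫ y, ‖f y‖) * ∫ z, ‖g z‖) := by
  have hk' := continuous_adjKernel hk
  have hkc' := hasCompactSupport_adjKernel hkc
  rw [integral_kernelOp_mul_conj hk hkc hf (memLp_kernelOp hk hkc hg)]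
  simp_rw [kernelOp_kernelOp hk' hkc' hk hkc hg]
  have e1 : ∀ y, ‖f y * conj (kernelOp (compKernel (adjKernel k) k) g y)‖
      ≤ ‖f y‖ * (τ * ∫ z, ‖g z‖) := by
    intro y
    rw [norm_mul, RCLike.norm_conj]
    by_cases hy : f y = 0
    · simp [hy]
    gcongr
    rw [kernelOp, ← integral_const_mul]
    refine norm_integral_le_of_norm_le (hgi.norm.const_mul τ)
      (Filter.Eventually.of_forall fun z => ?_)
    rw [norm_mul]
    by_cases hz : g z = 0
    · simp [hz]
    gcongr
    exact h y z hy hz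
  calc _ ≤ ∫ y, ‖f y‖ * (τ * ∫ z, ‖g z‖) :=
        norm_integral_le_of_norm_le (hfi.norm.mul_const _) (Filter.Eventually.of_forall e1)
    _ = _ := by rw [integral_mul_const]; ring

lemma sq_integral_norm_le {f : Rn d → ℂ} (hf : MemLp f 2 volume) {Y : Set (Rn d)}
    (hYf : volume Y ≠ ⊤) (hfY : ∀ y, f y ≠ 0 → y ∈ Y) :
    (∫ y, ‖f y‖) ^ 2 ≤ volume.real Y * sqNorm f := by
  have _hfin : IsFiniteMeasure (volume.restrict Y) := ⟨by simpa using hYf.lt_top⟩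
  have hfi : IntegrableOn f Y := (hf.restrict Y).integrable (by norm_num)
  have e1 : ∫ y, ‖f y‖ = ∫ y in Y, ‖f y‖ := by
    rw [setIntegral_eq_integral_of_forall_compl_eq_zero]
    intro y hy
    by_contra h
    exact hy (hfY y (by simpa using h))
  have e2 : sqNorm f = ∫ y in Y, ‖f y‖ ^ 2 := by
    rw [sqNorm, setIntegral_eq_integral_of_forall_compl_eq_zero]
    intro y hy
    by_contra h
    exact hy (hfY y (by simpa using h))
  set I := ∫ y, ‖f y‖
  set V := volume.real Y
  -- Cauchy–Schwarz from the nonnegative quadratic `∫_Y (|f| - t)²`, to be evaluated at its minimum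
  -- `t = I / V`.
  have e3 : ∀ t : ℝ, 0 ≤ sqNorm f - 2 * t * I + t ^ 2 * V := by
    intro t
    have h1 : ∫ y in Y, (‖f y‖ - t) ^ 2 = sqNorm f - 2 * t * I + t ^ 2 * V := by
      have : ∀ y, (‖f y‖ - t) ^ 2 = (‖f y‖ ^ 2 - 2 * t * ‖f y‖) + t ^ 2 := fun y => by ring
      simp_rw [this]
      have i1 : IntegrableOn (fun y => ‖f y‖ ^ 2) Y := hf.integrable_sq_norm.integrableOn
      have i2 : IntegrableOn (fun y => 2 * t * ‖f y‖) Y := hfi.norm.const_mul _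
      have i3 : IntegrableOn (fun y => ‖f y‖ ^ 2 - 2 * t * ‖f y‖) Y := i1.sub i2
      rw [integral_add i3 (integrable_const _), integral_sub i1 i2, integral_const_mul,
        ← e1, ← e2]
      simp [V, Measure.real, mul_comm]
    rw [← h1]
    exact integral_nonneg fun _ => by positivity
  have hV : 0 ≤ V := measureReal_nonneg
  rcases hV.eq_or_lt with hV0 | hVpos
  · have h0 : volume Y = 0 := by
      rcases (ENNReal.toReal_eq_zero_iff _).mp hV0.symm with h | h
      · exact h
      · exact absurd h hYf
    have : I = 0 := by rw [e1, Measure.restrict_eq_zero.mpr h0, integral_zero_measure]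
    rw [this, ← hV0]; simp
  · have := e3 (I / V)
    have h2 : sqNorm f - 2 * (I / V) * I + (I / V) ^ 2 * V = sqNorm f - I ^ 2 / V := by
      field_simp; ring
    rw [h2] at this
    have h3 : I ^ 2 / V ≤ sqNorm f := by linarith
    rwa [div_le_iff₀ hVpos, mul_comm] at h3

/-- The index of the cube of side `r` containing `y`. -/
def cubeIndex (r : ℝ) (y : Rn d) (i : Fin d) : ℤ := ⌊y i / r⌋

lemma measurable_cubeIndex (r : ℝ) : Measurable (cubeIndex r : Rn d → Fin d → ℤ) := by
  refine measurable_pi_lambda _ fun i => ?_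
  have : Measurable (fun y : Rn d => y i / r) := by
    refine Measurable.div_const ?_ r
    exact (by fun_prop : Continuous fun y : Rn d => y i).measurable
  exact Int.measurable_floor.comp this

lemma norm_coord_le (y : Rn d) (i : Fin d) : |y i| ≤ ‖y‖ := PiLp.norm_apply_le y i

lemma norm_le_of_cubeIndex_eq {r : ℝ} (hr : 0 < r) {y z : Rn d}
    (h : cubeIndex r y = cubeIndex r z) : ‖y - z‖ ≤ d * r := by
  have h1 : ∀ i, |(y - z) i| ≤ r := by
    intro i
    have h2 : ⌊y i / r⌋ = ⌊z i / r⌋ := congrFun h i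
    have h3 := Int.abs_sub_lt_one_of_floor_eq_floor h2
    rw [← sub_div, abs_div, abs_of_pos hr, div_lt_one hr] at h3
    exact h3.le
  calc ‖y - z‖ = Real.sqrt (∑ i, ‖(y - z) i‖ ^ 2) := EuclideanSpace.norm_eq _
    _ ≤ ∑ i, ‖(y - z) i‖ := by
        refine Real.sqrt_le_iff.mpr ⟨Finset.sum_nonneg fun _ _ => norm_nonneg _, ?_⟩
        exact Finset.sum_sq_le_sq_sum_of_nonneg fun i _ => norm_nonneg _
    _ ≤ ∑ _i : Fin d, r := Finset.sum_le_sum fun i _ => h1 i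
    _ = d * r := by simp

lemma le_norm_of_cubeIndex {r : ℝ} (hr : 0 < r) {y z : Rn d} {i : Fin d}
    (h : 1 < |cubeIndex r y i - cubeIndex r z i|) : r ≤ ‖y - z‖ := by
  refine le_trans ?_ (norm_coord_le (y - z) i)
  have h1 := Int.floor_le (y i / r)
  have h2 := Int.lt_floor_add_one (y i / r)
  have h3 := Int.floor_le (z i / r)
  have h4 := Int.lt_floor_add_one (z i / r)
  have h5 : (y - z) i = r * (y i / r - z i / r) := by
    rw [PiLp.sub_apply]; field_simp
  rw [h5, abs_mul, abs_of_pos hr]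
  refine le_mul_of_one_le_right hr.le ?_
  have h6 : (2 : ℤ) ≤ |⌊y i / r⌋ - ⌊z i / r⌋| := h
  rcases le_abs.mp h6 with h7 | h7
  · have : (2 : ℝ) ≤ ⌊y i / r⌋ - ⌊z i / r⌋ := by exact_mod_cast h7
    exact le_abs.mpr (Or.inl (by linarith))
  · have : (2 : ℝ) ≤ -(⌊y i / r⌋ - ⌊z i / r⌋) := by exact_mod_cast h7
    exact le_abs.mpr (Or.inr (by linarith))

lemma finite_cubeIndex_image {r : ℝ} (hr : 0 < r) {Y : Set (Rn d)} (hY : Bornology.IsBounded Y) :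
    (cubeIndex r '' Y).Finite := by
  obtain ⟨R, hR⟩ := hY.exists_norm_le
  refine (Set.Finite.pi' (t := fun _ : Fin d => Set.Icc ⌊-R / r⌋ ⌊R / r⌋)
    fun i => Set.finite_Icc _ _).subset ?_
  rintro _ ⟨y, hy, rfl⟩ i
  have := abs_le.mp ((norm_coord_le y i).trans (hR y hy))
  exact ⟨Int.floor_le_floor (by gcongr; exact this.1), Int.floor_le_floor (by gcongr; exact this.2)⟩

lemma card_neighbours_le (I : Finset (Fin d → ℤ)) (n : Fin d → ℤ) :
    (I.filter fun m => ∀ i, |n i - m i| ≤ 1).card ≤ 3 ^ d := by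
  classical
  calc _ ≤ (Fintype.piFinset fun i => Finset.Icc (n i - 1) (n i + 1)).card := by
        refine Finset.card_le_card fun m hm => ?_
        rw [Fintype.mem_piFinset]
        intro i
        have := abs_le.mp ((Finset.mem_filter.mp hm).2 i)
        rw [Finset.mem_Icc]
        constructor <;> linarith [this.1, this.2]
    _ = 3 ^ d := by
        rw [Fintype.card_piFinset]
        have : ∀ i, (Finset.Icc (n i - 1) (n i + 1)).card = 3 := by
          intro i
          rw [Int.card_Icc]
          have : n i + 1 + 1 - (n i - 1) = 3 := by ring
          rw [this]; rfl
        simp [this]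

/-- Localization to cubes: if far apart cubes are almost orthogonal, it suffices to bound the
operator on functions supported in small balls. -/
theorem sqNorm_kernelOp_le_of_cubes (hk : Continuous k) (hkc : HasCompactSupport k)
    {r B τ : ℝ} (hr : 0 < r) (hτ : 0 ≤ τ) (hB : 0 ≤ B) {Y : Set (Rn d)} (hY : MeasurableSet Y)
    (hYb : Bornology.IsBounded Y) (hkY : ∀ x y, k (x, y) ≠ 0 → y ∈ Y)
    (hnear : ∀ (c : Rn d) (f : Rn d → ℂ), MemLp f 2 volume →
      (∀ y, f y ≠ 0 → ‖y - c‖ ≤ d * r) → sqNorm (kernelOp k f) ≤ B * sqNorm f)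
    (hfar : ∀ y z, r ≤ ‖y - z‖ → ‖∫ x, conj (k (x, y)) * k (x, z)‖ ≤ τ)
    {f : Rn d → ℂ} (hf : MemLp f 2 volume) :
    sqNorm (kernelOp k f) ≤ (3 ^ d * B + τ * volume.real Y) * sqNorm f := by
  classical
  have hYf : volume Y ≠ ⊤ := hYb.measure_lt_top.ne
  set I : Finset (Fin d → ℤ) := (finite_cubeIndex_image hr hYb).toFinset with hI
  set Z : (Fin d → ℤ) → Set (Rn d) := fun n => Y ∩ cubeIndex r ⁻¹' {n} with hZ
  have hZm : ∀ n, MeasurableSet (Z n) := fun n =>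
    hY.inter (measurable_cubeIndex r (measurableSet_singleton n))
  set F : (Fin d → ℤ) → Rn d → ℂ := fun n => (Z n).indicator f with hF
  have hFL : ∀ n, MemLp (F n) 2 volume := fun n => hf.indicator (hZm n)
  have hFZ : ∀ n y, F n y ≠ 0 → y ∈ Z n := fun n y h => Set.mem_of_indicator_ne_zero h
  have _hfin : IsFiniteMeasure (volume.restrict Y) := ⟨by simpa using hYf.lt_top⟩
  have hfY : IntegrableOn f Y := (hf.restrict Y).integrable (by norm_num)
  have hFi : ∀ n, Integrable (F n) := by
    intro n
    exact (integrable_indicator_iff (hZm n)).mpr (hfY.mono_set Set.inter_subset_left)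
  have hsumF : ∀ {G : Type} [AddCommMonoid G] (v : Rn d → G) (y : Rn d), y ∈ Y →
      ∑ n ∈ I, (Z n).indicator v y = v y := by
    intro G _ v y hy
    have h0 : ∀ n ∈ I, n ≠ cubeIndex r y → (Z n).indicator v y = 0 := fun n _ hn =>
      Set.indicator_of_notMem (s := Z n) (a := y) (fun h => hn h.2.symm) v
    have h1 : cubeIndex r y ∉ I → (Z (cubeIndex r y)).indicator v y = 0 := fun h =>
      absurd ((finite_cubeIndex_image hr hYb).mem_toFinset.mpr ⟨y, hy, rfl⟩) h
    refine (Finset.sum_eq_single (cubeIndex r y) h0 h1).trans ?_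
    exact Set.indicator_of_mem (s := Z (cubeIndex r y)) (a := y) ⟨hy, rfl⟩ v
  have hop : ∀ x, kernelOp k f x = ∑ n ∈ I, kernelOp k (F n) x := by
    intro x
    rw [← kernelOp_sum hk hkc I hFL, kernelOp, kernelOp]
    refine integral_congr_ae (Filter.Eventually.of_forall fun y => ?_)
    by_cases hy : y ∈ Y
    · simp only [hF, hsumF f y hy]
    · have : k (x, y) = 0 := by
        by_contra h
        exact hy (hkY x y h)
      simp [this]
  have hsq : ∑ n ∈ I, sqNorm (F n) ≤ sqNorm f := by
    simp only [sqNorm]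
    rw [← integral_finsetSum _ fun n _ => (hFL n).integrable_sq_norm]
    refine integral_mono (integrable_finsetSum _ fun n _ => (hFL n).integrable_sq_norm)
      hf.integrable_sq_norm fun y => ?_
    have hind : ∀ n, ‖F n y‖ ^ 2 = (Z n).indicator (fun y => ‖f y‖ ^ 2) y := by
      intro n
      by_cases h : y ∈ Z n
      · simp [hF, h]
      · simp [hF, h]
    simp only [hind]
    by_cases hy : y ∈ Y
    · exact (hsumF (fun y => ‖f y‖ ^ 2) y hy).le
    · have : ∀ n, (Z n).indicator (fun y => ‖f y‖ ^ 2) y = 0 := fun n =>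
        Set.indicator_of_notMem (fun h => hy h.1) _
      simp only [this, Finset.sum_const_zero]
      positivity
  -- The number of cubes is not bounded uniformly in `r`. The distant interactions are nevertheless
  -- summable, because the `L¹` norms of the disjoint pieces add up to one `L¹` norm over `Y`.
  have hL1 : (∑ n ∈ I, ∫ y, ‖F n y‖) ^ 2 ≤ volume.real Y * sqNorm f := by
    have h1 : ∑ n ∈ I, ∫ y, ‖F n y‖ = ∫ y, ‖Y.indicator f y‖ := by
      rw [← integral_finsetSum _ fun n _ => (hFi n).norm]
      refine integral_congr_ae (Filter.Eventually.of_forall fun y => ?_)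
      have hind : ∀ n, ‖F n y‖ = (Z n).indicator (fun y => ‖f y‖) y := by
        intro n
        by_cases h : y ∈ Z n
        · simp [hF, h]
        · simp [hF, h]
      simp only [hind]
      by_cases hy : y ∈ Y
      · rw [hsumF (fun y => ‖f y‖) y hy, Set.indicator_of_mem hy]
      · have : ∀ n, (Z n).indicator (fun y => ‖f y‖) y = 0 := fun n =>
          Set.indicator_of_notMem (fun h => hy h.1) _
        simp [this, hy]
    rw [h1]
    refine (sq_integral_norm_le (hf.indicator hY) hYf
      fun y h => Set.mem_of_indicator_ne_zero h).trans ?_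
    gcongr
    refine integral_mono (hf.indicator hY).integrable_sq_norm hf.integrable_sq_norm fun y => ?_
    simp only []
    gcongr
    exact norm_indicator_le_norm_self f y
  have hTL : ∀ n, MemLp (kernelOp k (F n)) 2 volume := fun n => memLp_kernelOp hk hkc (hFL n)
  have hTF : ∀ n ∈ I, sqNorm (kernelOp k (F n)) ≤ B * sqNorm (F n) := by
    intro n hn
    obtain ⟨c, hc, rfl⟩ := (finite_cubeIndex_image hr hYb).mem_toFinset.mp hn
    exact hnear c _ (hFL _) fun y hy => norm_le_of_cubeIndex_eq hr (hFZ _ y hy).2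
  -- Cubes that touch, the cube itself included: at most `3^d` for each cube. Any two others are at
  -- distance at least `r`.
  set adj : (Fin d → ℤ) → (Fin d → ℤ) → Prop := fun n m => ∀ i, |n i - m i| ≤ 1 with hadj
  have hpair : ∀ n ∈ I, ∀ m ∈ I, ‖∫ x, kernelOp k (F n) x * conj (kernelOp k (F m) x)‖
      ≤ (if adj n m then B / 2 * sqNorm (F n) + B / 2 * sqNorm (F m) else 0)
        + τ * ((∫ y, ‖F n y‖) * ∫ y, ‖F m y‖) := by
    intro n hn m hm
    have hpos : 0 ≤ τ * ((∫ y, ‖F n y‖) * ∫ y, ‖F m y‖) := by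
      have h1 : ∀ n, 0 ≤ ∫ y, ‖F n y‖ := fun n => integral_nonneg fun _ => norm_nonneg _
      have := h1 n
      have := h1 m
      positivity
    by_cases hnm : adj n m
    · rw [if_pos hnm]
      have h1 := norm_integral_mul_conj_le (hTL n) (hTL m) one_pos
      have h2 := hTF n hn
      have h3 := hTF m hm
      rw [inv_one, one_mul, one_mul] at h1
      linarith
    · rw [if_neg hnm, zero_add]
      refine norm_integral_kernelOp_mul_conj_kernelOp_le hk hkc (hFL n) (hFL m) (hFi n) (hFi m)
        fun y z hy hz => hfar y z ?_
      simp only [hadj, not_forall, not_le] at hnm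
      obtain ⟨i, hi⟩ := hnm
      refine le_norm_of_cubeIndex hr (i := i) ?_
      have h1 : cubeIndex r y = n := (hFZ n y hy).2
      have h2 : cubeIndex r z = m := (hFZ m z hz).2
      rwa [h1, h2]
  have hcount : ∀ (u : (Fin d → ℤ) → ℝ), (∀ n, 0 ≤ u n) → ∀ n ∈ I,
      ∑ m ∈ I, (if adj n m then u n else 0) ≤ 3 ^ d * u n := by
    intro u hu n _
    rw [← Finset.sum_filter, Finset.sum_const, nsmul_eq_mul]
    have h0 := hu n
    gcongr
    exact_mod_cast card_neighbours_le I n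
  have hadjs : ∀ n m, adj n m ↔ adj m n := by
    intro n m
    simp only [hadj]
    exact forall_congr' fun i => by rw [abs_sub_comm]
  have hu0 : ∀ n, 0 ≤ B / 2 * sqNorm (F n) := fun n => by
    have := sqNorm_nonneg (F n)
    positivity
  calc sqNorm (kernelOp k f) = ‖∫ x, kernelOp k f x * conj (kernelOp k f x)‖ :=
        (norm_integral_mul_conj_self _).symm
    _ = ‖∑ n ∈ I, ∑ m ∈ I, ∫ x, kernelOp k (F n) x * conj (kernelOp k (F m) x)‖ := by
        congr 1
        simp_rw [hop, map_sum, Finset.sum_mul_sum]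
        have hi : ∀ n m, Integrable (fun x => kernelOp k (F n) x * conj (kernelOp k (F m) x)) :=
          fun n m => (hTL n).integrable_mul (hTL m).star
        rw [integral_finsetSum _ fun n _ => integrable_finsetSum _ fun m _ => hi n m]
        exact Finset.sum_congr rfl fun n _ => integral_finsetSum _ fun m _ => hi n m
    _ ≤ ∑ n ∈ I, ∑ m ∈ I,
          ((if adj n m then B / 2 * sqNorm (F n) + B / 2 * sqNorm (F m) else 0)
        + τ * ((∫ y, ‖F n y‖) * ∫ y, ‖F m y‖)) := by
        refine (norm_sum_le _ _).trans (Finset.sum_le_sum fun n hn => ?_)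
        exact (norm_sum_le _ _).trans (Finset.sum_le_sum fun m hm => hpair n hn m hm)
    _ = (∑ n ∈ I, ∑ m ∈ I, if adj n m then B / 2 * sqNorm (F n) else 0)
        + (∑ n ∈ I, ∑ m ∈ I, if adj n m then B / 2 * sqNorm (F m) else 0)
        + τ * (∑ n ∈ I, ∫ y, ‖F n y‖) ^ 2 := by
        rw [sq, Finset.sum_mul_sum, Finset.mul_sum, ← Finset.sum_add_distrib,
          ← Finset.sum_add_distrib]
        refine Finset.sum_congr rfl fun n _ => ?_
        rw [Finset.mul_sum, ← Finset.sum_add_distrib, ← Finset.sum_add_distrib]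
        refine Finset.sum_congr rfl fun m _ => ?_
        split_ifs <;> ring
    _ = (∑ n ∈ I, ∑ m ∈ I, if adj n m then B / 2 * sqNorm (F n) else 0)
        + (∑ n ∈ I, ∑ m ∈ I, if adj n m then B / 2 * sqNorm (F n) else 0)
        + τ * (∑ n ∈ I, ∫ y, ‖F n y‖) ^ 2 := by
        congr 2
        rw [Finset.sum_comm]
        simp only [hadjs]
    _ ≤ (∑ n ∈ I, 3 ^ d * (B / 2 * sqNorm (F n))) + (∑ n ∈ I, 3 ^ d * (B / 2 * sqNorm (F n)))
        + τ * (volume.real Y * sqNorm f) := by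
        gcongr with n hn n hn
        · exact hcount _ hu0 n hn
        · exact hcount _ hu0 n hn
    _ = 3 ^ d * B * (∑ n ∈ I, sqNorm (F n)) + τ * (volume.real Y * sqNorm f) := by
        rw [← Finset.mul_sum, ← Finset.mul_sum]; ring
    _ ≤ 3 ^ d * B * sqNorm f + τ * (volume.real Y * sqNorm f) := by gcongr
    _ = _ := by ring

end KernelOperators

end

noncomputable section

/-! ### Derivatives in one group of variables. -/

section Slices

variable {E E' F : Type*} [NormedAddCommGroup E] [NormedSpace ℝ E] [NormedAddCommGroup E']
  [NormedSpace ℝ E'] [NormedAddCommGroup F] [NormedSpace ℝ F]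

lemma norm_compContinuousLinearMap_inr_le {m : ℕ}
    (g : ContinuousMultilinearMap ℝ (fun _ : Fin m => E × E') F) :
    ‖g.compContinuousLinearMap fun _ => ContinuousLinearMap.inr ℝ E E'‖ ≤ ‖g‖ := by
  refine (g.norm_compContinuousLinearMap_le _).trans ?_
  refine mul_le_of_le_one_right (norm_nonneg _) (Finset.prod_le_one (fun _ _ => norm_nonneg _)
    fun _ _ => ?_)
  exact ContinuousLinearMap.norm_inr_le_one ℝ E E'

lemma iteratedFDeriv_slice {f : E × E' → F} (hf : ContDiff ℝ ∞ f) (m : ℕ) (x : E) (y : E') :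
    iteratedFDeriv ℝ m (fun y => f (x, y)) y
      = (iteratedFDeriv ℝ m f (x, y)).compContinuousLinearMap
          fun _ => ContinuousLinearMap.inr ℝ E E' := by
  have h1 : (fun y => f (x, y))
      = (fun q => f ((x, 0) + q)) ∘ ContinuousLinearMap.inr ℝ E E' := by
    funext y; simp
  have h2 : ContDiff ℝ ∞ (fun q => f ((x, 0) + q)) := hf.comp (contDiff_const.add contDiff_id)
  rw [h1, ContinuousLinearMap.iteratedFDeriv_comp_right _ h2 y (by exact_mod_cast le_top),
    iteratedFDeriv_comp_add_left]
  simp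

lemma DerivBound.slice {f : E × E' → F} {s B : ℝ} {M : ℕ} {x : E} {y : E'} (hs : 0 ≤ s)
    (hf : ContDiff ℝ ∞ f) (h : DerivBound s M f (x, y) B) :
    DerivBound s M (fun y => f (x, y)) y B := by
  intro m hm
  refine le_trans ?_ (h m hm)
  rw [iteratedFDeriv_slice hf]
  gcongr
  exact norm_compContinuousLinearMap_inr_le _

lemma exists_lipschitz_iteratedFDeriv {f : E → F} (hf : ContDiff ℝ ∞ f) {K : Set E}
    (hK : IsCompact K) (hKc : Convex ℝ K) (m : ℕ) :
    ∃ L, 0 ≤ L ∧ ∀ P ∈ K, ∀ Q ∈ K,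
      ‖iteratedFDeriv ℝ m f P - iteratedFDeriv ℝ m f Q‖ ≤ L * ‖P - Q‖ := by
  obtain ⟨L, hL⟩ := hK.exists_bound_of_continuousOn
    (hf.continuous_iteratedFDeriv (m := m + 1) (by exact_mod_cast le_top)).continuousOn
  refine ⟨max L 0, le_max_right _ _, fun P hP Q hQ => ?_⟩
  refine hKc.norm_image_sub_le_of_norm_fderiv_le (𝕜 := ℝ) (fun z _ => ?_) (fun z hz => ?_) hQ hP
  · exact (hf.differentiable_iteratedFDeriv (m := m) (by exact_mod_cast ENat.natCast_lt_top m)) z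
  · rw [norm_fderiv_iteratedFDeriv]
    exact (hL z hz).trans (le_max_left _ _)

/-- Applied to the phase: every `y` derivative of `φ(x, y) - φ(z, y)` is `O(|x - z|)`. Higher
derivatives of the phase can then be compared with its gradient once the gradient is bounded below
in terms of `|x - z|`. -/
lemma exists_lipschitz_slice {f : E × E' → F} (hf : ContDiff ℝ ∞ f) {K : Set (E × E')}
    (hK : IsCompact K) (hKc : Convex ℝ K) (N : ℕ) :
    ∃ L, 0 ≤ L ∧ ∀ m ≤ N, ∀ x z y, (x, y) ∈ K → (z, y) ∈ K →
      ‖iteratedFDeriv ℝ m (fun y => f (x, y) - f (z, y)) y‖ ≤ L * ‖x - z‖ := by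
  choose L hL0 hL using exists_lipschitz_iteratedFDeriv hf hK hKc
  refine ⟨∑ m ∈ Finset.range (N + 1), L m, Finset.sum_nonneg fun _ _ => hL0 _, ?_⟩
  intro m hm x z y hx hz
  have hsl : ∀ x, ContDiff ℝ ∞ (fun y => f (x, y)) := fun x =>
    hf.comp (contDiff_const.prodMk contDiff_id)
  have h1 : iteratedFDeriv ℝ m (fun y => f (x, y) - f (z, y)) y
      = (iteratedFDeriv ℝ m f (x, y) - iteratedFDeriv ℝ m f (z, y)).compContinuousLinearMap
          fun _ => ContinuousLinearMap.inr ℝ E E' := by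
    have := fun_iteratedFDeriv_sub_apply (i := m) (x := y)
      ((hsl x).of_le (by exact_mod_cast le_top)).contDiffAt
      ((hsl z).of_le (by exact_mod_cast le_top)).contDiffAt
    rw [this, iteratedFDeriv_slice hf, iteratedFDeriv_slice hf]
    ext v; simp
  rw [h1]
  refine (norm_compContinuousLinearMap_inr_le _).trans ((hL m _ hx _ hz).trans ?_)
  have h2 : ‖((x, y) : E × E') - (z, y)‖ = ‖x - z‖ := by simp [Prod.norm_def]
  rw [h2]
  gcongr
  exact Finset.single_le_sum (f := L) (fun _ _ => hL0 _) (Finset.mem_range.mpr (by omega))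

end Slices

/-! ### Symbol estimates for the localized amplitudes. -/

section Amplitudes

variable {E F G : Type*} [NormedAddCommGroup E] [NormedSpace ℝ E] [NormedAddCommGroup F]
  [NormedSpace ℝ F] [NormedAddCommGroup G] [NormedSpace ℝ G]

lemma exists_bound_iteratedFDeriv_of_isCompact {f : E → F} (hf : ContDiff ℝ ∞ f) {K : Set E}
    (hK : IsCompact K) (N : ℕ) :
    ∃ C, 1 ≤ C ∧ ∀ m ≤ N, ∀ P ∈ K, ‖iteratedFDeriv ℝ m f P‖ ≤ C := by
  have h : ∀ m, ∃ C, 0 ≤ C ∧ ∀ P ∈ K, ‖iteratedFDeriv ℝ m f P‖ ≤ C := by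
    intro m
    obtain ⟨C, hC⟩ := hK.exists_bound_of_continuousOn
      (hf.continuous_iteratedFDeriv (m := m) (by exact_mod_cast le_top)).continuousOn
    exact ⟨max C 0, le_max_right _ _, fun P hP => (hC P hP).trans (le_max_left _ _)⟩
  choose C hC0 hC using h
  refine ⟨1 + ∑ m ∈ Finset.range (N + 1), C m, ?_, fun m hm P hP => (hC m P hP).trans ?_⟩
  · have := Finset.sum_nonneg (s := Finset.range (N + 1)) fun m _ => hC0 m
    linarith
  · have := Finset.single_le_sum (f := C) (fun _ _ => hC0 _)
      (Finset.mem_range.mpr (by omega : m < N + 1))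
    linarith

lemma iteratedFDeriv_eq_zero_of_notMem_tsupport {f : E → F} {P : E} (hP : P ∉ tsupport f) (m : ℕ) :
    iteratedFDeriv ℝ m f P = 0 := by
  by_contra h
  exact hP (support_iteratedFDeriv_subset m h)

lemma exists_bound_iteratedFDeriv_of_hasCompactSupport {f : E → F} (hf : ContDiff ℝ ∞ f)
    (hfc : HasCompactSupport f) (N : ℕ) :
    ∃ C, 1 ≤ C ∧ ∀ m ≤ N, ∀ P, ‖iteratedFDeriv ℝ m f P‖ ≤ C := by
  obtain ⟨C, hC1, hC⟩ := exists_bound_iteratedFDeriv_of_isCompact hf hfc.isCompact N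
  refine ⟨C, hC1, fun m hm P => ?_⟩
  by_cases hP : P ∈ tsupport f
  · exact hC m hm P hP
  · rw [iteratedFDeriv_eq_zero_of_notMem_tsupport hP, norm_zero]; linarith

lemma DerivBound.of_norm_le {f : E → F} {P : E} {N : ℕ} {C s : ℝ} (hs : 0 ≤ s) (hs1 : s ≤ 1)
    (h : ∀ m ≤ N, ‖iteratedFDeriv ℝ m f P‖ ≤ C) : DerivBound s N f P C := by
  intro m hm
  exact (mul_le_of_le_one_left (norm_nonneg _) (pow_le_one₀ hs hs1)).trans (h m hm)

/-- A fixed compactly supported profile, rescaled to scale `δ`. -/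
lemma exists_derivBound_rescale {g : F → G} (hg : ContDiff ℝ ∞ g) (hgc : HasCompactSupport g)
    (N : ℕ) (C : ℝ) : ∃ A, 0 ≤ A ∧ ∀ {δ : ℝ} {H : E → F} {P : E}, 0 < δ → δ ≤ 1 → ContDiff ℝ ∞ H →
      (∀ m, 1 ≤ m → m ≤ N → ‖iteratedFDeriv ℝ m H P‖ ≤ C) →
      DerivBound δ N (fun Q => g (δ⁻¹ • H Q)) P A := by
  obtain ⟨Cg, hCg1, hCg⟩ := exists_bound_iteratedFDeriv_of_hasCompactSupport hg hgc N
  refine ⟨N.factorial * Cg * (max C 1) ^ N, by positivity, ?_⟩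
  intro δ H P hδ hδ1 hH hb
  refine DerivBound.comp_left (g := g) (f := fun Q => δ⁻¹ • H Q) (t := Set.univ) hδ
    (hH.const_smul _) (Set.subset_univ _) uniqueDiffOn_univ hg.contDiffOn (le_max_right _ _)
    (fun i hi => by rw [iteratedFDerivWithin_univ]; exact hCg i hi _) fun m hm1 hm => ?_
  have h1 : iteratedFDeriv ℝ m (fun Q => δ⁻¹ • H Q) P = δ⁻¹ • iteratedFDeriv ℝ m H P :=
    iteratedFDeriv_const_smul_apply (hH.of_le (by exact_mod_cast le_top)).contDiffAt
  rw [h1, norm_smul, Real.norm_of_nonneg (by positivity)]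
  -- Since `m ≥ 1`, one of the `m` powers of `δ` cancels the factor `δ⁻¹`. Nothing is needed about
  -- the size of `H` itself, because `g` is bounded together with its derivatives.
  obtain ⟨n, rfl⟩ : ∃ n, m = n + 1 := ⟨m - 1, by omega⟩
  calc δ ^ (n + 1) * (δ⁻¹ * ‖iteratedFDeriv ℝ (n + 1) H P‖)
      = δ ^ n * ‖iteratedFDeriv ℝ (n + 1) H P‖ := by
        rw [pow_succ]; field_simp
    _ ≤ 1 * C := by
        gcongr
        · exact pow_le_one₀ hδ.le hδ1
        · exact hb _ hm1 hm
    _ ≤ max C 1 := by rw [one_mul]; exact le_max_left _ _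

lemma DerivBound.mul_of_notMem {f g : E → ℂ} {P : E} {N : ℕ} {A s : ℝ} (hA : 0 ≤ A)
    (hP : P ∉ tsupport f) : DerivBound s N (fun Q => f Q * g Q) P A := by
  intro m _
  rw [iteratedFDeriv_eq_zero_of_notMem_tsupport]
  · simpa using hA
  · exact fun h => hP (closure_mono (fun Q hQ => left_ne_zero_of_mul hQ) h)

lemma DerivBound.mul {f g : E → ℂ} {P : E} {N : ℕ} {A B s : ℝ} (hs : 0 ≤ s)
    (hf : ContDiff ℝ ∞ f) (hg : ContDiff ℝ ∞ g) (h : DerivBound s N f P A)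
    (h' : DerivBound s N g P B) : DerivBound s N (fun Q => f Q * g Q) P (2 ^ N * A * B) :=
  DerivBound.smul (R := ℂ) (F := ℂ) hs hf hg h h'

/-- The amplitude localized to `|h| ~ δ` obeys symbol estimates at scale `δ`. -/
lemma exists_derivBound_amplitude {σ : E → ℂ} (hσ : ContDiff ℝ ∞ σ) (hσc : HasCompactSupport σ)
    {h : E → ℝ} (hh : ContDiff ℝ ∞ h) {χ : ℝ → ℂ} (hχ : ContDiff ℝ ∞ χ)
    (hχc : HasCompactSupport χ) (N : ℕ) : ∃ A, 0 ≤ A ∧ ∀ δ : ℝ, 0 < δ → δ ≤ 1 → ∀ P,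
      DerivBound δ N (fun Q => σ Q * χ (δ⁻¹ * h Q)) P A := by
  obtain ⟨Cσ, hCσ1, hCσ⟩ := exists_bound_iteratedFDeriv_of_hasCompactSupport hσ hσc N
  obtain ⟨Ch, hCh1, hCh⟩ := exists_bound_iteratedFDeriv_of_isCompact hh hσc.isCompact N
  obtain ⟨A, hA, hres⟩ := exists_derivBound_rescale (E := E) hχ hχc N Ch
  refine ⟨2 ^ N * Cσ * A, by positivity, fun δ hδ hδ1 P => ?_⟩
  by_cases hP : P ∈ tsupport σ
  · have h1 := hres (P := P) hδ hδ1 hh fun m _ hm => hCh m hm P hP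
    have h2 : DerivBound δ N σ P Cσ := DerivBound.of_norm_le hδ.le hδ1 fun m hm => hCσ m hm P
    have h3 : ContDiff ℝ ∞ (fun Q => χ (δ⁻¹ * h Q)) := hχ.comp (hh.const_smul δ⁻¹)
    exact DerivBound.mul hδ.le hσ h3 h2 h1
  · exact DerivBound.mul_of_notMem (by positivity) hP

end Amplitudes

/-! ### Pointwise bound for the kernel of `T T*`. -/

section OscillatoryKernel

open scoped ComplexConjugate

variable {d : ℕ}

/-- The kernel `e^{i lam φ} a`. -/
def oscKernel (lam : ℝ) (φ : Rn d × Rn d → ℝ) (a : Rn d × Rn d → ℂ) (P : Rn d × Rn d) : ℂ :=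
  Complex.exp (Complex.I * ((lam * φ P : ℝ) : ℂ)) * a P

/-- The gradient of `φ` in the second variable. -/
abbrev gradR (φ : Rn d × Rn d → ℝ) (P : Rn d × Rn d) : Rn d := (projR φ P).2

/-- The gradient of `φ` in the first variable. -/
abbrev gradL (φ : Rn d × Rn d → ℝ) (P : Rn d × Rn d) : Rn d := (projL φ P).2

lemma norm_fderiv_phase_diff {φ : Rn d × Rn d → ℝ} (hφ : ContDiff ℝ ∞ φ) {lam : ℝ} (hl : 0 ≤ lam)
    (x z y : Rn d) : ‖fderiv ℝ (fun y => lam * (φ (x, y) - φ (z, y))) y‖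
      = lam * ‖gradR φ (x, y) - gradR φ (z, y)‖ := by
  have hd : ∀ x, DifferentiableAt ℝ (fun y => φ (x, y)) y := fun x =>
    ((hφ.comp (contDiff_const.prodMk contDiff_id)).differentiable (by simp)).differentiableAt
  have h1 : fderiv ℝ (fun y => lam * (φ (x, y) - φ (z, y))) y
      = lam • (fderiv ℝ (fun y => φ (x, y)) y - fderiv ℝ (fun y => φ (z, y)) y) := by
    rw [fderiv_const_mul ((hd x).fun_sub (hd z)), fderiv_fun_sub (hd x) (hd z)]
  rw [h1, norm_smul, Real.norm_of_nonneg hl]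
  simp only [gradR, projR, gradient]
  rw [← map_sub, LinearIsometryEquiv.norm_map]

/-- Pointwise bound for the kernel of `T T*`. -/
theorem exists_enorm_oscKernel_mul_conj_le {φ : Rn d × Rn d → ℝ} (hφ : ContDiff ℝ ∞ φ)
    {K : Set (Rn d × Rn d)} (hK : IsCompact K) (hKc : Convex ℝ K) (N : ℕ) (A : ℝ) :
    ∃ C, 0 ≤ C ∧ ∀ {lam s : ℝ} {a : Rn d × Rn d → ℂ} {x z : Rn d}, 0 ≤ lam → 0 < s → s ≤ 1 →
      ContDiff ℝ ∞ a → tsupport a ⊆ K → (∀ P, DerivBound s N a P A) →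
      (∀ y, (x, y) ∈ tsupport a → (z, y) ∈ tsupport a →
        lam * s ^ 2 * ‖x - z‖ ≤ A * (1 + lam * s * ‖gradR φ (x, y) - gradR φ (z, y)‖)) →
      ‖∫ y, oscKernel lam φ a (x, y) * conj (oscKernel lam φ a (z, y))‖ₑ
        ≤ ENNReal.ofReal C * ∫⁻ y in {y | (x, y) ∈ tsupport a ∧ (z, y) ∈ tsupport a},
          ENNReal.ofReal (((1 + lam * s * ‖gradR φ (x, y) - gradR φ (z, y)‖)⁻¹) ^ N) := by
  obtain ⟨L, hL0, hL⟩ := exists_lipschitz_slice hφ hK hKc (N + 1)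
  set A' : ℝ := 1 + L * |A| + 2 ^ N * |A| * |A| with hA'
  have hA'1 : 1 ≤ A' := by
    have h1 : 0 ≤ L * |A| := by positivity
    have h2 : 0 ≤ 2 ^ N * |A| * |A| := by positivity
    linarith
  have hA'2 : L * |A| ≤ A' := by
    have h2 : 0 ≤ 2 ^ N * |A| * |A| := by positivity
    linarith
  have hA'3 : 2 ^ N * |A| * |A| ≤ A' := by
    have h1 : 0 ≤ L * |A| := by positivity
    linarith
  obtain ⟨C, hC, hmain⟩ := nonstationary_phase d N hA'1
  refine ⟨C, hC, ?_⟩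
  intro lam s a x z hl hs hs1 ha haK hab hsep
  set S : Set (Rn d) := {y | (x, y) ∈ tsupport a ∧ (z, y) ∈ tsupport a} with hS
  have hSc : IsClosed S := ((isClosed_tsupport a).preimage (by fun_prop : Continuous fun y => (x, y))).inter
    ((isClosed_tsupport a).preimage (by fun_prop : Continuous fun y => (z, y)))
  have hac : HasCompactSupport a := HasCompactSupport.of_support_subset_isCompact hK
    ((subset_tsupport a).trans haK)
  have hsl : ∀ x, ContDiff ℝ ∞ (fun y => a (x, y)) := fun x =>
    ha.comp (contDiff_const.prodMk contDiff_id)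
  have hslφ : ∀ x, ContDiff ℝ ∞ (fun y => φ (x, y)) := fun x =>
    hφ.comp (contDiff_const.prodMk contDiff_id)
  set ψ : Rn d → ℝ := fun y => lam * (φ (x, y) - φ (z, y)) with hψ
  have hψs : ContDiff ℝ ∞ ψ := contDiff_const.mul ((hslφ x).sub (hslφ z))
  set b : Rn d → ℂ := fun y => a (x, y) * Complex.conjCLE (a (z, y)) with hb
  have hbz : ContDiff ℝ ∞ (fun y => Complex.conjCLE (a (z, y))) :=
    Complex.conjCLE.contDiff.comp (hsl z)
  have hbs : ContDiff ℝ ∞ b := (hsl x).mul hbz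
  have hbS : tsupport b ⊆ S := by
    refine closure_minimal (fun y hy => ?_) hSc
    have h1 : a (x, y) ≠ 0 := left_ne_zero_of_mul hy
    have h2 : a (z, y) ≠ 0 := by
      intro h
      exact right_ne_zero_of_mul hy (by simp [h])
    exact ⟨subset_tsupport _ h1, subset_tsupport _ h2⟩
  have hSK : IsCompact S := by
    refine (hac.isCompact.image continuous_snd).of_isClosed_subset hSc ?_
    exact fun y hy => ⟨_, hy.1, rfl⟩
  have hbc : HasCompactSupport b := HasCompactSupport.of_support_subset_isCompact hSK
    ((subset_tsupport b).trans hbS)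
  have hgrad : ∀ y, s * ‖fderiv ℝ ψ y‖ = lam * s * ‖gradR φ (x, y) - gradR φ (z, y)‖ := by
    intro y
    rw [hψ, norm_fderiv_phase_diff hφ hl]; ring
  have hphase : ∀ y ∈ S, ∀ m, 1 ≤ m → m ≤ N + 1 →
      s ^ m * ‖iteratedFDeriv ℝ m ψ y‖ ≤ A' * (1 + s * ‖fderiv ℝ ψ y‖) := by
    intro y hy m hm1 hm
    -- The first derivative is the gradient itself. For `m ≥ 2` one has `s^m ≤ s²`, and the
    -- separation hypothesis absorbs `lam s² |x - z|`.
    rcases hm1.eq_or_lt with rfl | hm2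
    · rw [norm_iteratedFDeriv_one, pow_one]
      have h1 : 0 ≤ s * ‖fderiv ℝ ψ y‖ := by positivity
      nlinarith
    · have h1 : iteratedFDeriv ℝ m ψ y
          = lam • iteratedFDeriv ℝ m (fun y => φ (x, y) - φ (z, y)) y :=
        iteratedFDeriv_const_smul_apply (a := lam) (f := fun y => φ (x, y) - φ (z, y))
          (((hslφ x).sub (hslφ z)).of_le (by exact_mod_cast le_top)).contDiffAt
      rw [h1, norm_smul, Real.norm_of_nonneg hl, hgrad]
      have h2 := hsep y hy.1 hy.2
      have h3 : s ^ m ≤ s ^ 2 := pow_le_pow_of_le_one hs.le hs1 hm2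
      have h4 : (0 : ℝ) ≤ 1 + lam * s * ‖gradR φ (x, y) - gradR φ (z, y)‖ := by positivity
      calc s ^ m * (lam * ‖iteratedFDeriv ℝ m (fun y => φ (x, y) - φ (z, y)) y‖)
          ≤ s ^ 2 * (lam * (L * ‖x - z‖)) := by
            gcongr
            exact hL m hm x z y (haK hy.1) (haK hy.2)
        _ = L * (lam * s ^ 2 * ‖x - z‖) := by ring
        _ ≤ L * (|A| * (1 + lam * s * ‖gradR φ (x, y) - gradR φ (z, y)‖)) := by
            refine mul_le_mul_of_nonneg_left (h2.trans ?_) hL0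
            gcongr
            exact le_abs_self A
        _ = L * |A| * (1 + lam * s * ‖gradR φ (x, y) - gradR φ (z, y)‖) := by ring
        _ ≤ _ := by gcongr
  have hamp : ∀ y ∈ S, DerivBound s N b y A' := by
    intro y _
    have h1 := ((hab (x, y)).mono (le_abs_self A)).slice hs.le ha
    have h2 := ((hab (z, y)).mono (le_abs_self A)).slice hs.le ha
    have h3 : DerivBound s N (fun y => Complex.conjCLE (a (z, y))) y |A| := by
      intro m hm
      have := LinearIsometryEquiv.norm_iteratedFDeriv_comp_left (𝕜 := ℝ) Complex.conjLIE
        (fun y => a (z, y)) y m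
      have h4 : ((Complex.conjLIE : ℂ → ℂ) ∘ fun y => a (z, y))
        = fun y => Complex.conjCLE (a (z, y)) := rfl
      rw [h4] at this
      rw [this]
      exact h2 m hm
    exact (DerivBound.mul hs.le (hsl x) hbz h1 h3).mono hA'3
  have hfin := hmain hs hψs hbs hbc hSc.measurableSet hbS hphase hamp
  simp only [hgrad] at hfin
  refine le_trans (le_of_eq ?_) hfin
  congr 1
  refine integral_congr_ae (Filter.Eventually.of_forall fun y => ?_)
  simp only [oscKernel, hψ, hb, map_mul, ← Complex.exp_conj, Complex.conj_I, Complex.conj_ofReal,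
    Complex.conjCLE_apply]
  rw [mul_mul_mul_comm, ← Complex.exp_add]
  congr 2
  push_cast
  ring

end OscillatoryKernel

end

noncomputable section

/-! ### Local `L²` bound: distant cubes by `T*T`, a single cube by `T T*`. -/

section LocalEstimate

open scoped ComplexConjugate

variable {d : ℕ}

/-- `σ χ(h / δ)`. -/
def locAmp (σ : Rn d × Rn d → ℂ) (h : Rn d × Rn d → ℝ) (χ : ℝ → ℂ) (δ : ℝ)
    (P : Rn d × Rn d) : ℂ := σ P * χ (δ⁻¹ * h P)

lemma contDiff_locAmp {σ : Rn d × Rn d → ℂ} (hσ : ContDiff ℝ ∞ σ) {h : Rn d × Rn d → ℝ}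
    (hh : ContDiff ℝ ∞ h) {χ : ℝ → ℂ} (hχ : ContDiff ℝ ∞ χ) (δ : ℝ) :
    ContDiff ℝ ∞ (locAmp σ h χ δ) :=
  hσ.mul (hχ.comp (contDiff_const.mul hh))

lemma tsupport_locAmp_subset (σ : Rn d × Rn d → ℂ) (h : Rn d × Rn d → ℝ) (χ : ℝ → ℂ) (δ : ℝ) :
    tsupport (locAmp σ h χ δ) ⊆ tsupport σ :=
  closure_mono fun _ hP => left_ne_zero_of_mul hP

lemma mem_tsupport_of_mem_tsupport_locAmp {σ : Rn d × Rn d → ℂ} {h : Rn d × Rn d → ℝ}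
    (hh : Continuous h) {χ : ℝ → ℂ} {δ : ℝ} {P : Rn d × Rn d}
    (hP : P ∈ tsupport (locAmp σ h χ δ)) : δ⁻¹ * h P ∈ tsupport χ := by
  have h1 : IsClosed ((fun P => δ⁻¹ * h P) ⁻¹' tsupport χ) :=
    (isClosed_tsupport χ).preimage (continuous_const.mul hh)
  have h2 : Function.support (locAmp σ h χ δ) ⊆ (fun P => δ⁻¹ * h P) ⁻¹' tsupport χ :=
    fun Q hQ => subset_tsupport χ (right_ne_zero_of_mul hQ)
  exact closure_minimal h2 h1 hP

lemma hasCompactSupport_locAmp {σ : Rn d × Rn d → ℂ} (hσc : HasCompactSupport σ)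
    (h : Rn d × Rn d → ℝ) (χ : ℝ → ℂ) (δ : ℝ) : HasCompactSupport (locAmp σ h χ δ) :=
  hσc.mono fun _ hP => left_ne_zero_of_mul hP

lemma continuous_oscKernel {φ : Rn d × Rn d → ℝ} (hφ : Continuous φ) {a : Rn d × Rn d → ℂ}
    (ha : Continuous a) (lam : ℝ) : Continuous (oscKernel lam φ a) := by
  unfold oscKernel
  fun_prop

lemma hasCompactSupport_oscKernel {φ : Rn d × Rn d → ℝ} {a : Rn d × Rn d → ℂ}
    (ha : HasCompactSupport a) (lam : ℝ) : HasCompactSupport (oscKernel lam φ a) :=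
  ha.mono fun _ hP => right_ne_zero_of_mul hP

lemma gradR_eq {φ : Rn d × Rn d → ℝ} (hφ : ContDiff ℝ ∞ φ) : gradR φ = fun P =>
    (InnerProductSpace.toDual ℝ (Rn d)).symm
      ((fderiv ℝ φ P).comp (ContinuousLinearMap.inr ℝ (Rn d) (Rn d))) := by
  funext P
  simp only [gradR, projR, gradient]
  congr 1
  have h3 : HasFDerivAt φ (fderiv ℝ φ P) (P.1, P.2) :=
    (hφ.differentiable (by simp)).differentiableAt.hasFDerivAt
  exact (h3.comp P.2 (hasFDerivAt_prodMk_right P.1 P.2)).fderiv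

lemma gradL_eq {φ : Rn d × Rn d → ℝ} (hφ : ContDiff ℝ ∞ φ) : gradL φ = fun P =>
    (InnerProductSpace.toDual ℝ (Rn d)).symm
      ((fderiv ℝ φ P).comp (ContinuousLinearMap.inl ℝ (Rn d) (Rn d))) := by
  funext P
  simp only [gradL, projL, gradient]
  congr 1
  have h3 : HasFDerivAt φ (fderiv ℝ φ P) (P.1, P.2) :=
    (hφ.differentiable (by simp)).differentiableAt.hasFDerivAt
  exact (h3.comp P.1 (hasFDerivAt_prodMk_left P.1 P.2)).fderiv

lemma contDiff_gradR {φ : Rn d × Rn d → ℝ} (hφ : ContDiff ℝ ∞ φ) : ContDiff ℝ ∞ (gradR φ) := by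
  rw [gradR_eq hφ]
  exact (InnerProductSpace.toDual ℝ (Rn d)).symm.contDiff.comp
    ((hφ.fderiv_right (by simp)).clm_comp contDiff_const)

lemma contDiff_gradL {φ : Rn d × Rn d → ℝ} (hφ : ContDiff ℝ ∞ φ) : ContDiff ℝ ∞ (gradL φ) := by
  rw [gradL_eq hφ]
  exact (InnerProductSpace.toDual ℝ (Rn d)).symm.contDiff.comp
    ((hφ.fderiv_right (by simp)).clm_comp contDiff_const)

lemma continuous_gradR {φ : Rn d × Rn d → ℝ} (hφ : ContDiff ℝ ∞ φ) : Continuous (gradR φ) :=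
  (contDiff_gradR hφ).continuous

/-- By Tonelli the `z` integral is done first, with `y` fixed. Changes of variable in `z` are thus
made on one `y` slice at a time, and the `y` integral contributes only the volume of a slice. -/
lemma lintegral_fiber_le {T : Set (Rn d × Rn d)} (hT : IsClosed T) {W : Rn d × Rn d → ENNReal}
    (hW : Measurable W) (x : Rn d) {V : ENNReal}
    (h : ∀ y, (x, y) ∈ T → ∫⁻ z in {z | (z, y) ∈ T}, W (z, y) ≤ V) :
    ∫⁻ z, ∫⁻ y in {y | (x, y) ∈ T ∧ (z, y) ∈ T}, W (z, y) ≤ V * volume {y | (x, y) ∈ T} := by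
  set Tx : Set (Rn d) := {y | (x, y) ∈ T} with hTx
  have hTxc : IsClosed Tx := hT.preimage (by fun_prop)
  calc ∫⁻ z, ∫⁻ y in {y | (x, y) ∈ T ∧ (z, y) ∈ T}, W (z, y)
      = ∫⁻ z, ∫⁻ y in Tx, T.indicator W (z, y) := by
        refine lintegral_congr fun z => ?_
        have hzc : IsClosed {y | (z, y) ∈ T} := hT.preimage (by fun_prop)
        have h1 : {y | (x, y) ∈ T ∧ (z, y) ∈ T} = {y | (z, y) ∈ T} ∩ Tx := by
          ext y; exact and_comm
        rw [h1, ← Measure.restrict_restrict hzc.measurableSet,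
          ← lintegral_indicator hzc.measurableSet]
        rfl
    _ = ∫⁻ y in Tx, ∫⁻ z, T.indicator W (z, y) :=
        lintegral_lintegral_swap (hW.indicator hT.measurableSet).aemeasurable
    _ ≤ ∫⁻ y in Tx, V := by
        refine setLIntegral_mono' hTxc.measurableSet fun y hy => ?_
        refine le_trans (le_of_eq ?_) (h y hy)
        have hyc : IsClosed {z | (z, y) ∈ T} := hT.preimage (by fun_prop)
        rw [← lintegral_indicator hyc.measurableSet]
        rfl
    _ = V * volume Tx := setLIntegral_const _ _

/-- The weight appearing in the kernel bounds. -/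
def oscWeight (φ : Rn d × Rn d → ℝ) (t : ℝ) (N : ℕ) (x : Rn d) (p : Rn d × Rn d) : ENNReal :=
  ENNReal.ofReal (((1 + t * ‖gradR φ (x, p.2) - gradR φ p‖)⁻¹) ^ N)

lemma measurable_oscWeight {φ : Rn d × Rn d → ℝ} (hφ : ContDiff ℝ ∞ φ) {t : ℝ} (ht : 0 ≤ t)
    (N : ℕ) (x : Rn d) : Measurable (oscWeight φ t N x) := by
  have hg : Continuous (gradR φ) := continuous_gradR hφ
  have hg' : Continuous (fun p : Rn d × Rn d => gradR φ (x, p.2)) :=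
    hg.comp (by fun_prop : Continuous fun p : Rn d × Rn d => (x, p.2))
  have : Continuous (fun p : Rn d × Rn d =>
      ((1 + t * ‖gradR φ (x, p.2) - gradR φ p‖)⁻¹) ^ N) := by
    refine Continuous.pow (Continuous.inv₀ ?_ fun p => ?_) _
    · exact continuous_const.add (continuous_const.mul (hg'.sub hg).norm)
    · positivity
  exact (ENNReal.continuous_ofReal.comp this).measurable

/-- A reusable form of the decomposition into cubes: `T*T` controls distant cubes, and `T T*` with
Schur's test a single one. -/
theorem exists_sqNorm_locAmp_le {φ : Rn d × Rn d → ℝ} (hφ : ContDiff ℝ ∞ φ)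
    {K : Set (Rn d × Rn d)} (hK : IsCompact K) (hKc : Convex ℝ K) {σ : Rn d × Rn d → ℂ}
    (hσ : ContDiff ℝ ∞ σ) (hσK : tsupport σ ⊆ K) {h : Rn d × Rn d → ℝ} (hh : ContDiff ℝ ∞ h)
    {χ : ℝ → ℂ} (hχ : ContDiff ℝ ∞ χ) (hχc : HasCompactSupport χ) {C₀ : ℝ}
    (hfold : ∀ x y z, (x, y) ∈ K → (x, z) ∈ K →
      ‖y - z‖ ≤ C₀ * (‖gradL φ (x, y) - gradL φ (x, z)‖ + |h (x, y) - h (x, z)|))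
    (N : ℕ) (A : ℝ) :
    ∃ C, 0 ≤ C ∧ ∀ {lam δ s V : ℝ}, 1 ≤ lam → 0 < s → s ≤ δ → δ ≤ 1 → 0 < V →
      (∀ x z y, (x, y) ∈ tsupport (locAmp σ h χ δ) → (z, y) ∈ tsupport (locAmp σ h χ δ) →
        lam * s ^ 2 * ‖x - z‖ ≤ A * (1 + lam * s * ‖gradR φ (x, y) - gradR φ (z, y)‖)) →
      (∀ x y, (x, y) ∈ tsupport (locAmp σ h χ δ) →
        ∫⁻ z in {z | (z, y) ∈ tsupport (locAmp σ h χ δ)},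
          ENNReal.ofReal (((1 + lam * s * ‖gradR φ (x, y) - gradR φ (z, y)‖)⁻¹) ^ (d + 1))
            ≤ ENNReal.ofReal V) →
      ∀ f, MemLp f 2 volume → sqNorm (kernelOp (oscKernel lam φ (locAmp σ h χ δ)) f)
        ≤ C * (δ ^ d * V + ((lam * δ ^ 2)⁻¹) ^ N) * sqNorm f := by
  have hσc : HasCompactSupport σ := HasCompactSupport.of_support_subset_isCompact hK
    ((subset_tsupport σ).trans hσK)
  obtain ⟨R, hR⟩ := hχc.isCompact.isBounded.exists_norm_le
  set R' := max R 1 with hR'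
  set C₁ := max C₀ 1 with hC₁
  have hC₁1 : 1 ≤ C₁ := le_max_right _ _
  have hC₁0 : 0 < C₁ := by linarith
  have hR'1 : 1 ≤ R' := le_max_right _ _
  -- `ρ` equals one on the ball of radius `d Λ`
  set Λ : ℝ := 4 * C₁ * R' with hΛ
  have hΛ0 : 0 < Λ := by positivity
  let ρ : ContDiffBump (0 : Rn d) := ⟨d * Λ + 1, d * Λ + 2, by positivity, by linarith⟩
  have hρs : ContDiff ℝ ∞ (fun y => ((ρ y : ℝ) : ℂ)) := Complex.ofRealCLM.contDiff.comp ρ.contDiff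
  have hρc : HasCompactSupport (fun y => ((ρ y : ℝ) : ℂ)) :=
    ρ.hasCompactSupport.comp_left (g := fun t : ℝ => (t : ℂ)) (by simp)
  -- Enough derivatives for both integrations by parts: `N` for distant cubes and `d + 1` for an
  -- integrable weight in Schur's test.
  set M := max N (d + 1) with hM
  obtain ⟨A₁, hA₁, hamp⟩ := exists_derivBound_amplitude hσ hσc hh hχ hχc M
  obtain ⟨Cs, hCs1, hCs⟩ := exists_bound_iteratedFDeriv_of_isCompact
    (contDiff_snd (𝕜 := ℝ) (E := Rn d) (F := Rn d) (n := ∞)) hK M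
  obtain ⟨A₂, hA₂, hbump⟩ := exists_derivBound_rescale (E := Rn d × Rn d) hρs hρc M Cs
  set A₃ := max (2 ^ M * A₁ * A₂) (max |A| (max A₁ (2 * C₁))) with hA₃
  obtain ⟨Cn, hCn, hnear⟩ := exists_enorm_oscKernel_mul_conj_le hφ hK hKc (d + 1) A₃
  -- the transposed phase
  set φt : Rn d × Rn d → ℝ := fun P => φ P.swap with hφt
  have hφts : ContDiff ℝ ∞ φt := hφ.comp (contDiff_snd.prodMk contDiff_fst)
  set Kt : Set (Rn d × Rn d) := Prod.swap ⁻¹' K with hKt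
  have hKtc : IsCompact Kt := by
    rw [hKt, ← Set.image_swap_eq_preimage_swap]
    exact hK.image continuous_swap
  have hKtconv : Convex ℝ Kt := hKc.linear_preimage (LinearEquiv.prodComm ℝ (Rn d) (Rn d)).toLinearMap
  -- With `x` and `y` exchanged, the bound for kernels of `T T*` becomes the bound for kernels of
  -- `T*T`.
  obtain ⟨Cf, hCf, hfar⟩ := exists_enorm_oscKernel_mul_conj_le hφts hKtc hKtconv N A₃
  have hK1 : IsCompact (Prod.fst '' K) := hK.image continuous_fst
  have hK2 : IsCompact (Prod.snd '' K) := hK.image continuous_snd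
  set V₁ := volume.real (Prod.fst '' K) with hV₁
  set V₂ := volume.real (Prod.snd '' K) with hV₂
  have hV₁0 : 0 ≤ V₁ := measureReal_nonneg
  have hV₂0 : 0 ≤ V₂ := measureReal_nonneg
  set κ := volume.real (Metric.closedBall (0 : Rn d) (d * Λ + 2)) with hκ
  have hκ0 : 0 < κ := by
    rw [hκ, Measure.real, ENNReal.toReal_pos_iff]
    exact ⟨Metric.measure_closedBall_pos _ _ (by positivity), measure_closedBall_lt_top⟩
  set Cb := 3 ^ d * ((Cn + 1) * κ) + Cf * V₁ * V₂ with hCb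
  refine ⟨Cb, by positivity, ?_⟩
  intro lam δ s V hlam hs hsδ hδ1 hV hH1 hH2 f hf
  have hδ : 0 < δ := hs.trans_le hsδ
  have hs1 : s ≤ 1 := hsδ.trans hδ1
  have hlam0 : 0 < lam := by linarith
  set a := locAmp σ h χ δ with ha
  have has : ContDiff ℝ ∞ a := contDiff_locAmp hσ hh hχ δ
  have hac : HasCompactSupport a := hasCompactSupport_locAmp hσc h χ δ
  have haK : tsupport a ⊆ K := (tsupport_locAmp_subset σ h χ δ).trans hσK
  have hab : ∀ P, DerivBound δ M a P A₁ := hamp δ hδ hδ1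
  set k := oscKernel lam φ a with hk
  have hkc : Continuous k := continuous_oscKernel hφ.continuous has.continuous lam
  have hks : HasCompactSupport k := hasCompactSupport_oscKernel hac lam
  have hkY : ∀ x y, k (x, y) ≠ 0 → y ∈ Prod.snd '' K := fun x y hxy =>
    ⟨(x, y), haK (subset_tsupport _ (right_ne_zero_of_mul hxy)), rfl⟩
  have hhb : ∀ P ∈ tsupport a, |h P| ≤ R' * δ := by
    intro P hP
    have h1 := hR _ (mem_tsupport_of_mem_tsupport_locAmp hh.continuous hP)
    rw [norm_mul, norm_inv, Real.norm_of_nonneg hδ.le, inv_mul_le_iff₀ hδ, Real.norm_eq_abs] at h1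
    calc |h P| ≤ δ * R := h1
      _ ≤ δ * R' := by gcongr; exact le_max_left _ _
      _ = _ := mul_comm _ _
  set τ : ℝ := Cf * V₁ * ((lam * δ ^ 2)⁻¹) ^ N with hτ
  have hτ0 : 0 ≤ τ := by positivity
  set B : ℝ := (Cn + 1) * κ * (δ ^ d * V) with hB
  have hB0 : 0 < B := by positivity
  have key := sqNorm_kernelOp_le_of_cubes hkc hks (r := Λ * δ) (B := B) (τ := τ)
    (by positivity) hτ0 hB0.le hK2.measurableSet hK2.isBounded hkY ?_ ?_ hf
  · refine key.trans (mul_le_mul_of_nonneg_right ?_ (sqNorm_nonneg f))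
    have e1 : 0 ≤ δ ^ d * V := by positivity
    have e2 : 0 ≤ ((lam * δ ^ 2)⁻¹) ^ N := by positivity
    have e3 : 0 ≤ Cf * V₁ * V₂ * (δ ^ d * V) := by positivity
    have e4 : 0 ≤ 3 ^ d * ((Cn + 1) * κ) * ((lam * δ ^ 2)⁻¹) ^ N := by positivity
    rw [← hV₂, hB, hτ, hCb]
    linarith
  · -- a single cube
    intro c f hf hfc
    -- The bump equals `1` where `f` lives, so it does not change `T f`. It confines the kernel to a
    -- `y` ball of radius comparable to `δ`, which is the source of the factor `δ^d`; its
    -- derivatives are of the same order as those of the amplitude at scale `δ`.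
    set b : Rn d × Rn d → ℂ := fun P => a P * ((ρ (δ⁻¹ • (P.2 - c)) : ℝ) : ℂ) with hb
    have hρb : ContDiff ℝ ∞ (fun P : Rn d × Rn d => ((ρ (δ⁻¹ • (P.2 - c)) : ℝ) : ℂ)) :=
      hρs.comp (g := fun y => ((ρ y : ℝ) : ℂ))
        ((contDiff_snd.sub contDiff_const).const_smul δ⁻¹)
    have hbs : ContDiff ℝ ∞ b := has.mul hρb
    have hba : tsupport b ⊆ tsupport a := closure_mono fun P hP => left_ne_zero_of_mul hP
    have hbc : HasCompactSupport b := hac.mono fun P hP => left_ne_zero_of_mul hP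
    have hbball : ∀ P ∈ tsupport b, P.2 ∈ Metric.closedBall c ((d * Λ + 2) * δ) := by
      have hcl : IsClosed (Prod.snd ⁻¹' Metric.closedBall c ((d * Λ + 2) * δ) :
          Set (Rn d × Rn d)) := Metric.isClosed_closedBall.preimage continuous_snd
      refine closure_minimal (fun P hP => ?_) hcl
      have h1 : ρ (δ⁻¹ • (P.2 - c)) ≠ 0 := by
        have := right_ne_zero_of_mul hP
        exact_mod_cast this
      have h2 : δ⁻¹ • (P.2 - c) ∈ Metric.ball (0 : Rn d) (d * Λ + 2) := by
        rw [← ρ.support_eq]; exact h1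
      rw [mem_ball_zero_iff, norm_smul, norm_inv, Real.norm_of_nonneg hδ.le,
        inv_mul_lt_iff₀ hδ] at h2
      show P.2 ∈ Metric.closedBall c ((d * Λ + 2) * δ)
      rw [Metric.mem_closedBall, dist_eq_norm, mul_comm]
      exact h2.le
    have hkb : kernelOp k f = kernelOp (oscKernel lam φ b) f := by
      funext x
      refine integral_congr_ae (Filter.Eventually.of_forall fun y => ?_)
      by_cases hy : f y = 0
      · simp [hy]
      · have h1 : ρ (δ⁻¹ • (y - c)) = 1 := by
          refine ρ.one_of_mem_closedBall ?_
          rw [mem_closedBall_zero_iff, norm_smul, norm_inv, Real.norm_of_nonneg hδ.le,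
            inv_mul_le_iff₀ hδ]
          have h2 := hfc y hy
          show ‖y - c‖ ≤ δ * (d * Λ + 1)
          nlinarith
        simp [hk, oscKernel, hb, h1]
    rw [hkb]
    refine sqNorm_kernelOp_le_of_schur (continuous_oscKernel hφ.continuous hbs.continuous lam)
      (hasCompactSupport_oscKernel hbc lam) hB0 (fun x => ?_) hf
    have hbd : ∀ P, DerivBound s (d + 1) b P A₃ := by
      intro P
      have h0 : DerivBound δ M b P A₃ := by
        by_cases hP : P ∈ tsupport a
        · have h1 := hbump (H := fun P : Rn d × Rn d => P.2 - c) (P := P) hδ hδ1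
            (contDiff_snd.sub contDiff_const) fun m hm1 hm => by
              have h2 : iteratedFDeriv ℝ m (fun P : Rn d × Rn d => P.2 - c) P
                  = iteratedFDeriv ℝ m (fun P : Rn d × Rn d => P.2) P := by
                obtain ⟨n, rfl⟩ : ∃ n, m = n + 1 := ⟨m - 1, by omega⟩
                rw [fun_iteratedFDeriv_sub_apply contDiff_snd.contDiffAt
                  contDiff_const.contDiffAt]
                simp [iteratedFDeriv_succ_const]
              rw [h2]
              exact hCs m hm P (haK hP)
          exact (DerivBound.mul hδ.le has hρb (hab P) h1).mono (le_max_left _ _)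
        · exact DerivBound.mul_of_notMem
            ((by positivity : (0:ℝ) ≤ 2 ^ M * A₁ * A₂).trans (le_max_left _ _)) hP
      intro m hm
      refine le_trans ?_ (h0 m (hm.trans (le_max_right _ _)))
      gcongr
    have hker := fun z => hnear (lam := lam) (a := b) (x := x) (z := z) hlam0.le hs hs1 hbs
      (hba.trans haK) hbd fun y h1 h2 => (hH1 x z y (hba h1) (hba h2)).trans (by
        gcongr
        exact (le_abs_self A).trans ((le_max_left _ _).trans (le_max_right _ _)))
    have hfib : ∀ y, (x, y) ∈ tsupport b →
        ∫⁻ z in {z | (z, y) ∈ tsupport b}, oscWeight φ (lam * s) (d + 1) x (z, y)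
          ≤ ENNReal.ofReal V := fun y hy =>
      (lintegral_mono_set (s := {z | (z, y) ∈ tsupport b}) (t := {z | (z, y) ∈ tsupport a})
        fun z hz => hba hz).trans (hH2 x y (hba hy))
    have hvol : volume {y | (x, y) ∈ tsupport b} ≤ ENNReal.ofReal (κ * δ ^ d) := by
      calc volume {y | (x, y) ∈ tsupport b}
          ≤ volume (Metric.closedBall c ((d * Λ + 2) * δ)) :=
            measure_mono fun y hy => hbball (x, y) hy
        _ = volume (Metric.closedBall c (δ * (d * Λ + 2))) := by rw [mul_comm]
        _ = ENNReal.ofReal (δ ^ d) * volume (Metric.closedBall (0 : Rn d) (d * Λ + 2)) := by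
            rw [Measure.addHaar_closedBall_mul_of_pos _ _ hδ, finrank_euclideanSpace,
              Fintype.card_fin]
        _ = ENNReal.ofReal (κ * δ ^ d) := by
            rw [mul_comm κ, ENNReal.ofReal_mul (by positivity), hκ, Measure.real,
              ENNReal.ofReal_toReal measure_closedBall_lt_top.ne]
    calc ∫⁻ z, ‖∫ y, oscKernel lam φ b (x, y) * conj (oscKernel lam φ b (z, y))‖ₑ
        ≤ ∫⁻ z, ENNReal.ofReal Cn * ∫⁻ y in {y | (x, y) ∈ tsupport b ∧ (z, y) ∈ tsupport b},
            oscWeight φ (lam * s) (d + 1) x (z, y) := lintegral_mono hker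
      _ = ENNReal.ofReal Cn * ∫⁻ z, ∫⁻ y in {y | (x, y) ∈ tsupport b ∧ (z, y) ∈ tsupport b},
            oscWeight φ (lam * s) (d + 1) x (z, y) :=
          lintegral_const_mul' _ _ ENNReal.ofReal_ne_top
      _ ≤ ENNReal.ofReal Cn * (ENNReal.ofReal V * ENNReal.ofReal (κ * δ ^ d)) := by
          refine mul_le_mul_right ((lintegral_fiber_le (isClosed_tsupport b)
            (measurable_oscWeight hφ (by positivity) _ x) x hfib).trans ?_) _
          exact mul_le_mul_right hvol _
      _ = ENNReal.ofReal (Cn * (V * (κ * δ ^ d))) := by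
          rw [← ENNReal.ofReal_mul hV.le, ← ENNReal.ofReal_mul hCn]
      _ ≤ ENNReal.ofReal B := by
          refine ENNReal.ofReal_le_ofReal ?_
          have e1 : 0 ≤ κ * (δ ^ d * V) := by positivity
          rw [hB]
          linarith
  · -- distant cubes
    intro y z hyz
    set at' : Rn d × Rn d → ℂ := fun P => a P.swap with hat
    have hats : ContDiff ℝ ∞ at' := has.comp (contDiff_snd.prodMk contDiff_fst)
    have htsup : ∀ P, P ∈ tsupport at' → P.swap ∈ tsupport a := by
      intro P hP
      have hcl : IsClosed (Prod.swap ⁻¹' tsupport a) :=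
        (isClosed_tsupport a).preimage continuous_swap
      have hsub : Function.support at' ⊆ Prod.swap ⁻¹' tsupport a :=
        fun Q hQ => subset_tsupport a (show a Q.swap ≠ 0 from hQ)
      exact closure_minimal hsub hcl hP
    have hatb : ∀ P, DerivBound δ N at' P A₃ := by
      intro P m hm
      have h1 := LinearIsometryEquiv.norm_iteratedFDeriv_comp_right (𝕜 := ℝ)
        (LinearIsometryEquiv.prodComm ℝ (Rn d) (Rn d)) a P m
      have h2 : a ∘ (LinearIsometryEquiv.prodComm ℝ (Rn d) (Rn d)) = at' := rfl
      rw [h2] at h1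
      rw [h1]
      exact ((hab _ m (hm.trans (le_max_left _ _))).trans
        ((le_max_left _ _).trans (le_max_right _ _))).trans (le_max_right _ _)
    have hgradt : ∀ u v, gradR φt (u, v) = gradL φ (v, u) := fun u v => rfl
    have hlow : ∀ x, (x, y) ∈ tsupport a → (x, z) ∈ tsupport a →
        ‖y - z‖ ≤ 2 * C₁ * ‖gradL φ (x, y) - gradL φ (x, z)‖ := by
      intro x h1 h2
      have h3 := hfold x y z (haK h1) (haK h2)
      have h4 : |h (x, y) - h (x, z)| ≤ 2 * (R' * δ) := by
        have h5 := abs_le.mp (hhb _ h1)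
        have h6 := abs_le.mp (hhb _ h2)
        rw [abs_le]
        constructor <;> linarith [h5.1, h5.2, h6.1, h6.2]
      have h7 : ‖y - z‖ ≤ C₁ * (‖gradL φ (x, y) - gradL φ (x, z)‖ + 2 * (R' * δ)) := by
        refine h3.trans ?_
        gcongr
        exact le_max_left _ _
      have h8 : Λ * δ ≤ ‖y - z‖ := hyz
      -- The reason for `Λ = 4 C₁ R'`: the contribution of `h` is at most half of the distance
      -- between separated points, and so is absorbed.
      have h9 : C₁ * (2 * (R' * δ)) = Λ * δ / 2 := by rw [hΛ]; ring
      rw [mul_add, h9] at h7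
      linarith
    have hmain := hfar (lam := lam) (s := δ) (a := at') (x := z) (z := y) hlam0.le hδ hδ1 hats
      (fun P hP => haK (htsup P hP)) hatb (fun x h1 h2 => by
        rw [hgradt, hgradt, norm_sub_rev z y, norm_sub_rev (gradL φ (x, z))]
        have h3 := hlow x (htsup _ h2) (htsup _ h1)
        have hA₃' : 2 * C₁ ≤ A₃ :=
          ((le_max_right _ _).trans (le_max_right _ _)).trans (le_max_right _ _)
        set g := ‖gradL φ (x, y) - gradL φ (x, z)‖
        have hg : 0 ≤ g := norm_nonneg _
        calc lam * δ ^ 2 * ‖y - z‖ ≤ lam * δ ^ 2 * (2 * C₁ * g) := by gcongr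
          _ = 2 * C₁ * (lam * δ * g) * δ := by ring
          _ ≤ 2 * C₁ * (lam * δ * g) * 1 := by gcongr
          _ ≤ 2 * C₁ * (1 + lam * δ * g) := by nlinarith
          _ ≤ A₃ * (1 + lam * δ * g) := by gcongr)
    have hkt : ∀ u v, oscKernel lam φt at' (u, v) = k (v, u) := fun u v => rfl
    simp only [hkt] at hmain
    have hcomm : ∫ x, conj (k (x, y)) * k (x, z) = ∫ x, k (x, z) * conj (k (x, y)) :=
      integral_congr_ae (Filter.Eventually.of_forall fun x => mul_comm _ _)
    rw [hcomm, ← ENNReal.ofReal_le_ofReal_iff hτ0, ofReal_norm]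
    refine hmain.trans ?_
    set S : Set (Rn d) := {x | (z, x) ∈ tsupport at' ∧ (y, x) ∈ tsupport at'} with hS
    have hSm : MeasurableSet S :=
      (((isClosed_tsupport at').preimage (by fun_prop : Continuous fun x => (z, x))).inter
        ((isClosed_tsupport at').preimage (by fun_prop : Continuous fun x => (y, x)))).measurableSet
    have hSK : S ⊆ Prod.fst '' K := fun x hx => ⟨(x, z), haK (htsup _ hx.1), rfl⟩
    calc ENNReal.ofReal Cf * ∫⁻ x in S, ENNReal.ofReal
          (((1 + lam * δ * ‖gradR φt (z, x) - gradR φt (y, x)‖)⁻¹) ^ N)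
        ≤ ENNReal.ofReal Cf * ∫⁻ x in S, ENNReal.ofReal (((lam * δ ^ 2)⁻¹) ^ N) := by
          gcongr ENNReal.ofReal Cf * ?_
          refine setLIntegral_mono' hSm fun x hx => ENNReal.ofReal_le_ofReal ?_
          rw [hgradt, hgradt, norm_sub_rev (gradL φ (x, z))]
          gcongr
          have h3 := hlow x (htsup _ hx.2) (htsup _ hx.1)
          have h4 : Λ * δ ≤ ‖y - z‖ := hyz
          set g := ‖gradL φ (x, y) - gradL φ (x, z)‖
          have h5 : 2 * C₁ * δ ≤ 2 * C₁ * g := by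
            refine le_trans ?_ (h4.trans h3)
            rw [hΛ]
            have : 0 ≤ C₁ * δ := by positivity
            nlinarith
          have h6 : δ ≤ g := le_of_mul_le_mul_left h5 (by positivity)
          calc lam * δ ^ 2 = lam * δ * δ := by ring
            _ ≤ lam * δ * g := by gcongr
            _ ≤ 1 + lam * δ * g := by linarith
      _ ≤ ENNReal.ofReal Cf * (ENNReal.ofReal (((lam * δ ^ 2)⁻¹) ^ N) * ENNReal.ofReal V₁) := by
          rw [setLIntegral_const]
          gcongr
          rw [hV₁, Measure.real, ENNReal.ofReal_toReal hK1.measure_lt_top.ne]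
          exact measure_mono hSK
      _ = ENNReal.ofReal τ := by
          rw [← ENNReal.ofReal_mul (by positivity), ← ENNReal.ofReal_mul hCf, hτ]
          congr 1; ring

end LocalEstimate

end

noncomputable section

/-! ### The `z` integrals in Schur's test, for `|h| ~ δ` and for `|h| ≲ δ`. -/

section SchurIntegrals

variable {d : ℕ}

/-- The exponent `d + 1` exceeds the dimension, so the integral is finite at `t = 1`; scaling and
translation give the rest. -/
lemma exists_lintegral_bracket_le (d : ℕ) : ∃ J : ℝ, 0 < J ∧ ∀ t : ℝ, 0 < t → ∀ ζ₀ : Rn d,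
    ∫⁻ ζ, ENNReal.ofReal (((1 + t * ‖ζ₀ - ζ‖)⁻¹) ^ (d + 1)) ≤ ENNReal.ofReal (J * (t⁻¹) ^ d) := by
  set W : Rn d → ENNReal := fun ζ => ENNReal.ofReal (((1 + ‖ζ‖)⁻¹) ^ (d + 1)) with hW
  have hWm : Measurable W := by
    rw [hW]
    fun_prop
  have hfin : ∫⁻ ζ, W ζ < ⊤ := by
    have h1 := finite_integral_one_add_norm (E := Rn d) (μ := volume) (r := (d + 1 : ℕ))
      (by rw [finrank_euclideanSpace, Fintype.card_fin]; exact_mod_cast Nat.lt_succ_self d)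
    refine lt_of_le_of_lt (lintegral_mono fun ζ => ?_) h1
    rw [Real.rpow_neg (by positivity), Real.rpow_natCast, ← inv_pow]
  refine ⟨(∫⁻ ζ, W ζ).toReal + 1, by positivity, fun t ht ζ₀ => ?_⟩
  have e1 : ∀ ζ : Rn d, ENNReal.ofReal (((1 + t * ‖ζ₀ - ζ‖)⁻¹) ^ (d + 1)) = W (t • (ζ₀ - ζ)) := by
    intro ζ
    rw [hW]
    simp only [norm_smul, Real.norm_eq_abs, abs_of_pos ht]
  calc ∫⁻ ζ, ENNReal.ofReal (((1 + t * ‖ζ₀ - ζ‖)⁻¹) ^ (d + 1))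
      = ∫⁻ ζ, (fun η => W (t • η)) (ζ₀ - ζ) := lintegral_congr e1
    _ = ∫⁻ η, W (t • η) := lintegral_sub_left_eq_self (μ := (volume : Measure (Rn d)))
        (fun η => W (t • η)) ζ₀
    _ = ∫⁻ η, W η ∂(Measure.map (fun η : Rn d => t • η) volume) :=
        (lintegral_map hWm (by fun_prop)).symm
    _ = ENNReal.ofReal ((t⁻¹) ^ d) * ∫⁻ η, W η := by
        have h2 := Measure.map_addHaar_smul (volume : Measure (Rn d)) ht.ne'
        rw [h2, lintegral_smul_measure, finrank_euclideanSpace, Fintype.card_fin,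
          abs_of_pos (by positivity), inv_pow, smul_eq_mul]
    _ ≤ ENNReal.ofReal ((t⁻¹) ^ d) * ENNReal.ofReal ((∫⁻ ζ, W ζ).toReal + 1) := by
        gcongr
        rw [ENNReal.le_ofReal_iff_toReal_le hfin.ne (by positivity)]
        linarith
    _ = _ := by rw [← ENNReal.ofReal_mul (by positivity), mul_comm]

lemma isClosed_slice {T : Set (Rn d × Rn d)} (hT : IsClosed T) (y : Rn d) :
    IsClosed {z | (z, y) ∈ T} :=
  hT.preimage (by fun_prop : Continuous fun z => (z, y))

/-- The local estimate where `|h| ~ δ`. -/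
theorem exists_sqNorm_locAmp_le_of_zero_notMem_tsupport {φ : Rn d × Rn d → ℝ}
    (hφ : ContDiff ℝ ∞ φ)
    {K : Set (Rn d × Rn d)} (hK : IsCompact K) (hKc : Convex ℝ K) {σ : Rn d × Rn d → ℂ}
    (hσ : ContDiff ℝ ∞ σ) (hσK : tsupport σ ⊆ K) {h : Rn d × Rn d → ℝ} (hh : ContDiff ℝ ∞ h)
    {χ : ℝ → ℂ} (hχ : ContDiff ℝ ∞ χ) (hχc : HasCompactSupport χ) (hχ0 : (0 : ℝ) ∉ tsupport χ)
    {C₀ : ℝ}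
    (hfold : ∀ x y z, (x, y) ∈ K → (x, z) ∈ K →
      ‖y - z‖ ≤ C₀ * (‖gradL φ (x, y) - gradL φ (x, z)‖ + |h (x, y) - h (x, z)|))
    (hdet : ∀ x y, |(fderiv ℝ (fun x => gradR φ (x, y)) x).det| = |h (x, y)|)
    (hinj : ∀ x z y, (x, y) ∈ K → (z, y) ∈ K →
      |h (x, y)| * ‖x - z‖ ≤ C₀ * ‖gradR φ (x, y) - gradR φ (z, y)‖)
    (N : ℕ) :
    ∃ C, 0 ≤ C ∧ ∀ {lam δ : ℝ}, 1 ≤ lam → 0 < δ → δ ≤ 1 →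
      ∀ f, MemLp f 2 volume → sqNorm (kernelOp (oscKernel lam φ (locAmp σ h χ δ)) f)
        ≤ C * (δ⁻¹ * (lam⁻¹) ^ d + ((lam * δ ^ 2)⁻¹) ^ N) * sqNorm f := by
  obtain ⟨c₀, hc₀, hχb⟩ : ∃ c₀ > 0, ∀ t ∈ tsupport χ, c₀ ≤ |t| := by
    obtain ⟨c, hc, hb⟩ := Metric.isOpen_iff.mp (isClosed_tsupport χ).isOpen_compl 0 hχ0
    refine ⟨c, hc, fun t ht => ?_⟩
    by_contra hcon
    exact hb (by simpa using hcon) ht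
  set C₁ := max C₀ 0 with hC₁
  obtain ⟨J, hJ, hJb⟩ := exists_lintegral_bracket_le d
  obtain ⟨C, hC, hmain⟩ := exists_sqNorm_locAmp_le hφ hK hKc hσ hσK hh hχ hχc hfold N (C₁ / c₀)
  refine ⟨C * (c₀⁻¹ * J + 1), by positivity, ?_⟩
  intro lam δ hlam hδ hδ1 f hf
  have hlam0 : 0 < lam := by linarith
  have hTK : tsupport (locAmp σ h χ δ) ⊆ K := (tsupport_locAmp_subset σ h χ δ).trans hσK
  have hlow : ∀ P ∈ tsupport (locAmp σ h χ δ), c₀ * δ ≤ |h P| := by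
    intro P hP
    have h1 := hχb _ (mem_tsupport_of_mem_tsupport_locAmp hh.continuous hP)
    rw [abs_mul, abs_inv, abs_of_pos hδ, inv_mul_eq_div, le_div_iff₀ hδ] at h1
    exact h1
  have hsep : ∀ x z y, (x, y) ∈ tsupport (locAmp σ h χ δ) → (z, y) ∈ tsupport (locAmp σ h χ δ) →
      c₀ * δ * ‖x - z‖ ≤ C₁ * ‖gradR φ (x, y) - gradR φ (z, y)‖ := by
    intro x z y h1 h2
    calc c₀ * δ * ‖x - z‖ ≤ |h (x, y)| * ‖x - z‖ := by gcongr; exact hlow _ h1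
      _ ≤ C₀ * ‖gradR φ (x, y) - gradR φ (z, y)‖ := hinj _ _ _ (hTK h1) (hTK h2)
      _ ≤ _ := by gcongr; exact le_max_left _ _
  -- In `V`, the factor `(c₀ δ)⁻¹` is the bound for the inverse Jacobian of `z ↦ φ_y(z, y)`, and `J
  -- (lam δ)^{-d}` is the integral of the weight in the new variable.
  have hb := hmain (lam := lam) (δ := δ) (s := δ)
    (V := (c₀ * δ)⁻¹ * (J * ((lam * δ)⁻¹) ^ d)) hlam hδ le_rfl hδ1
    (by positivity) ?_ ?_ f hf
  · refine hb.trans (mul_le_mul_of_nonneg_right ?_ (sqNorm_nonneg f))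
    rw [mul_assoc C]
    refine mul_le_mul_of_nonneg_left ?_ hC
    have e1 : δ ^ d * ((c₀ * δ)⁻¹ * (J * ((lam * δ)⁻¹) ^ d))
        = c₀⁻¹ * J * (δ⁻¹ * (lam⁻¹) ^ d) := by
      rw [mul_inv, mul_inv, mul_pow]
      have : δ ^ d * δ⁻¹ ^ d = 1 := by rw [← mul_pow, mul_inv_cancel₀ hδ.ne', one_pow]
      linear_combination (c₀⁻¹ * J * (δ⁻¹ * (lam⁻¹) ^ d)) * this
    rw [e1]
    have p1 : 0 ≤ δ⁻¹ * (lam⁻¹) ^ d := by positivity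
    have p2 : 0 ≤ ((lam * δ ^ 2)⁻¹) ^ N := by positivity
    have p3 : 0 ≤ c₀⁻¹ * J := by positivity
    nlinarith [mul_nonneg p3 p2]
  · intro x z y h1 h2
    have h3 := hsep x z y h1 h2
    rw [div_mul_eq_mul_div, le_div_iff₀ hc₀]
    set g := ‖gradR φ (x, y) - gradR φ (z, y)‖
    have h4 : lam * δ * (c₀ * δ * ‖x - z‖) ≤ lam * δ * (C₁ * g) := by gcongr
    have h5 : 0 ≤ C₁ := le_max_right _ _
    nlinarith
  · intro x y _
    set S : Set (Rn d) := {z | (z, y) ∈ tsupport (locAmp σ h χ δ)} with hS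
    have hSm : MeasurableSet S := (isClosed_slice (isClosed_tsupport _) y).measurableSet
    set g : Rn d → Rn d := fun z => gradR φ (z, y) with hg
    have hgd : Differentiable ℝ g := ((contDiff_gradR hφ).comp
      (contDiff_id.prodMk contDiff_const)).differentiable (by simp)
    -- Global injectivity on the slice, as the change of variables requires; it holds because `|h|`
    -- is bounded below on the support.
    have hgi : Set.InjOn g S := by
      intro z hz w hw hzw
      have h3 := hsep z w y hz hw
      have h4 : gradR φ (z, y) = gradR φ (w, y) := hzw
      rw [h4, sub_self, norm_zero, mul_zero] at h3
      have h5 : ‖z - w‖ ≤ 0 := by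
        by_contra hcon
        push Not at hcon
        have : 0 < c₀ * δ * ‖z - w‖ := by positivity
        linarith
      exact sub_eq_zero.mp (norm_le_zero_iff.mp h5)
    set W : Rn d → ENNReal := fun ζ =>
      ENNReal.ofReal (((1 + lam * δ * ‖gradR φ (x, y) - ζ‖)⁻¹) ^ (d + 1)) with hW
    calc ∫⁻ z in S, W (g z)
        ≤ ∫⁻ z in S, ENNReal.ofReal ((c₀ * δ)⁻¹) *
            (ENNReal.ofReal |(fderiv ℝ g z).det| * W (g z)) := by
          refine setLIntegral_mono' hSm fun z hz => ?_
          rw [← mul_assoc, ← ENNReal.ofReal_mul (by positivity)]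
          refine le_mul_of_one_le_left zero_le ?_
          rw [ENNReal.one_le_ofReal, hdet, inv_mul_eq_div, one_le_div (by positivity)]
          exact hlow _ hz
      _ = ENNReal.ofReal ((c₀ * δ)⁻¹) * ∫⁻ z in S,
            ENNReal.ofReal |(fderiv ℝ g z).det| * W (g z) :=
          lintegral_const_mul' _ _ ENNReal.ofReal_ne_top
      _ = ENNReal.ofReal ((c₀ * δ)⁻¹) * ∫⁻ ζ in g '' S, W ζ := by
          rw [lintegral_image_eq_lintegral_abs_det_fderiv_mul volume hSm
            (fun z _ => (hgd z).hasFDerivAt.hasFDerivWithinAt) hgi]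
      _ ≤ ENNReal.ofReal ((c₀ * δ)⁻¹) * ENNReal.ofReal (J * ((lam * δ)⁻¹) ^ d) := by
          gcongr
          exact (setLIntegral_le_lintegral _ _).trans (hJb _ (by positivity) _)
      _ = _ := by rw [← ENNReal.ofReal_mul (by positivity)]

/-- On a set of bounded width in the direction `u₀`, split into slabs of width `t⁻¹`, the weight
`(1 + t |G|)⁻¹` is controlled once `G` and `⟪·, u₀⟫` separate points. -/
lemma lintegral_slabs_le {J : ℝ} (hJ : 0 < J) (hJb : ∀ t : ℝ, 0 < t → ∀ ζ₀ : Rn d,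
      ∫⁻ ζ, ENNReal.ofReal (((1 + t * ‖ζ₀ - ζ‖)⁻¹) ^ (d + 1)) ≤ ENNReal.ofReal (J * (t⁻¹) ^ d))
    {S : Set (Rn d)} (hS : MeasurableSet S) {G : Rn d → Rn d} {u₀ : Rn d} {C₁ B : ℝ}
    (hC₁ : 0 ≤ C₁) (hB : 0 ≤ B)
    (hG : ∀ z ∈ S, ∀ w ∈ S, ‖z - w‖ ≤ C₁ * (‖G z - G w‖ + |inner ℝ (z - w) u₀|))
    (hSB : ∀ z ∈ S, |inner ℝ z u₀| ≤ B) {t : ℝ} (ht : 1 ≤ t) :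
    ∫⁻ z in S, ENNReal.ofReal (((1 + t * ‖G z‖)⁻¹) ^ (d + 1)) ≤
      ENNReal.ofReal ((2 * B + 2) * ((2 * C₁ + 1) ^ (d + 1) * J) * (t * (t⁻¹) ^ d)) := by
  have ht0 : 0 < t := by linarith
  set W : Rn d → ENNReal := fun z => ENNReal.ofReal (((1 + t * ‖G z‖)⁻¹) ^ (d + 1)) with hW
  set I : Finset ℤ := Finset.Icc ⌊-(t * B)⌋ ⌊t * B⌋ with hI
  -- Slabs of width `t⁻¹` orthogonal to `u₀`; inside one slab `G` alone separates points, up to an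
  -- error `O(t⁻¹)`.
  set T : I → Set (Rn d) := fun j => {z | z ∈ S ∧ ⌊t * inner ℝ z u₀⌋ = (j : ℤ)} with hT
  have hTm : ∀ j, MeasurableSet (T j) := fun j =>
    hS.inter (measurableSet_eq_fun (by fun_prop) measurable_const)
  have hcover : S ⊆ ⋃ j, T j := by
    intro z hz
    have h1 := abs_le.mp (hSB z hz)
    refine Set.mem_iUnion.mpr ⟨⟨⌊t * inner ℝ z u₀⌋, Finset.mem_Icc.mpr ⟨?_, ?_⟩⟩, hz, rfl⟩
    · exact Int.floor_le_floor (by nlinarith [h1.1])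
    · exact Int.floor_le_floor (by nlinarith [h1.2])
  have hcard : (Fintype.card I : ℝ) ≤ (2 * B + 2) * t := by
    rw [Fintype.card_coe, hI, Int.card_Icc]
    have h1 : ⌊-(t * B)⌋ ≤ ⌊t * B⌋ := Int.floor_le_floor (by nlinarith)
    have h2 : ((⌊t * B⌋ + 1 - ⌊-(t * B)⌋).toNat : ℤ) = ⌊t * B⌋ + 1 - ⌊-(t * B)⌋ :=
      Int.toNat_of_nonneg (by linarith)
    have h3 : ((⌊t * B⌋ + 1 - ⌊-(t * B)⌋).toNat : ℝ) = ⌊t * B⌋ + 1 - ⌊-(t * B)⌋ := by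
      exact_mod_cast h2
    rw [h3]
    have h4 := Int.floor_le (t * B)
    have h5 := Int.sub_one_lt_floor (-(t * B))
    nlinarith
  have hpiece : ∀ j, ∫⁻ z in T j, W z ≤
      ENNReal.ofReal ((2 * C₁ + 1) ^ (d + 1) * J * (t⁻¹) ^ d) := by
    intro j
    rcases (T j).eq_empty_or_nonempty with he | hne
    · rw [he]; simp
    -- `G` need not vanish on the slab, so the weight is centred at an approximate minimizer of
    -- `‖G‖`. Then `‖G w - G z‖ ≤ 2‖G z‖ + t⁻¹`, and `1 + t‖w - z‖` is at most a constant times `1 +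
    -- t‖G z‖`.
    obtain ⟨w, hw, hwmin⟩ : ∃ w ∈ T j, ∀ z ∈ T j, ‖G w‖ ≤ ‖G z‖ + t⁻¹ := by
      have h1 : (((fun z => ‖G z‖) '' T j)).Nonempty := hne.image _
      have h2 : BddBelow ((fun z => ‖G z‖) '' T j) :=
        ⟨0, by rintro _ ⟨z, _, rfl⟩; exact norm_nonneg _⟩
      obtain ⟨_, ⟨w, hw, rfl⟩, hlt⟩ := exists_lt_of_csInf_lt h1
        (show sInf ((fun z => ‖G z‖) '' T j) < sInf ((fun z => ‖G z‖) '' T j) + t⁻¹ by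
          have : 0 < t⁻¹ := by positivity
          linarith)
      refine ⟨w, hw, fun z hz => ?_⟩
      have h3 := csInf_le h2 ⟨z, hz, rfl⟩
      simp only at hlt h3
      linarith
    calc ∫⁻ z in T j, W z
        ≤ ∫⁻ z in T j, ENNReal.ofReal ((2 * C₁ + 1) ^ (d + 1)) *
            ENNReal.ofReal (((1 + t * ‖w - z‖)⁻¹) ^ (d + 1)) := by
          refine setLIntegral_mono' (hTm j) fun z hz => ?_
          rw [← ENNReal.ofReal_mul (by positivity), ← mul_pow]
          refine ENNReal.ofReal_le_ofReal (pow_le_pow_left₀ (by positivity) ?_ _)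
          have h1 := hG w hw.1 z hz.1
          have h2 := hwmin z hz
          have h3 : |inner ℝ (w - z) u₀| ≤ t⁻¹ := by
            have h4 := Int.abs_sub_lt_one_of_floor_eq_floor (hw.2.trans hz.2.symm)
            rw [← mul_sub, ← inner_sub_left, abs_mul, abs_of_pos ht0] at h4
            rw [← one_div, le_div_iff₀ ht0, mul_comm]
            exact h4.le
          have h4 : ‖G w - G z‖ ≤ ‖G w‖ + ‖G z‖ := norm_sub_le _ _
          have h5 : ‖w - z‖ ≤ C₁ * (2 * ‖G z‖ + 2 * t⁻¹) := by
            refine h1.trans (mul_le_mul_of_nonneg_left ?_ hC₁)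
            linarith
          have h6 : t * ‖w - z‖ ≤ 2 * C₁ * (1 + t * ‖G z‖) := by
            calc t * ‖w - z‖ ≤ t * (C₁ * (2 * ‖G z‖ + 2 * t⁻¹)) := by gcongr
              _ = 2 * C₁ * (t * t⁻¹ + t * ‖G z‖) := by ring
              _ = _ := by rw [mul_inv_cancel₀ ht0.ne']
          rw [← div_eq_mul_inv, inv_eq_one_div, div_le_div_iff₀ (by positivity) (by positivity)]
          have h7 : 0 ≤ t * ‖G z‖ := by positivity
          linarith
      _ = ENNReal.ofReal ((2 * C₁ + 1) ^ (d + 1)) * ∫⁻ z in T j,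
            ENNReal.ofReal (((1 + t * ‖w - z‖)⁻¹) ^ (d + 1)) :=
          lintegral_const_mul' _ _ ENNReal.ofReal_ne_top
      _ ≤ ENNReal.ofReal ((2 * C₁ + 1) ^ (d + 1)) * ENNReal.ofReal (J * (t⁻¹) ^ d) := by
          gcongr
          exact (setLIntegral_le_lintegral _ _).trans (hJb t ht0 w)
      _ = _ := by rw [← ENNReal.ofReal_mul (by positivity), mul_assoc]
  calc ∫⁻ z in S, W z ≤ ∫⁻ z in ⋃ j, T j, W z := lintegral_mono_set hcover
    _ ≤ ∑' j, ∫⁻ z in T j, W z := lintegral_iUnion_le _ _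
    _ ≤ ∑' _ : I, ENNReal.ofReal ((2 * C₁ + 1) ^ (d + 1) * J * (t⁻¹) ^ d) :=
        ENNReal.tsum_le_tsum hpiece
    _ = ENNReal.ofReal (Fintype.card I * ((2 * C₁ + 1) ^ (d + 1) * J * (t⁻¹) ^ d)) := by
        rw [tsum_fintype, Finset.sum_const, nsmul_eq_mul, Finset.card_univ,
          ENNReal.ofReal_mul (p := (Fintype.card I : ℝ)) (by positivity), ENNReal.ofReal_natCast]
    _ ≤ _ := by
        refine ENNReal.ofReal_le_ofReal ?_
        calc (Fintype.card I : ℝ) * ((2 * C₁ + 1) ^ (d + 1) * J * (t⁻¹) ^ d)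
            ≤ (2 * B + 2) * t * ((2 * C₁ + 1) ^ (d + 1) * J * (t⁻¹) ^ d) := by gcongr
          _ = _ := by ring

/-- The local estimate where `|h| ≲ δ`. -/
theorem exists_sqNorm_locAmp_le_of_slabs {φ : Rn d × Rn d → ℝ} (hφ : ContDiff ℝ ∞ φ)
    {K : Set (Rn d × Rn d)} (hK : IsCompact K) (hKc : Convex ℝ K) {σ : Rn d × Rn d → ℂ}
    (hσ : ContDiff ℝ ∞ σ) (hσK : tsupport σ ⊆ K) {h : Rn d × Rn d → ℝ} (hh : ContDiff ℝ ∞ h)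
    {χ : ℝ → ℂ} (hχ : ContDiff ℝ ∞ χ) (hχc : HasCompactSupport χ) {C₀ : ℝ}
    (hfold : ∀ x y z, (x, y) ∈ K → (x, z) ∈ K →
      ‖y - z‖ ≤ C₀ * (‖gradL φ (x, y) - gradL φ (x, z)‖ + |h (x, y) - h (x, z)|))
    {u₀ : Rn d}
    (hslab : ∀ x z y, (x, y) ∈ K → (z, y) ∈ K →
      ‖x - z‖ ≤ C₀ * (‖gradR φ (x, y) - gradR φ (z, y)‖ + |inner ℝ (x - z) u₀|))
    (N : ℕ) :
    ∃ C, 0 ≤ C ∧ ∀ {lam δ : ℝ}, 1 ≤ lam → 0 < δ → δ ≤ 1 → 1 ≤ lam * δ ^ 2 →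
      ∀ f, MemLp f 2 volume → sqNorm (kernelOp (oscKernel lam φ (locAmp σ h χ δ)) f)
        ≤ C * (δ ^ d * (√lam * ((√lam)⁻¹) ^ d) + ((lam * δ ^ 2)⁻¹) ^ N) * sqNorm f := by
  obtain ⟨R, hR⟩ := hK.isBounded.exists_norm_le
  set R' := max R 0 with hR'
  have hR'0 : 0 ≤ R' := le_max_right _ _
  have hRx : ∀ {x y}, (x, y) ∈ K → ‖x‖ ≤ R' := fun {x y} hxy =>
    ((norm_fst_le (x, y)).trans (hR _ hxy)).trans (le_max_left _ _)
  set C₁ := max C₀ 0 with hC₁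
  have hC₁0 : 0 ≤ C₁ := le_max_right _ _
  obtain ⟨J, hJ, hJb⟩ := exists_lintegral_bracket_le d
  obtain ⟨C, hC, hmain⟩ := exists_sqNorm_locAmp_le hφ hK hKc hσ hσK hh hχ hχc hfold N (2 * R')
  set B := R' * ‖u₀‖ with hB
  set D := (2 * B + 2) * ((2 * C₁ + 1) ^ (d + 1) * J) with hD
  have hD0 : 0 < D := by positivity
  refine ⟨C * (D + 1), by positivity, ?_⟩
  intro lam δ hlam hδ hδ1 hlδ f hf
  have hlam0 : 0 < lam := by linarith
  have ht1 : 1 ≤ √lam := Real.one_le_sqrt.mpr hlam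
  have ht0 : 0 < √lam := by linarith
  have htt : √lam * √lam = lam := Real.mul_self_sqrt hlam0.le
  have hls : lam * (√lam)⁻¹ = √lam := by rw [← div_eq_mul_inv, Real.div_sqrt]
  have hTK : tsupport (locAmp σ h χ δ) ⊆ K := (tsupport_locAmp_subset σ h χ δ).trans hσK
  have hsδ : (√lam)⁻¹ ≤ δ := by
    rw [inv_le_iff_one_le_mul₀ ht0]
    have h1 : 1 ≤ (δ * √lam) ^ 2 := by
      rw [mul_pow, Real.sq_sqrt hlam0.le]
      linarith
    exact (one_le_sq_iff₀ (by positivity)).mp h1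
  -- With `s = lam^{-1/2}` one has `lam s² = 1`, so the separation hypothesis follows from the
  -- boundedness of `K`, without any lower bound on the gradient.
  have hb := hmain (lam := lam) (δ := δ) (s := (√lam)⁻¹) (V := D * (√lam * ((√lam)⁻¹) ^ d))
    hlam (by positivity) hsδ hδ1 (by positivity) ?_ ?_ f hf
  · refine hb.trans (mul_le_mul_of_nonneg_right ?_ (sqNorm_nonneg f))
    rw [mul_assoc C]
    refine mul_le_mul_of_nonneg_left ?_ hC
    have p1 : 0 ≤ δ ^ d * (√lam * ((√lam)⁻¹) ^ d) := by positivity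
    have p2 : 0 ≤ ((lam * δ ^ 2)⁻¹) ^ N := by positivity
    have e1 : δ ^ d * (D * (√lam * ((√lam)⁻¹) ^ d)) = D * (δ ^ d * (√lam * ((√lam)⁻¹) ^ d)) := by
      ring
    rw [e1]
    nlinarith [mul_nonneg hD0.le p2]
  · intro x z y h1 h2
    have e1 : lam * (√lam)⁻¹ ^ 2 = 1 := by
      rw [inv_pow, Real.sq_sqrt hlam0.le, mul_inv_cancel₀ hlam0.ne']
    rw [e1, one_mul, hls]
    have h3 : ‖x - z‖ ≤ 2 * R' :=
      (norm_sub_le _ _).trans (by linarith [hRx (hTK h1), hRx (hTK h2)])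
    refine h3.trans (le_mul_of_one_le_right (by positivity) ?_)
    have : 0 ≤ √lam * ‖gradR φ (x, y) - gradR φ (z, y)‖ := by positivity
    linarith
  · intro x y _
    rw [hls]
    refine lintegral_slabs_le (G := fun z => gradR φ (x, y) - gradR φ (z, y)) (u₀ := u₀) hJ hJb
      (isClosed_slice (isClosed_tsupport _) y).measurableSet hC₁0 (by positivity) ?_ ?_ ht1
    · intro z hz w hw
      have h1 := hslab z w y (hTK hz) (hTK hw)
      rw [sub_sub_sub_cancel_left, norm_sub_rev (gradR φ (w, y))]
      refine h1.trans ?_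
      gcongr
      exact le_max_left _ _
    · intro z hz
      refine (abs_real_inner_le_norm _ _).trans ?_
      rw [hB]
      gcongr
      exact hRx (hTK hz)

end SchurIntegrals

end

noncomputable section

/-! ### Block determinants and the augmentation of a degenerate endomorphism. -/

section LinearAlgebra

variable {E F : Type*} [AddCommGroup E] [Module ℝ E] [AddCommGroup F] [Module ℝ F]

/-- The shear `(x, y) ↦ (x, y + A x)`. -/
def shearEquiv (A : E →ₗ[ℝ] F) : (E × F) ≃ₗ[ℝ] (E × F) where
  toFun p := (p.1, p.2 + A p.1)
  invFun p := (p.1, p.2 - A p.1)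
  map_add' p q := by ext <;> simp; abel
  map_smul' c p := by ext <;> simp
  left_inv p := by ext <;> simp
  right_inv p := by ext <;> simp

/-- Conjugation by the dilation `y ↦ 2y` turns the shear into its square. Its determinant is
therefore a nonzero root of `t = t²`. -/
lemma det_shearEquiv (A : E →ₗ[ℝ] F) :
    LinearMap.det (shearEquiv A : E × F →ₗ[ℝ] E × F) = 1 := by
  let D : (E × F) ≃ₗ[ℝ] (E × F) :=
    (LinearEquiv.refl ℝ E).prodCongr (LinearEquiv.smulOfNeZero ℝ F (2 : ℝ) two_ne_zero)
  have h1 : (D : E × F →ₗ[ℝ] E × F) ∘ₗ (shearEquiv A : E × F →ₗ[ℝ] E × F) ∘ₗ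
      (D.symm : E × F →ₗ[ℝ] E × F) =
      (shearEquiv A : E × F →ₗ[ℝ] E × F) ∘ₗ (shearEquiv A : E × F →ₗ[ℝ] E × F) := by
    have hD : ∀ q, D q = (q.1, (2 : ℝ) • q.2) := fun q => rfl
    have hS : ∀ q, shearEquiv A q = (q.1, q.2 + A q.1) := fun q => rfl
    refine LinearMap.ext fun p => ?_
    obtain ⟨q, rfl⟩ := D.surjective p
    simp only [LinearMap.comp_apply, LinearEquiv.coe_coe, LinearEquiv.symm_apply_apply]
    simp only [hD, hS]
    refine Prod.ext rfl ?_
    simp only [two_smul, smul_add]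
    abel
  have h2 := congrArg LinearMap.det h1
  rw [LinearMap.det_conj, LinearMap.det_comp] at h2
  have h3 : LinearMap.det (shearEquiv A : E × F →ₗ[ℝ] E × F) ≠ 0 :=
    ((shearEquiv A).isUnit_det').ne_zero
  exact mul_left_cancel₀ h3 (by rw [mul_one]; exact h2.symm)

lemma det_of_blockTriangular [FiniteDimensional ℝ E] [FiniteDimensional ℝ F]
    (A : E →ₗ[ℝ] F) (B : F →ₗ[ℝ] F) (T : E × F →ₗ[ℝ] E × F)
    (hT : ∀ p, T p = (p.1, A p.1 + B p.2)) : LinearMap.det T = LinearMap.det B := by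
  have h1 : T = (shearEquiv A : E × F →ₗ[ℝ] E × F) ∘ₗ (LinearMap.id.prodMap B) := by
    refine LinearMap.ext fun p => ?_
    rw [hT]
    refine Prod.ext rfl ?_
    simp [shearEquiv, add_comm]
  rw [h1, LinearMap.det_comp, det_shearEquiv, LinearMap.det_prodMap, LinearMap.det_id, one_mul,
    one_mul]

end LinearAlgebra

section Augmentation

variable {E : Type*} [NormedAddCommGroup E] [InnerProductSpace ℝ E]

/-- `S`, with its component along `v` replaced by the functional `⟪u, ·⟫`. -/
def augment (u v : E) (S : E →L[ℝ] E) : E →L[ℝ] E :=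
  S + (innerSL ℝ u - (innerSL ℝ v).comp S).smulRight v

lemma augment_apply (u v : E) (S : E →L[ℝ] E) (x : E) :
    augment u v S x = S x + (inner ℝ u x - inner ℝ v (S x)) • v := rfl

lemma contDiff_augment (u v : E) : ContDiff ℝ ∞ (augment u v) := by
  have h1 : augment u v = fun S => S + (ContinuousLinearMap.smulRightL ℝ E E
      (innerSL ℝ u - (innerSL ℝ v).comp S)) v := rfl
  rw [h1]
  fun_prop

lemma inner_augment {u v : E} (hv : ‖v‖ = 1) (S : E →L[ℝ] E) (x : E) :
    inner ℝ v (augment u v S x) = inner ℝ u x := by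
  rw [augment_apply, inner_add_right, inner_smul_right, real_inner_self_eq_norm_sq, hv]
  ring

/-- So `w` is the direction in which `S` can degenerate: moving along it changes only the component
along `v`. -/
lemma apply_eq_smul_of_augment_eq {u v : E} {S : E →L[ℝ] E} {w : E}
    (hw : augment u v S w = v) (hv : ‖v‖ = 1) : S w = (inner ℝ v (S w)) • v ∧ inner ℝ u w = 1 := by
  have h2 : inner ℝ u w = 1 := by
    rw [← inner_augment hv S, hw, real_inner_self_eq_norm_sq, hv, one_pow]
  refine ⟨?_, h2⟩
  rw [augment_apply, h2] at hw
  rw [sub_smul, one_smul] at hw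
  have h3 : S w - (inner ℝ v (S w)) • v = 0 := by
    rw [← sub_eq_zero.mpr hw]
    abel
  exact sub_eq_zero.mp h3

/-- `S` and its augmentation differ by a functional times `v`, and `v` is the image of `w`. Hence
`S` is the augmentation composed with the transvection `x ↦ x + β(x) w`, whose determinant is `1 +
β(w) = ⟨v, S w⟩`. Near an invertible augmentation, the scalar `⟨v, S w⟩` thus has the same size as
`det S`. -/
lemma det_eq_inner_mul_det_augment [FiniteDimensional ℝ E] {u v : E} {S : E →L[ℝ] E} {w : E}
    (hw : augment u v S w = v) (hv : ‖v‖ = 1) : S.det = inner ℝ v (S w) * (augment u v S).det := by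
  obtain ⟨-, h2⟩ := apply_eq_smul_of_augment_eq hw hv
  set β : E →ₗ[ℝ] ℝ := ((innerSL ℝ v).comp S - innerSL ℝ u).toLinearMap with hβ
  have h1 : (S : E →ₗ[ℝ] E) =
      (augment u v S : E →ₗ[ℝ] E) ∘ₗ LinearMap.transvection β w := by
    refine LinearMap.ext fun x => ?_
    simp only [LinearMap.comp_apply, LinearMap.transvection.apply, map_add, map_smul,
      ContinuousLinearMap.coe_coe, hw]
    rw [augment_apply, add_assoc, ← add_smul]
    have : inner ℝ u x - inner ℝ v (S x) + β x = 0 := by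
      simp [hβ]
    rw [this, zero_smul, add_zero]
  rw [ContinuousLinearMap.det, h1, LinearMap.det_comp, LinearMap.transvection.det, mul_comm]
  congr 1
  simp [hβ, h2]

/-- A corank one endomorphism becomes invertible after augmentation. -/
lemma exists_augment_det_ne_zero [FiniteDimensional ℝ E] {S : E →L[ℝ] E} (hS : S.det = 0)
    (hker : ∀ a b, S a = 0 → S b = 0 → b ≠ 0 → ∃ c : ℝ, a = c • b) :
    ∃ u v : E, ‖u‖ = 1 ∧ ‖v‖ = 1 ∧ S u = 0 ∧ (augment u v S).det ≠ 0 := by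
  obtain ⟨k, hk, hk0⟩ := (LinearMap.ker (S : E →ₗ[ℝ] E)).ne_bot_iff.mp
    (bot_lt_iff_ne_bot.mp (LinearMap.bot_lt_ker_of_det_eq_zero hS))
  have hr := LinearMap.range_lt_top_of_det_eq_zero hS
  obtain ⟨l, hl, hl0⟩ := (LinearMap.range (S : E →ₗ[ℝ] E))ᗮ.ne_bot_iff.mp
    (fun h => hr.ne (Submodule.orthogonal_eq_bot_iff.mp h))
  have hkS : S k = 0 := hk
  -- With `u` in the kernel and `v` normal to the range, a null vector of the augmentation lies in
  -- `ker S`, which is spanned by `u`, and is orthogonal to `u`.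
  set u := (‖k‖⁻¹ : ℝ) • k with hu
  set v := (‖l‖⁻¹ : ℝ) • l with hv
  have hu1 : ‖u‖ = 1 := norm_smul_inv_norm hk0
  have hv1 : ‖v‖ = 1 := norm_smul_inv_norm hl0
  have hSu : S u = 0 := by rw [hu, map_smul, hkS, smul_zero]
  have hvS : ∀ x, inner ℝ v (S x) = 0 := by
    intro x
    rw [hv, inner_smul_left, real_inner_comm, hl (S x) ⟨x, rfl⟩, mul_zero]
  refine ⟨u, v, hu1, hv1, hSu, fun hdet => ?_⟩
  obtain ⟨x, hx, hx0⟩ := (LinearMap.ker (augment u v S : E →ₗ[ℝ] E)).ne_bot_iff.mp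
    (bot_lt_iff_ne_bot.mp (LinearMap.bot_lt_ker_of_det_eq_zero hdet))
  have hx' : augment u v S x = 0 := hx
  have h1 : inner ℝ u x = 0 := by rw [← inner_augment hv1 S, hx', inner_zero_right]
  rw [augment_apply, h1, hvS, sub_zero, zero_smul, add_zero] at hx'
  obtain ⟨c, hc⟩ := hker x u hx' hSu (fun h => by rw [h, norm_zero] at hu1; exact zero_ne_one hu1)
  rw [hc, inner_smul_right, real_inner_self_eq_norm_sq, hu1, one_pow, mul_one] at h1
  exact hx0 (by rw [hc, h1, zero_smul])

end Augmentation

/-! ### The mixed Hessian and the Jacobians of the two projections. -/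

section MixedDerivative

variable {d : ℕ} {φ : Rn d × Rn d → ℝ}

/-- `D_x φ_y`. -/
def dxGradR (φ : Rn d × Rn d → ℝ) (P : Rn d × Rn d) : Rn d →L[ℝ] Rn d :=
  (fderiv ℝ (gradR φ) P).comp (ContinuousLinearMap.inl ℝ (Rn d) (Rn d))

/-- `D_y φ_x`. -/
def dyGradL (φ : Rn d × Rn d → ℝ) (P : Rn d × Rn d) : Rn d →L[ℝ] Rn d :=
  (fderiv ℝ (gradL φ) P).comp (ContinuousLinearMap.inr ℝ (Rn d) (Rn d))

lemma contDiff_dxGradR (hφ : ContDiff ℝ ∞ φ) : ContDiff ℝ ∞ (dxGradR φ) :=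
  ((contDiff_gradR hφ).fderiv_right (by simp)).clm_comp contDiff_const

lemma contDiff_dyGradL (hφ : ContDiff ℝ ∞ φ) : ContDiff ℝ ∞ (dyGradL φ) :=
  ((contDiff_gradL hφ).fderiv_right (by simp)).clm_comp contDiff_const

lemma inner_gradR (hφ : ContDiff ℝ ∞ φ) (P : Rn d × Rn d) (b : Rn d) :
    inner ℝ b (gradR φ P) = fderiv ℝ φ P (0, b) := by
  rw [gradR_eq hφ, real_inner_comm, ← InnerProductSpace.toDual_apply_apply,
    LinearIsometryEquiv.apply_symm_apply]
  simp

lemma inner_gradL (hφ : ContDiff ℝ ∞ φ) (P : Rn d × Rn d) (b : Rn d) :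
    inner ℝ b (gradL φ P) = fderiv ℝ φ P (b, 0) := by
  rw [gradL_eq hφ, real_inner_comm, ← InnerProductSpace.toDual_apply_apply,
    LinearIsometryEquiv.apply_symm_apply]
  simp

lemma inner_fderiv_eq {Ψ : Rn d × Rn d → Rn d} {P : Rn d × Rn d} (hφ : ContDiff ℝ ∞ φ)
    (hΨ : ContDiff ℝ ∞ Ψ) {b : Rn d} {q : Rn d × Rn d}
    (h : ∀ Q, inner ℝ b (Ψ Q) = fderiv ℝ φ Q q) (a : Rn d × Rn d) :
    inner ℝ b (fderiv ℝ Ψ P a) = fderiv ℝ (fderiv ℝ φ) P a q := by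
  have h1 : HasFDerivAt (fun Q => inner ℝ b (Ψ Q)) ((innerSL ℝ b).comp (fderiv ℝ Ψ P)) P :=
    (innerSL ℝ b).hasFDerivAt.comp P ((hΨ.differentiable (by simp)) P).hasFDerivAt
  have h2 : HasFDerivAt (fun Q => fderiv ℝ φ Q q)
      ((ContinuousLinearMap.apply ℝ ℝ q).comp (fderiv ℝ (fderiv ℝ φ) P)) P :=
    (ContinuousLinearMap.apply ℝ ℝ q).hasFDerivAt.comp P
      ((((hφ.fderiv_right (m := ∞) (by simp)).differentiable (by simp)) P).hasFDerivAt)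
  have h3 : (fun Q => inner ℝ b (Ψ Q)) = fun Q => fderiv ℝ φ Q q := funext h
  rw [h3] at h1
  exact congrArg (fun T => T a) (h1.unique h2)

lemma inner_dxGradR (hφ : ContDiff ℝ ∞ φ) (P : Rn d × Rn d) (a b : Rn d) :
    inner ℝ b (dxGradR φ P a) = fderiv ℝ (fderiv ℝ φ) P (a, 0) (0, b) :=
  inner_fderiv_eq hφ (contDiff_gradR hφ) (fun Q => inner_gradR hφ Q b) (a, 0)

/-- Symmetry of the second derivative gives the same right side as for `dxGradR`: the two maps are
transposes of each other. -/
lemma inner_dyGradL (hφ : ContDiff ℝ ∞ φ) (P : Rn d × Rn d) (a b : Rn d) :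
    inner ℝ a (dyGradL φ P b) = fderiv ℝ (fderiv ℝ φ) P (a, 0) (0, b) := by
  rw [dyGradL, ContinuousLinearMap.comp_apply, ContinuousLinearMap.inr_apply,
    inner_fderiv_eq hφ (contDiff_gradL hφ) (fun Q => inner_gradL hφ Q a) (0, b)]
  exact (hφ.contDiffAt.isSymmSndFDerivAt (by
    rw [minSmoothness_of_isRCLikeNormedField]
    exact WithTop.coe_le_coe.mpr le_top)) _ _

lemma mixedHessian_apply (hφ : ContDiff ℝ ∞ φ) (P : Rn d × Rn d) (i j : Fin d) :
    mixedHessian φ P i j = fderiv ℝ (fderiv ℝ φ) P (EuclideanSpace.single i 1, 0)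
      (0, EuclideanSpace.single j 1) := by
  have h1 : ∀ x, fderiv ℝ (fun y => φ (x, y)) P.2 (EuclideanSpace.single j 1)
      = fderiv ℝ φ (x, P.2) (0, EuclideanSpace.single j 1) := by
    intro x
    have h3 : HasFDerivAt φ (fderiv ℝ φ (x, P.2)) (x, P.2) :=
      (hφ.differentiable (by simp)).differentiableAt.hasFDerivAt
    have h4 : HasFDerivAt (fun y => φ (x, y)) _ P.2 :=
      h3.comp P.2 (hasFDerivAt_prodMk_right x P.2)
    rw [h4.fderiv]
    simp
  have h2 : HasFDerivAt (fun Q => fderiv ℝ φ Q (0, EuclideanSpace.single j 1))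
      ((ContinuousLinearMap.apply ℝ ℝ ((0, EuclideanSpace.single j 1) : Rn d × Rn d)).comp
        (fderiv ℝ (fderiv ℝ φ) P)) (P.1, P.2) :=
    (ContinuousLinearMap.apply ℝ ℝ ((0, EuclideanSpace.single j 1) : Rn d × Rn d)).hasFDerivAt.comp P
      ((((hφ.fderiv_right (m := ∞) (by simp)).differentiable (by simp)) P).hasFDerivAt)
  rw [mixedHessian, Matrix.of_apply]
  simp only [h1]
  have h3 : HasFDerivAt (fun x => fderiv ℝ φ (x, P.2) (0, EuclideanSpace.single j 1)) _ P.1 :=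
    HasFDerivAt.comp (g := fun Q => fderiv ℝ φ Q (0, EuclideanSpace.single j 1))
      (f := fun x => (x, P.2)) P.1 h2 (hasFDerivAt_prodMk_left P.1 P.2)
  rw [h3.fderiv]
  simp

lemma det_eq_det_of_inner {T : Rn d →L[ℝ] Rn d} {A : Matrix (Fin d) (Fin d) ℝ}
    (h : ∀ i j, inner ℝ (EuclideanSpace.single i (1 : ℝ)) (T (EuclideanSpace.single j (1 : ℝ)))
      = A i j) : T.det = A.det := by
  rw [ContinuousLinearMap.det,
    ← LinearMap.det_toMatrix (EuclideanSpace.basisFun (Fin d) ℝ).toBasis]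
  congr 1
  ext i j
  rw [LinearMap.toMatrix_apply, ← h]
  simp [EuclideanSpace.inner_single_left]

lemma det_dxGradR (hφ : ContDiff ℝ ∞ φ) (P : Rn d × Rn d) :
    (dxGradR φ P).det = mixedHessianDet φ P := by
  rw [mixedHessianDet, ← Matrix.det_transpose]
  refine det_eq_det_of_inner fun i j => ?_
  rw [inner_dxGradR hφ, Matrix.transpose_apply, mixedHessian_apply hφ]

lemma det_dyGradL (hφ : ContDiff ℝ ∞ φ) (P : Rn d × Rn d) :
    (dyGradL φ P).det = mixedHessianDet φ P := by
  refine det_eq_det_of_inner fun i j => ?_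
  rw [inner_dyGradL hφ, mixedHessian_apply hφ]

lemma contDiff_mixedHessianDet (hφ : ContDiff ℝ ∞ φ) : ContDiff ℝ ∞ (mixedHessianDet φ) := by
  have h1 : mixedHessianDet φ = fun P => ∑ τ : Equiv.Perm (Fin d), (Equiv.Perm.sign τ : ℝ) *
      ∏ i, fderiv ℝ (fderiv ℝ φ) P (EuclideanSpace.single (τ i) 1, 0)
        (0, EuclideanSpace.single i 1) := by
    funext P
    rw [mixedHessianDet, Matrix.det_apply']
    simp only [mixedHessian_apply hφ]
  rw [h1]
  have h2 : ContDiff ℝ ∞ (fderiv ℝ (fderiv ℝ φ)) :=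
    (hφ.fderiv_right (m := ∞) (by simp)).fderiv_right (by simp)
  refine ContDiff.sum fun τ _ => contDiff_const.mul (contDiff_prod fun i _ => ?_)
  exact (h2.clm_apply contDiff_const).clm_apply contDiff_const

lemma hasFDerivAt_gradR_slice (hφ : ContDiff ℝ ∞ φ) (x y : Rn d) :
    HasFDerivAt (fun x => gradR φ (x, y)) (dxGradR φ (x, y)) x := by
  have h1 := ((contDiff_gradR hφ).differentiable (by simp) (x, y)).hasFDerivAt
  exact HasFDerivAt.comp (g := gradR φ) (f := fun x => (x, y)) x h1 (hasFDerivAt_prodMk_left x y)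

lemma hasFDerivAt_projL (hφ : ContDiff ℝ ∞ φ) (P : Rn d × Rn d) :
    HasFDerivAt (projL φ) ((ContinuousLinearMap.fst ℝ _ _).prod (fderiv ℝ (gradL φ) P)) P :=
  hasFDerivAt_fst.prodMk ((contDiff_gradL hφ).differentiable (by simp) P).hasFDerivAt

lemma hasFDerivAt_projR (hφ : ContDiff ℝ ∞ φ) (P : Rn d × Rn d) :
    HasFDerivAt (projR φ) ((ContinuousLinearMap.snd ℝ _ _).prod (fderiv ℝ (gradR φ) P)) P :=
  hasFDerivAt_snd.prodMk ((contDiff_gradR hφ).differentiable (by simp) P).hasFDerivAt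

lemma map_prod_eq_add {F : Type*} [AddCommGroup F] [Module ℝ F] [TopologicalSpace F]
    {E E' : Type*} [NormedAddCommGroup E] [NormedSpace ℝ E] [NormedAddCommGroup E']
    [NormedSpace ℝ E']
    (T : E × E' →L[ℝ] F) (p : E × E') : T p = T (p.1, 0) + T (0, p.2) := by
  rw [← map_add]
  simp

/-- The differential is block triangular, with diagonal blocks the identity and `D_y φ_x`. -/
lemma jacDet_projL (hφ : ContDiff ℝ ∞ φ) : jacDet (projL φ) = mixedHessianDet φ := by
  funext P
  rw [jacDet, (hasFDerivAt_projL hφ P).fderiv, ← det_dyGradL hφ]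
  exact det_of_blockTriangular
    ((fderiv ℝ (gradL φ) P).comp (ContinuousLinearMap.inl ℝ _ _) : Rn d →ₗ[ℝ] Rn d) _ _
    fun p => Prod.ext rfl (map_prod_eq_add _ p)

/-- The determinant of `(x, y) ↦ (y, x)`. -/
def swapDet (d : ℕ) : ℝ :=
  LinearMap.det ((LinearEquiv.prodComm ℝ (Rn d) (Rn d)) : Rn d × Rn d →ₗ[ℝ] Rn d × Rn d)

lemma swapDet_ne_zero (d : ℕ) : swapDet d ≠ 0 :=
  (LinearEquiv.isUnit_det' _).ne_zero

/-- Block triangular after exchanging the variables. The sign of the exchange is left unevaluated,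
since only its being nonzero matters for the singular variety and for tangency. -/
lemma jacDet_projR (hφ : ContDiff ℝ ∞ φ) :
    jacDet (projR φ) = fun P => mixedHessianDet φ P * swapDet d := by
  funext P
  rw [jacDet, (hasFDerivAt_projR hφ P).fderiv, ← det_dxGradR hφ, swapDet]
  set T : Rn d × Rn d →L[ℝ] Rn d × Rn d :=
    (ContinuousLinearMap.snd ℝ _ _).prod (fderiv ℝ (gradR φ) P) with hT
  have h1 : (T : Rn d × Rn d →ₗ[ℝ] Rn d × Rn d) = ((T : Rn d × Rn d →ₗ[ℝ] Rn d × Rn d) ∘ₗ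
      (LinearEquiv.prodComm ℝ (Rn d) (Rn d)).toLinearMap) ∘ₗ
      (LinearEquiv.prodComm ℝ (Rn d) (Rn d)).toLinearMap := by
    refine LinearMap.ext fun p => ?_
    simp
  rw [ContinuousLinearMap.det, h1, LinearMap.det_comp]
  congr 1
  refine det_of_blockTriangular
    ((fderiv ℝ (gradR φ) P).comp (ContinuousLinearMap.inr ℝ _ _) : Rn d →ₗ[ℝ] Rn d) _ _
    fun p => Prod.ext rfl ?_
  have h2 := map_prod_eq_add (fderiv ℝ (gradR φ) P) (p.2, p.1)
  rw [add_comm] at h2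
  exact h2

end MixedDerivative

end

noncomputable section

/-! ### Quantitative injectivity, a Gronwall argument, and division by a defining function. -/

section Calculus

open scoped Topology
open Filter

variable {E F : Type*} [NormedAddCommGroup E] [NormedSpace ℝ E]
  [NormedAddCommGroup F] [NormedSpace ℝ F]

lemma HasStrictFDerivAt.exists_eventually_norm_sub_le {f : E → F} {f' : E →L[ℝ] F} {a : E}
    (hf : HasStrictFDerivAt f f' a) :
    ∃ C, 0 ≤ C ∧ ∀ᶠ p in 𝓝 (a, a), ‖f p.1 - f p.2‖ ≤ C * ‖p.1 - p.2‖ := by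
  obtain ⟨C, hC, h⟩ := hf.isBigO_sub.exists_nonneg
  exact ⟨C, hC, h.bound⟩

/-- An injective linear map on a finite-dimensional space is bounded below by some `K⁻¹`, and strict
differentiability makes the error at most half of that. -/
lemma HasStrictFDerivAt.exists_eventually_norm_sub_le_of_injective [FiniteDimensional ℝ E]
    {f : E → F} {f' : E →L[ℝ] F} {a : E}
    (hf : HasStrictFDerivAt f f' a) (hinj : ∀ x, f' x = 0 → x = 0) :
    ∃ C, 0 ≤ C ∧ ∀ᶠ p in 𝓝 (a, a), ‖p.1 - p.2‖ ≤ C * ‖f p.1 - f p.2‖ := by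
  obtain ⟨K, hK, hanti⟩ := LinearMap.exists_antilipschitzWith (f' : E →ₗ[ℝ] F)
    (LinearMap.ker_eq_bot'.mpr hinj)
  have hK' : (0 : ℝ) < K := hK
  refine ⟨2 * K, by positivity, ?_⟩
  filter_upwards [hf.isLittleO.def (c := (2 * (K : ℝ))⁻¹) (by positivity)] with p hp
  have h1 : ‖p.1 - p.2‖ ≤ K * ‖f' (p.1 - p.2)‖ := by
    have h0 := hanti.le_mul_dist p.1 p.2
    rw [dist_eq_norm, dist_eq_norm, ← map_sub] at h0
    exact h0
  have h2 : ‖f' (p.1 - p.2)‖ ≤ ‖f p.1 - f p.2‖ + (2 * (K : ℝ))⁻¹ * ‖p.1 - p.2‖ := by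
    have h3 := norm_sub_norm_le (f' (p.1 - p.2)) (f p.1 - f p.2)
    rw [norm_sub_rev (f' _)] at h3
    linarith
  have h3 : ‖p.1 - p.2‖ ≤ K * ‖f p.1 - f p.2‖ + ‖p.1 - p.2‖ / 2 := by
    calc ‖p.1 - p.2‖ ≤ K * (‖f p.1 - f p.2‖ + (2 * (K : ℝ))⁻¹ * ‖p.1 - p.2‖) := by
          refine h1.trans ?_
          gcongr
      _ = _ := by field_simp
  linarith

/-- If `H' = O(H)` and `H = O(f')` on `[0, 1]`, then `H 0` is controlled by the increment
of `f`. -/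
lemma abs_le_of_abs_deriv_le {f G H H' : ℝ → ℝ} {M c : ℝ} (hM : 0 ≤ M)
    (hf : ∀ t ∈ Set.Icc (0 : ℝ) 1, HasDerivAt f (G t) t)
    (hH : ∀ t ∈ Set.Icc (0 : ℝ) 1, HasDerivAt H (H' t) t)
    (hH' : ∀ t ∈ Set.Icc (0 : ℝ) 1, |H' t| ≤ M * |H t|)
    (hG : ∀ t ∈ Set.Icc (0 : ℝ) 1, |H t| ≤ c * |G t|) :
    |H 0| ≤ c * Real.exp M * |f 1 - f 0| := by
  obtain ⟨t, ht, hslope⟩ := exists_hasDerivAt_eq_slope f G zero_lt_one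
    (fun t ht => (hf t ht).continuousAt.continuousWithinAt)
    (fun t ht => hf t (Set.Ioo_subset_Icc_self ht))
  have htI := Set.Ioo_subset_Icc_self ht
  rw [sub_zero, div_one] at hslope
  -- The factor `e^{2Ms}` makes `H²` nondecreasing, so `|H 0| ≤ e^M |H t|` at the point `t` where
  -- the mean value theorem identifies `G t` with the increment of `f`.
  have hE : ∀ s ∈ Set.Icc (0 : ℝ) 1, HasDerivAt (fun s => H s ^ 2 * Real.exp (2 * M * s))
      (2 * (H s * H' s + M * H s ^ 2) * Real.exp (2 * M * s)) s := by
    intro s hs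
    have h1 := (hH s hs).fun_pow 2
    have h2 : HasDerivAt (fun s => Real.exp (2 * M * s)) (Real.exp (2 * M * s) * (2 * M)) s := by
      have := ((hasDerivAt_id s).const_mul (2 * M)).exp
      simpa using this
    refine (h1.fun_mul h2).congr_deriv ?_
    push_cast
    ring
  have hmono : MonotoneOn (fun s => H s ^ 2 * Real.exp (2 * M * s)) (Set.Icc 0 1) := by
    refine monotoneOn_of_deriv_nonneg (convex_Icc 0 1)
      (fun s hs => (hE s hs).continuousAt.continuousWithinAt)
      (fun s hs => (hE s (interior_subset hs)).differentiableAt.differentiableWithinAt) ?_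
    intro s hs
    rw [(hE s (interior_subset hs)).deriv]
    have h1 := hH' s (interior_subset hs)
    have h2 : |H s * H' s| ≤ M * H s ^ 2 := by
      rw [abs_mul, ← sq_abs (H s)]
      nlinarith [abs_nonneg (H s)]
    have h3 := (abs_le.mp h2).1
    have h4 : 0 ≤ H s * H' s + M * H s ^ 2 := by linarith
    positivity
  have h1 := hmono (Set.left_mem_Icc.mpr zero_le_one) htI ht.1.le
  simp only [mul_zero, Real.exp_zero, mul_one] at h1
  have h2 : H 0 ^ 2 ≤ (|H t| * Real.exp M) ^ 2 := by
    refine h1.trans ?_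
    rw [mul_pow, sq_abs, ← Real.exp_nat_mul]
    refine mul_le_mul_of_nonneg_left (Real.exp_le_exp.mpr ?_) (sq_nonneg _)
    push_cast
    nlinarith [ht.2]
  have h3 : |H 0| ≤ |H t| * Real.exp M := abs_le_of_sq_le_sq' h2 (by positivity) |> abs_le.mpr
  calc |H 0| ≤ |H t| * Real.exp M := h3
    _ ≤ c * |G t| * Real.exp M := by gcongr; exact hG t htI
    _ = _ := by rw [hslope]; ring

/-- A function vanishing on the regular hypersurface `{h = 0}` is `O(h)`. -/
lemma exists_eventually_abs_le_of_eq_zero [CompleteSpace E] {h : E → ℝ} {h' : E →L[ℝ] ℝ} {a : E}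
    (hh : HasStrictFDerivAt h h' a) (ha : h a = 0) (h'0 : h' ≠ 0) {G : E → ℝ}
    {G' : E →L[ℝ] ℝ} (hG : HasStrictFDerivAt G G' a) (hzero : ∀ᶠ P in 𝓝 a, h P = 0 → G P = 0) :
    ∃ M, 0 ≤ M ∧ ∀ᶠ P in 𝓝 a, |G P| ≤ M * |h P| := by
  have hrange : (h' : E →ₗ[ℝ] ℝ).range = ⊤ := by
    refine LinearMap.range_eq_top.mpr (LinearMap.surjective fun h0 => h'0 ?_)
    exact ContinuousLinearMap.coe_injective h0
  set R := h'.nonlinearRightInverseOfSurjective hrange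
  have hR : 0 < R.nnnorm := h'.nonlinearRightInverseOfSurjective_nnnorm_pos hrange
  have hR' : (0 : ℝ) < R.nnnorm := hR
  obtain ⟨s, hs, happ⟩ := hh.approximates_deriv_on_nhds (c := R.nnnorm⁻¹ / 2)
    (Or.inr (by positivity))
  obtain ⟨L, hL, hGL⟩ := hG.exists_eventually_norm_sub_le
  obtain ⟨u, hu, hGu⟩ := (nhds_prod_eq (x := a) (y := a) ▸ hGL).exists_mem.imp fun _ h => h
  obtain ⟨t₁, ht₁, t₂, ht₂, ht⟩ := Filter.mem_prod_iff.mp hu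
  obtain ⟨r, hr, hball⟩ := Metric.mem_nhds_iff.mp
    (Filter.inter_mem (Filter.inter_mem hs (Filter.inter_mem ht₁ ht₂)) hzero)
  refine ⟨L * (2 * R.nnnorm), by positivity, ?_⟩
  have hsmall : ∀ᶠ P in 𝓝 a, 2 * R.nnnorm * |h P| < r / 2 := by
    have h1 : ContinuousAt (fun P => 2 * (R.nnnorm : ℝ) * |h P|) a :=
      (hh.continuousAt.abs).const_mul _
    refine h1.eventually_lt continuousAt_const ?_
    simp only [ha, abs_zero, mul_zero]
    positivity
  filter_upwards [hsmall, Metric.ball_mem_nhds a (half_pos hr)] with P hP hPa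
  have hPa' : dist P a < r / 2 := hPa
  have hsub : Metric.closedBall P (2 * R.nnnorm * |h P|) ⊆ Metric.ball a r := by
    intro Q hQ
    have h1 : dist Q P ≤ 2 * R.nnnorm * |h P| := hQ
    have h2 := dist_triangle Q P a
    exact Metric.mem_ball.mpr (by linarith)
  -- Quantitative surjectivity of `h` provides a zero `Q` at distance `O(|h P|)` from `P`. Since `G
  -- Q = 0`, the Lipschitz bound for `G` finishes. The radius carries a factor `2` because half of
  -- the inverse bound is lost to the nonlinearity.
  have hsurj := happ.surjOn_closedBall_of_nonlinearRightInverse R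
    (ε := 2 * R.nnnorm * |h P|) (b := P) (by positivity)
    (fun Q hQ => (hball (hsub hQ)).1.1)
  have h0 : (0 : ℝ) ∈ Metric.closedBall (h P)
      (((R.nnnorm : ℝ)⁻¹ - ((R.nnnorm⁻¹ / 2 : NNReal) : ℝ)) * (2 * R.nnnorm * |h P|)) := by
    rw [Metric.mem_closedBall, dist_comm, Real.dist_eq, sub_zero]
    push_cast
    apply le_of_eq
    field_simp
    ring
  obtain ⟨Q, hQ, hQ0⟩ := hsurj h0
  have hQ1 : G Q = 0 := (hball (hsub hQ)).2 hQ0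
  have hPr : P ∈ Metric.ball a r := Metric.mem_ball.mpr (by linarith)
  have h1 := hGu (P, Q) (ht ⟨(hball hPr).1.2.1, (hball (hsub hQ)).1.2.2⟩)
  simp only [hQ1, sub_zero, Real.norm_eq_abs] at h1
  refine h1.trans ?_
  rw [mul_assoc]
  gcongr
  rw [← dist_eq_norm, dist_comm]
  exact hQ

end Calculus

/-! ### A smooth extension of the kernel field off the singular variety. -/

section KernelField

lemma isOpen_augment_det_ne_zero {E M : Type*} [NormedAddCommGroup E] [InnerProductSpace ℝ E]
    [TopologicalSpace M] {u v : E} {S : M → E →L[ℝ] E} (hS : Continuous S) :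
    IsOpen {P | (augment u v (S P)).det ≠ 0} :=
  isOpen_ne.preimage (ContinuousLinearMap.continuous_det.comp
    ((contDiff_augment u v).continuous.comp hS))

variable {E M : Type*} [NormedAddCommGroup E] [InnerProductSpace ℝ E] [FiniteDimensional ℝ E]
  [NormedAddCommGroup M] [NormedSpace ℝ M]

/-- The solution `w` of `augment u v S w = v`, which spans `ker S` when `det S = 0`. -/
def kernelVec (u v : E) (S : E →L[ℝ] E) : E := (augment u v S).inverse v

lemma augment_kernelVec {u v : E} {S : E →L[ℝ] E} (hS : (augment u v S).det ≠ 0) :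
    augment u v S (kernelVec u v S) = v := by
  have h1 := ContinuousLinearMap.coe_toContinuousLinearEquivOfDetNeZero _ hS
  set e := (augment u v S).toContinuousLinearEquivOfDetNeZero hS
  rw [kernelVec, ← h1, ContinuousLinearMap.inverse_equiv]
  exact e.apply_symm_apply v

lemma eq_zero_of_det_ne_zero {T : E →L[ℝ] E} (hT : T.det ≠ 0) {x : E} (hx : T x = 0) : x = 0 := by
  have h1 := T.toContinuousLinearEquivOfDetNeZero_apply hT x
  rw [hx] at h1
  exact (ContinuousLinearEquiv.map_eq_zero_iff _).mp h1

lemma eq_kernelVec {u v : E} {S : E →L[ℝ] E} (hS : (augment u v S).det ≠ 0) {w : E}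
    (hw : augment u v S w = v) : w = kernelVec u v S := by
  refine sub_eq_zero.mp (eq_zero_of_det_ne_zero hS ?_)
  rw [map_sub, hw, augment_kernelVec hS, sub_self]

/-- No condition on `det S`: the vector is defined and smooth on a full neighbourhood and spans the
kernel only where `det S = 0`. This provides the fields on which the fold and blowdown conditions
are tested. -/
lemma contDiffAt_kernelVec {u v : E} {S : M → E →L[ℝ] E} (hS : ContDiff ℝ ∞ S) {P : M}
    (hP : (augment u v (S P)).det ≠ 0) : ContDiffAt ℝ ∞ (fun P => kernelVec u v (S P)) P := by
  have h1 := ContinuousLinearMap.coe_toContinuousLinearEquivOfDetNeZero _ hP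
  set e := (augment u v (S P)).toContinuousLinearEquivOfDetNeZero hP
  have h2 : ContDiffAt ℝ ∞ ContinuousLinearMap.inverse (augment u v (S P)) := by
    rw [← h1]
    exact contDiffAt_map_inverse e
  have h3 : ContDiffAt ℝ ∞ (fun P => (augment u v (S P)).inverse) P :=
    ContDiffAt.comp (f := fun P => augment u v (S P)) P h2
      ((contDiff_augment u v).comp hS).contDiffAt
  exact h3.clm_apply contDiffAt_const

lemma apply_kernelVec_eq_zero {u v : E} {S : E →L[ℝ] E} (hv : ‖v‖ = 1)
    (hS : (augment u v S).det ≠ 0) (h0 : S.det = 0) : S (kernelVec u v S) = 0 := by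
  have hw := augment_kernelVec hS
  rw [det_eq_inner_mul_det_augment hw hv, mul_eq_zero, or_iff_left hS] at h0
  rw [(apply_eq_smul_of_augment_eq hw hv).1, h0, zero_smul]

lemma kernelVec_ne_zero {u v : E} {S : E →L[ℝ] E} (hv : ‖v‖ = 1)
    (hS : (augment u v S).det ≠ 0) : kernelVec u v S ≠ 0 := by
  intro h
  have hw := augment_kernelVec hS
  rw [h, map_zero] at hw
  rw [← hw, norm_zero] at hv
  exact zero_ne_one hv

/-- Any kernel vector of `S` is a multiple of `kernelVec u v S`. -/
lemma eq_smul_kernelVec {u v : E} {S : E →L[ℝ] E} (hS : (augment u v S).det ≠ 0) {x : E}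
    (hx : S x = 0) : x = (inner ℝ u x) • kernelVec u v S := by
  refine sub_eq_zero.mp (eq_zero_of_det_ne_zero hS ?_)
  rw [map_sub, map_smul, augment_kernelVec hS, augment_apply, hx, inner_zero_right, sub_zero,
    zero_add, sub_self]

end KernelField

end

noncomputable section

/-! ### Separation of points under the blowdown condition. -/

section BlowdownEstimate

open scoped Topology
open Filter

variable {E : Type*} [NormedAddCommGroup E] [InnerProductSpace ℝ E] [FiniteDimensional ℝ E]

lemma ContDiff.exists_eventually_norm_comp_sub_le {E F M : Type*} [NormedAddCommGroup E]
    [NormedSpace ℝ E] [NormedAddCommGroup F] [NormedSpace ℝ F] [NormedAddCommGroup M]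
    [NormedSpace ℝ M] {f : E → F} (hf : ContDiff ℝ ∞ f) {G : M → E} {a : M}
    (hG : ContDiffAt ℝ ∞ G a) :
    ∃ L, 0 ≤ L ∧ ∀ᶠ p in 𝓝 (a, a), ‖f (G p.1) - f (G p.2)‖ ≤ L * ‖p.1 - p.2‖ := by
  have h1 : ContDiffAt ℝ ∞ (fun Q => f (G Q)) a := hf.contDiffAt.comp _ hG
  exact (h1.hasStrictFDerivAt (by simp)).exists_eventually_norm_sub_le

set_option maxHeartbeats 1000000 in
/-- Local separation of points by `(Ψ, y)` up to the direction in which `D_x Ψ` degenerates, and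
with a loss of `|h|` in that direction when `h = det D_x Ψ` satisfies `W h = O(h)` for the kernel
field `W`. -/
theorem exists_eventually_blowdown_le {Ψ : E × E → E} (hΨ : ContDiff ℝ ∞ Ψ) {S : E × E → E →L[ℝ] E}
    (hS : ∀ P, S P = (fderiv ℝ Ψ P).comp (ContinuousLinearMap.inl ℝ E E))
    {h : E × E → ℝ} (hh : ContDiff ℝ ∞ h) (hdet : ∀ P, h P = (S P).det) {P₀ : E × E} {u v : E}
    (hv : ‖v‖ = 1) (hD : (augment u v (S P₀)).det ≠ 0) {M : ℝ} (hM : 0 ≤ M)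
    (hF : ∀ᶠ P in 𝓝 P₀, |fderiv ℝ h P (kernelVec u v (S P), 0)| ≤ M * |h P|) :
    ∃ C, 0 ≤ C ∧ ∀ᶠ p in 𝓝 (P₀, P₀), p.1.2 = p.2.2 →
      |h p.1| * ‖p.1.1 - p.2.1‖ ≤ C * ‖Ψ p.1 - Ψ p.2‖ ∧
      ‖p.1.1 - p.2.1‖ ≤ C * (‖Ψ p.1 - Ψ p.2‖ + |inner ℝ (p.1.1 - p.2.1) u|) := by
  have hΨd : Differentiable ℝ Ψ := hΨ.differentiable (by simp)
  have hhd : Differentiable ℝ h := hh.differentiable (by simp)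
  have hSc : Continuous S := by
    have h1 : S = fun P => (fderiv ℝ Ψ P).comp (ContinuousLinearMap.inl ℝ E E) := funext hS
    rw [h1]
    exact (hΨ.continuous_fderiv (by simp)).clm_comp continuous_const
  -- The map `(Θ, y)` is a local diffeomorphism even where `Ψ` degenerates, because the component of
  -- `Ψ` along `v` has been replaced by the coordinate `⟨u, x⟩`.
  set Θ : E × E → E := fun P => Ψ P + (inner ℝ u P.1 - inner ℝ v (Ψ P)) • v with hΘ
  have hΘv : ∀ P, inner ℝ v (Θ P) = inner ℝ u P.1 := by
    intro P
    rw [hΘ]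
    simp only [inner_add_right, inner_smul_right, real_inner_self_eq_norm_sq, hv]
    ring
  set κ : E × E → E × E := fun P => (Θ P, P.2) with hκ
  have hκs : ContDiff ℝ ∞ κ := by
    have hΘs : ContDiff ℝ ∞ Θ := by
      have h1 : ContDiff ℝ ∞ fun P : E × E => inner ℝ u P.1 :=
        (innerSL ℝ u).contDiff.comp contDiff_fst
      have h2 : ContDiff ℝ ∞ fun P => inner ℝ v (Ψ P) := (innerSL ℝ v).contDiff.comp hΨ
      exact hΨ.add ((h1.sub h2).fun_smul contDiff_const)
    exact hΘs.prodMk contDiff_snd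
  have hκd : Differentiable ℝ κ := hκs.differentiable (by simp)
  have hκ' : ∀ P q, (fderiv ℝ κ P q).2 = q.2 ∧
      (q.2 = 0 → (fderiv ℝ κ P q).1 = augment u v (S P) q.1) := by
    intro P q
    have h1 : HasFDerivAt κ (((fderiv ℝ Ψ P) + ((innerSL ℝ u).comp (ContinuousLinearMap.fst ℝ E E)
        - (innerSL ℝ v).comp (fderiv ℝ Ψ P)).smulRight v).prod
          (ContinuousLinearMap.snd ℝ E E)) P := by
      refine HasFDerivAt.prodMk ?_ hasFDerivAt_snd
      have h2 := (hΨd P).hasFDerivAt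
      refine h2.add (HasFDerivAt.smul_const (HasFDerivAt.sub ?_ ?_) v)
      · exact (innerSL ℝ u).hasFDerivAt.comp P hasFDerivAt_fst
      · exact (innerSL ℝ v).hasFDerivAt.comp P h2
    rw [h1.fderiv]
    refine ⟨rfl, fun h0 => ?_⟩
    obtain ⟨a, b⟩ := q
    obtain rfl : b = 0 := h0
    rw [augment_apply, hS]
    rfl
  have hκinj : ∀ q, fderiv ℝ κ P₀ q = 0 → q = 0 := by
    intro q hq
    have h1 := hκ' P₀ q
    rw [hq] at h1
    have h2 : q.2 = 0 := h1.1.symm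
    exact Prod.ext (eq_zero_of_det_ne_zero hD (h1.2 h2).symm) h2
  set e' : (E × E) ≃L[ℝ] (E × E) := (LinearEquiv.ofInjectiveEndo
    (fderiv ℝ κ P₀ : E × E →ₗ[ℝ] E × E) ((injective_iff_map_eq_zero _).mpr hκinj)).toContinuousLinearEquiv
    with he'
  have hκ0 : HasFDerivAt κ (e' : E × E →L[ℝ] E × E) P₀ := by
    have h1 : (e' : E × E →L[ℝ] E × E) = fderiv ℝ κ P₀ := by
      ext q <;> rfl
    rw [h1]
    exact (hκd P₀).hasFDerivAt
  set e := hκs.contDiffAt.toOpenPartialHomeomorph κ hκ0 (by simp) with he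
  set G : E × E → E × E := fun Q => e.symm Q with hG
  have hes : P₀ ∈ e.source := ContDiffAt.mem_toOpenPartialHomeomorph_source _ _ _
  have het : κ P₀ ∈ e.target := e.map_source hes
  have hG0 : G (κ P₀) = P₀ := e.left_inv hes
  have hGs : ContDiffAt ℝ ∞ G (κ P₀) := by
    refine e.contDiffAt_symm (f₀' := e') het ?_ hκs.contDiffAt
    rw [show e.symm (κ P₀) = P₀ from hG0]
    exact hκ0
  have hGc : Tendsto G (𝓝 (κ P₀)) (𝓝 P₀) := by
    have := hGs.continuousAt
    rwa [ContinuousAt, hG0] at this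
  have hGleft : ∀ᶠ P in 𝓝 P₀, G (κ P) = P := e.eventually_left_inverse hes
  have hGright : ∀ᶠ Q in 𝓝 (κ P₀), κ (G Q) = Q := e.eventually_right_inverse het
  -- Lipschitz bounds in the straightened coordinates
  obtain ⟨L₁, hL₁, hlip₁⟩ := (contDiff_fst (F := E)).exists_eventually_norm_comp_sub_le hGs
  obtain ⟨L₂, hL₂, hlip₂⟩ := hh.exists_eventually_norm_comp_sub_le hGs
  obtain ⟨L₃, hL₃, hlip₃⟩ := hΨ.exists_eventually_norm_comp_sub_le hGs
  set D₁ : ℝ := |(augment u v (S P₀)).det| + 1 with hD₁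
  have hdetc : Continuous fun P => (augment u v (S P)).det :=
    ContinuousLinearMap.continuous_det.comp ((contDiff_augment u v).continuous.comp hSc)
  have hDle : ∀ᶠ P in 𝓝 P₀, |(augment u v (S P)).det| ≤ D₁ := by
    have := hdetc.abs.continuousAt.eventually_lt (x₀ := P₀) (continuousAt_const (y := D₁))
      (lt_add_one _)
    exact this.mono fun P hP => hP.le
  have hDne : ∀ᶠ P in 𝓝 P₀, (augment u v (S P)).det ≠ 0 :=
    (isOpen_augment_det_ne_zero hSc).mem_nhds hD
  have hGdiff : ∀ᶠ Q in 𝓝 (κ P₀), DifferentiableAt ℝ G Q :=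
    ((hGs.of_le (m := 1) (by exact_mod_cast le_top)).eventually (by simp)).mono
      fun Q hQ => hQ.differentiableAt (by simp)
  have hgood : ∀ᶠ Q in 𝓝 (κ P₀), DifferentiableAt ℝ G Q ∧ (∀ᶠ Q' in 𝓝 Q, κ (G Q') = Q') ∧
      |(augment u v (S (G Q))).det| ≤ D₁ ∧ (augment u v (S (G Q))).det ≠ 0 ∧
      |fderiv ℝ h (G Q) (kernelVec u v (S (G Q)), 0)| ≤ M * |h (G Q)| :=
    hGdiff.and (hGright.eventually_nhds.and ((hGc.eventually hDle).and
      ((hGc.eventually hDne).and (hGc.eventually hF))))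
  -- The requirement `r ≤ 1` keeps the displacement `τ` below `1` in absolute value, so that a
  -- second factor `τ` can be dropped.
  obtain ⟨r, hr, hr1, hball⟩ : ∃ r > 0, r ≤ 1 ∧ ∀ Q ∈ Metric.ball (κ P₀) r,
      (∀ Q' ∈ Metric.ball (κ P₀) r, ‖(G Q).1 - (G Q').1‖ ≤ L₁ * ‖Q - Q'‖ ∧
        |h (G Q) - h (G Q')| ≤ L₂ * ‖Q - Q'‖ ∧ ‖Ψ (G Q) - Ψ (G Q')‖ ≤ L₃ * ‖Q - Q'‖) ∧
      DifferentiableAt ℝ G Q ∧ (∀ᶠ Q' in 𝓝 Q, κ (G Q') = Q') ∧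
      |(augment u v (S (G Q))).det| ≤ D₁ ∧ (augment u v (S (G Q))).det ≠ 0 ∧
      |fderiv ℝ h (G Q) (kernelVec u v (S (G Q)), 0)| ≤ M * |h (G Q)| := by
    obtain ⟨r₁, hr₁, hb₁⟩ := Metric.eventually_nhds_iff_ball.mp (hlip₁.and (hlip₂.and hlip₃))
    obtain ⟨r₂, hr₂, hb₂⟩ := Metric.eventually_nhds_iff_ball.mp hgood
    refine ⟨min (min r₁ r₂) 1, by positivity, min_le_right _ _, fun Q hQ => ⟨fun Q' hQ' => ?_, ?_⟩⟩
    · refine hb₁ (Q, Q') ?_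
      rw [← ball_prod_same]
      exact ⟨Metric.ball_subset_ball ((min_le_left _ _).trans (min_le_left _ _)) hQ,
        Metric.ball_subset_ball ((min_le_left _ _).trans (min_le_left _ _)) hQ'⟩
    · exact hb₂ Q (Metric.ball_subset_ball ((min_le_left _ _).trans (min_le_right _ _)) hQ)
  -- integration along the lines in direction `v`
  have hline : ∀ (Q : E × E) (τ : ℝ), |τ| ≤ 1 →
      (∀ t ∈ Set.Icc (0 : ℝ) 1, Q + t • (τ • v, (0 : E)) ∈ Metric.ball (κ P₀) r) →
      |τ| * |h (G Q)| ≤ D₁ * Real.exp M * ‖Ψ (G (Q + (τ • v, 0))) - Ψ (G Q)‖ := by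
    intro Q τ hτ hQ
    set c : ℝ → E × E := fun t => Q + t • (τ • v, (0 : E)) with hc
    have hcd : ∀ t, HasDerivAt c (τ • v, (0 : E)) t := by
      intro t
      have h0 := ((hasDerivAt_id t).smul_const (τ • v, (0 : E))).const_add Q
      rw [one_smul] at h0
      exact h0
    -- Differentiating `κ ∘ G = id` shows that `dG (v, 0)` solves the augmented equation. Lines in
    -- direction `v` are thus carried by `G` to integral curves of the kernel field with `y` fixed.
    have hGc' : ∀ t ∈ Set.Icc (0 : ℝ) 1, HasDerivAt (fun t => G (c t))
        (τ • (kernelVec u v (S (G (c t))), (0 : E))) t := by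
      intro t ht
      obtain ⟨-, hd, hinv, -, hne, -⟩ := hball _ (hQ t ht)
      have h1 : HasDerivAt (fun t => G (c t)) (fderiv ℝ G (c t) (τ • v, 0)) t :=
        hd.hasFDerivAt.comp_hasDerivAt t (hcd t)
      have h2 : HasFDerivAt (fun Q => κ (G Q)) ((fderiv ℝ κ (G (c t))).comp (fderiv ℝ G (c t)))
          (c t) := (hκd _).hasFDerivAt.comp _ hd.hasFDerivAt
      have h3 := h2.unique ((hasFDerivAt_id (c t)).congr_of_eventuallyEq hinv)
      have h4 : fderiv ℝ κ (G (c t)) (fderiv ℝ G (c t) (v, 0)) = (v, 0) :=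
        congrArg (fun T => T (v, (0 : E))) h3
      obtain ⟨h5, h6⟩ := hκ' (G (c t)) (fderiv ℝ G (c t) (v, 0))
      rw [h4] at h5 h6
      have h7 : fderiv ℝ G (c t) (v, 0) = (kernelVec u v (S (G (c t))), 0) :=
        Prod.ext (eq_kernelVec hne (h6 h5.symm).symm) h5.symm
      have h8 : ((τ • v, 0) : E × E) = τ • (v, 0) := by simp
      rw [h8, map_smul, h7] at h1
      exact h1
    -- Along the curve, `⟨v, Ψ⟩` has derivative `τ ⟨v, S w⟩`. By the factorization of `det S` this
    -- dominates `τ h / D₁`, while `h` has derivative `O(h)`.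
    have hmain := abs_le_of_abs_deriv_le (f := fun t => inner ℝ v (Ψ (G (c t))))
      (G := fun t => τ * inner ℝ v (S (G (c t)) (kernelVec u v (S (G (c t))))))
      (H := fun t => τ * h (G (c t)))
      (H' := fun t => τ * (τ * fderiv ℝ h (G (c t)) (kernelVec u v (S (G (c t))), 0)))
      (M := M) (c := D₁) hM ?_ ?_ ?_ ?_
    · have hc0 : c 0 = Q := by rw [hc]; simp
      have hc1 : c 1 = Q + (τ • v, 0) := by rw [hc]; simp
      simp only [hc0, hc1, abs_mul] at hmain
      refine hmain.trans ?_
      rw [← inner_sub_right]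
      have h1 := abs_real_inner_le_norm v (Ψ (G (Q + (τ • v, 0))) - Ψ (G Q))
      rw [hv, one_mul] at h1
      gcongr
    · intro t ht
      have h1 := (hΨd (G (c t))).hasFDerivAt.comp_hasDerivAt t (hGc' t ht)
      have h2 := (innerSL ℝ v).hasFDerivAt.comp_hasDerivAt t h1
      refine h2.congr_deriv ?_
      rw [map_smul, map_smul, hS, smul_eq_mul]
      rfl
    · intro t ht
      have h1 := ((hhd (G (c t))).hasFDerivAt.comp_hasDerivAt t (hGc' t ht)).const_mul τ
      refine h1.congr_deriv ?_
      rw [map_smul, smul_eq_mul]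
    · intro t ht
      have h1 := (hball _ (hQ t ht)).2.2.2.2.2
      simp only [abs_mul]
      calc |τ| * (|τ| * |fderiv ℝ h (G (c t)) (kernelVec u v (S (G (c t))), 0)|)
          ≤ |τ| * (1 * (M * |h (G (c t))|)) := by gcongr
        _ = _ := by ring
    · intro t ht
      obtain ⟨-, -, -, h1, h2, -⟩ := hball _ (hQ t ht)
      have h3 := det_eq_inner_mul_det_augment (augment_kernelVec h2) hv
      simp only [hdet]
      rw [h3]
      simp only [abs_mul]
      calc |τ| * (|inner ℝ v (S (G (c t)) (kernelVec u v (S (G (c t)))))|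
            * |(augment u v (S (G (c t)))).det|)
          ≤ |τ| * (|inner ℝ v (S (G (c t)) (kernelVec u v (S (G (c t)))))| * D₁) := by gcongr
        _ = _ := by ring
  -- bounds for the original coordinates
  set H₀ : ℝ := |h P₀| + 1 with hH₀
  have hhle : ∀ᶠ P in 𝓝 P₀, |h P| ≤ H₀ := by
    have := hh.continuous.abs.continuousAt.eventually_lt (x₀ := P₀) (continuousAt_const (y := H₀))
      (lt_add_one _)
    exact this.mono fun P hP => hP.le
  have hκc : ∀ᶠ P in 𝓝 P₀, κ P ∈ Metric.ball (κ P₀) (r / 4) :=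
    hκs.continuous.continuousAt.eventually_mem (Metric.ball_mem_nhds _ (by positivity))
  have hP := hhle.and (hκc.and hGleft)
  have hpp : ∀ᶠ p in 𝓝 (P₀, P₀), (|h p.1| ≤ H₀ ∧ κ p.1 ∈ Metric.ball (κ P₀) (r / 4) ∧
      G (κ p.1) = p.1) ∧ (|h p.2| ≤ H₀ ∧ κ p.2 ∈ Metric.ball (κ P₀) (r / 4) ∧ G (κ p.2) = p.2) := by
    rw [nhds_prod_eq]
    exact hP.prod_mk hP
  have hD₁0 : 0 < D₁ := by positivity
  have hH₀0 : 0 < H₀ := by positivity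
  refine ⟨max (L₁ * (H₀ + L₂ + D₁ * Real.exp M * (1 + L₃))) L₁,
    le_max_of_le_right hL₁, hpp.mono ?_⟩
  rintro ⟨P, P'⟩ ⟨⟨hP1, hP2, hP3⟩, ⟨-, hP2', hP3'⟩⟩ hy
  simp only at hP1 hP2 hP3 hP2' hP3' hy ⊢
  set Δ := ‖Ψ P - Ψ P'‖ with hΔ
  -- `Θ P' - Θ P = b + τ v` with `b` orthogonal to `v`. As `Θ` and `Ψ` differ only along `v`, `b` is
  -- also the projection of `Ψ P' - Ψ P` off `v`, whence `‖b‖ ≤ Δ`.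
  set τ : ℝ := inner ℝ u (P'.1 - P.1) with hτ
  set b : E := Θ P' - Θ P - τ • v with hb
  have hbΔ : ‖b‖ ≤ Δ := by
    have h1 : b = (Ψ P' - Ψ P) - (inner ℝ v (Ψ P' - Ψ P)) • v := by
      rw [hb, hτ, hΘ]
      simp only [inner_sub_right]
      module
    have h2 : ‖b‖ ^ 2 ≤ Δ ^ 2 := by
      rw [h1, hΔ, norm_sub_rev (Ψ P), norm_sub_sq_real, norm_smul, inner_smul_right, hv,
        real_inner_comm, Real.norm_eq_abs, mul_one, sq_abs]
      nlinarith [sq_nonneg (inner ℝ v (Ψ P' - Ψ P))]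
    exact (sq_le_sq₀ (norm_nonneg _) (norm_nonneg _)).mp h2
  have hκP' : κ P' = κ P + (b, 0) + (τ • v, 0) := by
    refine Prod.ext ?_ ?_
    · simp only [hκ, hb, Prod.fst_add]
      abel
    · simp [hκ, hy]
  -- The corner of a two-step path: from `κ P` by `b`, which costs `O(Δ)`, and then along `v` to `κ
  -- P'`.
  set Q := κ P + (b, (0 : E)) with hQ
  have hdist : ‖κ P' - κ P‖ < r / 2 := by
    rw [← dist_eq_norm]
    have h1 : dist (κ P') (κ P₀) < r / 4 := hP2'
    have h2 : dist (κ P) (κ P₀) < r / 4 := hP2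
    have h3 := dist_triangle_right (κ P') (κ P) (κ P₀)
    linarith
  have hτeq : τ = inner ℝ v (Θ P' - Θ P) := by
    rw [inner_sub_right, hΘv, hΘv, ← inner_sub_right]
  have hdist' : ‖Θ P' - Θ P‖ < r / 2 := lt_of_le_of_lt (norm_fst_le (κ P' - κ P)) hdist
  have hτr : |τ| ≤ ‖Θ P' - Θ P‖ := by
    rw [hτeq]
    refine (abs_real_inner_le_norm _ _).trans ?_
    rw [hv, one_mul]
  have hbr : ‖b‖ ≤ ‖Θ P' - Θ P‖ := by
    have h2 : ‖b‖ ^ 2 ≤ ‖Θ P' - Θ P‖ ^ 2 := by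
      rw [hb, hτeq, norm_sub_sq_real, norm_smul, inner_smul_right, hv,
        real_inner_comm, Real.norm_eq_abs, mul_one, sq_abs]
      nlinarith [sq_nonneg (inner ℝ v (Θ P' - Θ P))]
    exact (sq_le_sq₀ (norm_nonneg _) (norm_nonneg _)).mp h2
  have hnorm0 : ∀ a : E, ‖((a, 0) : E × E)‖ = ‖a‖ := by
    intro a
    rw [Prod.norm_mk, norm_zero, max_eq_left (norm_nonneg _)]
  have hQball : Q ∈ Metric.ball (κ P₀) (3 * r / 4) := by
    have h2 : dist (κ P) (κ P₀) < r / 4 := hP2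
    have h3 : dist Q (κ P) = ‖b‖ := by
      rw [dist_eq_norm, hQ, add_sub_cancel_left, hnorm0]
    have h4 := dist_triangle Q (κ P) (κ P₀)
    exact Metric.mem_ball.mpr (by linarith)
  have hPball : κ P ∈ Metric.ball (κ P₀) r := Metric.ball_subset_ball (by linarith) hP2
  have hP'ball : κ P' ∈ Metric.ball (κ P₀) r := Metric.ball_subset_ball (by linarith) hP2'
  have hQball' : Q ∈ Metric.ball (κ P₀) r := Metric.ball_subset_ball (by linarith) hQball
  have hsegment : ∀ t ∈ Set.Icc (0 : ℝ) 1, Q + t • (τ • v, (0 : E)) ∈ Metric.ball (κ P₀) r := by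
    intro t ht
    have h1 : Q + t • (τ • v, (0 : E)) = (1 - t) • Q + t • κ P' := by
      rw [hκP']
      module
    rw [h1]
    exact (convex_ball _ _) hQball' hP'ball (by linarith [ht.2]) ht.1 (by ring)
  have hline' := hline Q τ (by linarith) hsegment
  rw [← hκP', hP3'] at hline'
  obtain ⟨hPQ, -⟩ := hball _ hPball
  obtain ⟨hl1, -, -⟩ := hPQ _ hP'ball
  obtain ⟨-, hl2, hl3⟩ := hPQ _ hQball'
  have hPQn : ‖κ P - Q‖ = ‖b‖ := by rw [hQ, sub_add_cancel_left, norm_neg, hnorm0]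
  rw [hP3, hPQn] at hl2 hl3
  rw [hP3, hP3'] at hl1
  have hκn : ‖κ P - κ P'‖ ≤ ‖b‖ + |τ| := by
    rw [hκP', add_assoc, sub_add_cancel_left, norm_neg]
    refine (norm_add_le _ _).trans ?_
    rw [hnorm0, hnorm0, norm_smul, hv, mul_one, Real.norm_eq_abs]
  have hsep : ‖P.1 - P'.1‖ ≤ L₁ * (Δ + |τ|) :=
    hl1.trans (mul_le_mul_of_nonneg_left (hκn.trans (by linarith)) hL₁)
  have hτu : |τ| = |inner ℝ (P.1 - P'.1) u| := by
    rw [hτ, real_inner_comm, ← neg_sub P.1 P'.1, inner_neg_left, abs_neg]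
  have hΔ0 : 0 ≤ Δ := norm_nonneg _
  constructor
  · have hbL₂ : L₂ * ‖b‖ ≤ L₂ * Δ := mul_le_mul_of_nonneg_left hbΔ hL₂
    have hbL₃ : L₃ * ‖b‖ ≤ L₃ * Δ := mul_le_mul_of_nonneg_left hbΔ hL₃
    have h1 : ‖Ψ P' - Ψ (G Q)‖ ≤ (1 + L₃) * Δ := by
      have h2 := norm_sub_le_norm_sub_add_norm_sub (Ψ P') (Ψ P) (Ψ (G Q))
      rw [norm_sub_rev (Ψ P') (Ψ P)] at h2
      linarith
    -- The line estimate bounds `|τ| |h|` at the corner `G Q`; passing from there to `P` costs only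
    -- `L₂ Δ`.
    have h2 : |τ| * |h P| ≤ (L₂ + D₁ * Real.exp M * (1 + L₃)) * Δ := by
      have h3 : |h P| ≤ |h (G Q)| + L₂ * Δ := by
        have h4 := abs_sub_abs_le_abs_sub (h P) (h (G Q))
        linarith
      have h5 : D₁ * Real.exp M * ‖Ψ P' - Ψ (G Q)‖ ≤ D₁ * Real.exp M * ((1 + L₃) * Δ) :=
        mul_le_mul_of_nonneg_left h1 (by positivity)
      have h6 : |τ| * (L₂ * Δ) ≤ 1 * (L₂ * Δ) :=
        mul_le_mul_of_nonneg_right (by linarith) (mul_nonneg hL₂ hΔ0)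
      have h7 := mul_le_mul_of_nonneg_left h3 (abs_nonneg τ)
      linarith
    calc |h P| * ‖P.1 - P'.1‖ ≤ |h P| * (L₁ * (Δ + |τ|)) := by gcongr
      _ = L₁ * (|h P| * Δ + |τ| * |h P|) := by ring
      _ ≤ L₁ * (H₀ * Δ + (L₂ + D₁ * Real.exp M * (1 + L₃)) * Δ) := by gcongr
      _ = (L₁ * (H₀ + L₂ + D₁ * Real.exp M * (1 + L₃))) * Δ := by ring
      _ ≤ _ := by gcongr; exact le_max_left _ _
  · rw [← hτu]
    refine hsep.trans ?_
    gcongr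
    exact le_max_right _ _

end BlowdownEstimate

end

noncomputable section

/-! ### From the fold and blowdown hypotheses to the local inequalities. -/

section LocalGeometry

open scoped Topology
open Filter

variable {d : ℕ} {φ : Rn d × Rn d → ℝ} {U : Set (Rn d × Rn d)} {P₀ : Rn d × Rn d}

lemma exists_eq_smul_of_finrank_le_one {V : Type*} [AddCommGroup V] [Module ℝ V]
    {N : Submodule ℝ V} [FiniteDimensional ℝ N] (hN : Module.finrank ℝ N ≤ 1) {p q : V}
    (hp : p ∈ N) (hq : q ∈ N) (hq0 : q ≠ 0) : ∃ c : ℝ, p = c • q := by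
  obtain ⟨w, hw⟩ := finrank_le_one_iff.mp hN
  obtain ⟨a, ha⟩ := hw ⟨p, hp⟩
  obtain ⟨b, hb⟩ := hw ⟨q, hq⟩
  have ha' : a • (w : V) = p := congrArg Subtype.val ha
  have hb' : b • (w : V) = q := congrArg Subtype.val hb
  have hb0 : b ≠ 0 := by
    rintro rfl
    exact hq0 (by rw [← hb', zero_smul])
  exact ⟨a / b, by rw [← ha', ← hb', smul_smul, div_mul_cancel₀ _ hb0]⟩

lemma mem_ker_projL (hφ : ContDiff ℝ ∞ φ) {P : Rn d × Rn d} {b : Rn d} (hb : dyGradL φ P b = 0) :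
    ((0, b) : Rn d × Rn d) ∈ (fderiv ℝ (projL φ) P).ker := by
  rw [(hasFDerivAt_projL hφ P).fderiv]
  exact Prod.ext rfl hb

lemma mem_ker_projR (hφ : ContDiff ℝ ∞ φ) {P : Rn d × Rn d} {a : Rn d} (ha : dxGradR φ P a = 0) :
    ((a, 0) : Rn d × Rn d) ∈ (fderiv ℝ (projR φ) P).ker := by
  rw [(hasFDerivAt_projR hφ P).fderiv]
  exact Prod.ext rfl ha

lemma exists_augment_dyGradL (hφ : ContDiff ℝ ∞ φ)
    (hL : HasCorankOneSingularities (projL φ) U) (hP₀ : P₀ ∈ U) (h0 : mixedHessianDet φ P₀ = 0) :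
    ∃ u v : Rn d, ‖v‖ = 1 ∧ (augment u v (dyGradL φ P₀)).det ≠ 0 := by
  obtain ⟨u, v, -, hv, -, h⟩ := exists_augment_det_ne_zero (S := dyGradL φ P₀)
    (by rw [det_dyGradL hφ, h0]) (fun a b ha hb hb0 => by
      obtain ⟨c, hc⟩ := exists_eq_smul_of_finrank_le_one (hL.corank_le_one P₀ hP₀)
        (mem_ker_projL hφ ha) (mem_ker_projL hφ hb) (fun h => hb0 (congrArg Prod.snd h))
      exact ⟨c, congrArg Prod.snd hc⟩)
  exact ⟨u, v, hv, h⟩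

lemma exists_augment_dxGradR (hφ : ContDiff ℝ ∞ φ)
    (hR : HasCorankOneSingularities (projR φ) U) (hP₀ : P₀ ∈ U) (h0 : mixedHessianDet φ P₀ = 0) :
    ∃ u v : Rn d, ‖v‖ = 1 ∧ (augment u v (dxGradR φ P₀)).det ≠ 0 := by
  obtain ⟨u, v, -, hv, -, h⟩ := exists_augment_det_ne_zero (S := dxGradR φ P₀)
    (by rw [det_dxGradR hφ, h0]) (fun a b ha hb hb0 => by
      obtain ⟨c, hc⟩ := exists_eq_smul_of_finrank_le_one (hR.corank_le_one P₀ hP₀)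
        (mem_ker_projR hφ ha) (mem_ker_projR hφ hb) (fun h => hb0 (congrArg Prod.fst h))
      exact ⟨c, congrArg Prod.fst hc⟩)
  exact ⟨u, v, hv, h⟩

/-- On a Whitney fold, `(x, φ_x, h)` is an immersion. -/
lemma eq_zero_of_isWhitneyFoldOn (hφ : ContDiff ℝ ∞ φ) (hU : IsOpen U)
    (hL : IsWhitneyFoldOn (projL φ) U) (hP₀ : P₀ ∈ U) {b : Rn d} (hb : dyGradL φ P₀ b = 0)
    (hb' : fderiv ℝ (mixedHessianDet φ) P₀ (0, b) = 0) : b = 0 := by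
  by_cases h0 : mixedHessianDet φ P₀ = 0
  swap
  · exact eq_zero_of_det_ne_zero (by rwa [det_dyGradL hφ]) hb
  obtain ⟨u, v, hv, hD⟩ := exists_augment_dyGradL hφ hL.toHasCorankOneSingularities hP₀ h0
  have hS := contDiff_dyGradL hφ
  -- Only where the augmentation stays invertible is the explicit kernel field available, so the
  -- fold condition is tested on this neighbourhood of `P₀`. At `P₀` the vector `b` is a multiple of
  -- that field.
  set W : Set (Rn d × Rn d) := U ∩ {P | (augment u v (dyGradL φ P)).det ≠ 0} with hW
  have hfield : IsKernelFieldOn (projL φ) W fun P => (0, kernelVec u v (dyGradL φ P)) := by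
    refine ⟨fun P hP => ?_, fun P hP h => ?_, fun P hP => ?_⟩
    · exact (contDiffAt_const.prodMk (contDiffAt_kernelVec hS hP.2)).contDiffWithinAt
    · exact kernelVec_ne_zero hv hP.2 (congrArg Prod.snd h)
    · refine mem_ker_projL hφ (apply_kernelVec_eq_zero hv hP.1.2 ?_)
      have h1 := hP.2
      rw [jacDet_projL hφ] at h1
      rw [det_dyGradL hφ, h1]
  have hfold := hL.fold W (hU.inter (isOpen_augment_det_ne_zero hS.continuous))
    Set.inter_subset_left _ hfield P₀ ⟨⟨hP₀, hD⟩, by rw [jacDet_projL hφ, h0]⟩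
  rw [jacDet_projL hφ] at hfold
  rw [eq_smul_kernelVec hD hb] at hb' ⊢
  have h1 : ((0, (inner ℝ u b) • kernelVec u v (dyGradL φ P₀)) : Rn d × Rn d)
      = (inner ℝ u b) • (0, kernelVec u v (dyGradL φ P₀)) := by simp
  rw [h1, map_smul, smul_eq_mul, mul_eq_zero, or_iff_left hfold] at hb'
  rw [hb', zero_smul]

/-- Quantitative injectivity for the immersion `(x, φ_x, h)`, restricted to pairs with the same `x`.
-/
lemma exists_eventually_fold_le (hφ : ContDiff ℝ ∞ φ) (hU : IsOpen U)
    (hL : IsWhitneyFoldOn (projL φ) U) (hP₀ : P₀ ∈ U) :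
    ∃ C, 0 ≤ C ∧ ∀ᶠ p in 𝓝 (P₀, P₀), p.1.1 = p.2.1 →
      ‖p.1.2 - p.2.2‖ ≤ C * (‖gradL φ p.1 - gradL φ p.2‖ +
        |mixedHessianDet φ p.1 - mixedHessianDet φ p.2|) := by
  have hh := contDiff_mixedHessianDet hφ
  have hstrict : HasStrictFDerivAt
      (fun P : Rn d × Rn d => (P.1, gradL φ P, mixedHessianDet φ P))
      ((ContinuousLinearMap.fst ℝ _ _).prod ((fderiv ℝ (gradL φ) P₀).prod
        (fderiv ℝ (mixedHessianDet φ) P₀))) P₀ :=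
    hasStrictFDerivAt_fst.prodMk (((contDiff_gradL hφ).hasStrictFDerivAt (by simp)).prodMk
      (hh.hasStrictFDerivAt (by simp)))
  obtain ⟨C, hC, h⟩ := hstrict.exists_eventually_norm_sub_le_of_injective (by
    rintro ⟨a, b⟩ hab
    obtain rfl : a = 0 := congrArg Prod.fst hab
    rw [eq_zero_of_isWhitneyFoldOn hφ hU hL hP₀ (congrArg (fun q => q.2.1) hab)
      (congrArg (fun q => q.2.2) hab)]
    rfl)
  refine ⟨C, hC, h.mono fun p hp hx => ?_⟩
  refine ((norm_snd_le (p.1 - p.2)).trans hp).trans (mul_le_mul_of_nonneg_left ?_ hC)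
  simp only [Prod.mk_sub_mk, hx, sub_self]
  rw [Prod.norm_mk, Prod.norm_mk, norm_zero, Real.norm_eq_abs]
  exact max_le (by positivity) (max_le_add_of_nonneg (norm_nonneg _) (abs_nonneg _))

/-- At a singular point, tangency and `dh ≠ 0` turn the vanishing of the derivative of `h` along the
kernel field into the bound `O(h)` needed by `exists_eventually_blowdown_le`. At a regular point, `x
↦ φ_y` is already injective to first order, and `u₀ = 0` will do. -/
lemma exists_eventually_blowdown_le_of_isBlowdownOn (hφ : ContDiff ℝ ∞ φ) (hU : IsOpen U)
    (hR : IsBlowdownOn (projR φ) U) (hP₀ : P₀ ∈ U) :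
    ∃ (C : ℝ) (u₀ : Rn d), 0 ≤ C ∧ ∀ᶠ p in 𝓝 (P₀, P₀), p.1.2 = p.2.2 →
      |mixedHessianDet φ p.1| * ‖p.1.1 - p.2.1‖ ≤ C * ‖gradR φ p.1 - gradR φ p.2‖ ∧
      ‖p.1.1 - p.2.1‖ ≤ C * (‖gradR φ p.1 - gradR φ p.2‖ + |inner ℝ (p.1.1 - p.2.1) u₀|) := by
  have hh := contDiff_mixedHessianDet hφ
  have hS := contDiff_dxGradR hφ
  have hΨ := contDiff_gradR hφ
  by_cases h0 : mixedHessianDet φ P₀ = 0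
  · obtain ⟨u, v, hv, hD⟩ := exists_augment_dxGradR hφ hR.toHasCorankOneSingularities hP₀ h0
    have hjac : ∀ P, fderiv ℝ (jacDet (projR φ)) P = swapDet d • fderiv ℝ (mixedHessianDet φ) P := by
      intro P
      rw [jacDet_projR hφ]
      exact ((hh.differentiable (by simp) P).hasFDerivAt.mul_const _).fderiv
    have hjac0 : ∀ P, mixedHessianDet φ P = 0 ↔ jacDet (projR φ) P = 0 := by
      intro P
      rw [jacDet_projR hφ, mul_eq_zero, or_iff_left (swapDet_ne_zero d)]
    have hdh : fderiv ℝ (mixedHessianDet φ) P₀ ≠ 0 := by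
      intro h
      refine hR.fderiv_jacDet_ne_zero P₀ ⟨hP₀, (hjac0 P₀).mp h0⟩ ?_
      rw [hjac, h, smul_zero]
    set W : Set (Rn d × Rn d) := U ∩ {P | (augment u v (dxGradR φ P)).det ≠ 0} with hW
    have hWo : IsOpen W := hU.inter (isOpen_augment_det_ne_zero hS.continuous)
    have hfield : IsKernelFieldOn (projR φ) W fun P => (kernelVec u v (dxGradR φ P), 0) := by
      refine ⟨fun P hP => ?_, fun P hP h => ?_, fun P hP => ?_⟩
      · exact ((contDiffAt_kernelVec hS hP.2).prodMk contDiffAt_const).contDiffWithinAt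
      · exact kernelVec_ne_zero hv hP.2 (congrArg Prod.fst h)
      · refine mem_ker_projR hφ (apply_kernelVec_eq_zero hv hP.1.2 ?_)
        rw [det_dxGradR hφ, (hjac0 P).mpr hP.2]
    have hG : ContDiffAt ℝ ∞ (fun P => fderiv ℝ (mixedHessianDet φ) P
        (kernelVec u v (dxGradR φ P), (0 : Rn d))) P₀ :=
      (hh.fderiv_right (m := ∞) (by simp)).contDiffAt.clm_apply
        ((contDiffAt_kernelVec hS hD).prodMk contDiffAt_const)
    obtain ⟨M, hM, hF⟩ := exists_eventually_abs_le_of_eq_zero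
      (hh.hasStrictFDerivAt (x := P₀) (by simp)) h0 hdh (hG.hasStrictFDerivAt (by simp)) (by
        filter_upwards [hWo.mem_nhds ⟨hP₀, hD⟩] with P hP hP0
        have h1 := hR.tangential W hWo Set.inter_subset_left _ hfield P ⟨hP, (hjac0 P).mp hP0⟩
        rw [hjac, smul_apply, smul_eq_mul, mul_eq_zero,
          or_iff_right (swapDet_ne_zero d)] at h1
        exact h1)
    obtain ⟨C, hC, h⟩ := exists_eventually_blowdown_le hΨ (S := dxGradR φ) (fun _ => rfl) hh
      (fun P => (det_dxGradR hφ P).symm) hv hD hM hF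
    exact ⟨C, u, hC, h⟩
  · have hstrict : HasStrictFDerivAt (fun P : Rn d × Rn d => (gradR φ P, P.2))
        ((fderiv ℝ (gradR φ) P₀).prod (ContinuousLinearMap.snd ℝ _ _)) P₀ :=
      (hΨ.hasStrictFDerivAt (by simp)).prodMk hasStrictFDerivAt_snd
    obtain ⟨C, hC, h⟩ := hstrict.exists_eventually_norm_sub_le_of_injective (by
      rintro ⟨a, b⟩ hab
      obtain rfl : b = 0 := congrArg Prod.snd hab
      have ha : dxGradR φ P₀ a = 0 := congrArg Prod.fst hab
      rw [eq_zero_of_det_ne_zero (by rwa [det_dxGradR hφ]) ha]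
      rfl)
    set H₀ : ℝ := |mixedHessianDet φ P₀| + 1
    have hhle : ∀ᶠ P in 𝓝 P₀, |mixedHessianDet φ P| ≤ H₀ :=
      (hh.continuous.abs.continuousAt.eventually_lt (x₀ := P₀) (continuousAt_const (y := H₀))
        (lt_add_one _)).mono fun P hP => hP.le
    have hhle' : ∀ᶠ p in 𝓝 (P₀, P₀), |mixedHessianDet φ p.1| ≤ H₀ := by
      rw [nhds_prod_eq]
      exact hhle.prod_inl _
    refine ⟨max (H₀ * C) C, 0, le_max_of_le_right hC, (h.and hhle').mono fun p hp hy => ?_⟩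
    have hsep : ‖p.1.1 - p.2.1‖ ≤ C * ‖gradR φ p.1 - gradR φ p.2‖ := by
      refine ((norm_fst_le (p.1 - p.2)).trans hp.1).trans (mul_le_mul_of_nonneg_left ?_ hC)
      simp only [Prod.mk_sub_mk, hy, sub_self]
      rw [Prod.norm_mk, norm_zero, max_eq_left (norm_nonneg _)]
    constructor
    · calc |mixedHessianDet φ p.1| * ‖p.1.1 - p.2.1‖
          ≤ H₀ * (C * ‖gradR φ p.1 - gradR φ p.2‖) :=
            mul_le_mul hp.2 hsep (norm_nonneg _) (by positivity)
        _ = H₀ * C * ‖gradR φ p.1 - gradR φ p.2‖ := by ring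
        _ ≤ _ := by gcongr; exact le_max_left _ _
    · rw [inner_zero_right, abs_zero, add_zero]
      refine hsep.trans ?_
      gcongr
      exact le_max_right _ _

/-- The estimates for the phase which enter the `L²` bounds, on a small ball. -/
theorem exists_local_geometry (hφ : ContDiff ℝ ∞ φ) (hU : IsOpen U)
    (hL : IsWhitneyFoldOn (projL φ) U) (hR : IsBlowdownOn (projR φ) U) (hP₀ : P₀ ∈ U) :
    ∃ (r C₀ : ℝ) (u₀ : Rn d), 0 < r ∧
      (∀ x y z, (x, y) ∈ Metric.closedBall P₀ r → (x, z) ∈ Metric.closedBall P₀ r →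
        ‖y - z‖ ≤ C₀ * (‖gradL φ (x, y) - gradL φ (x, z)‖ +
          |mixedHessianDet φ (x, y) - mixedHessianDet φ (x, z)|)) ∧
      (∀ x z y, (x, y) ∈ Metric.closedBall P₀ r → (z, y) ∈ Metric.closedBall P₀ r →
        |mixedHessianDet φ (x, y)| * ‖x - z‖ ≤ C₀ * ‖gradR φ (x, y) - gradR φ (z, y)‖) ∧
      (∀ x z y, (x, y) ∈ Metric.closedBall P₀ r → (z, y) ∈ Metric.closedBall P₀ r →
        ‖x - z‖ ≤ C₀ * (‖gradR φ (x, y) - gradR φ (z, y)‖ + |inner ℝ (x - z) u₀|)) := by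
  obtain ⟨C₁, hC₁, h₁⟩ := exists_eventually_fold_le hφ hU hL hP₀
  obtain ⟨C₂, u₀, hC₂, h₂⟩ := exists_eventually_blowdown_le_of_isBlowdownOn hφ hU hR hP₀
  obtain ⟨r, hr, hball⟩ := Metric.eventually_nhds_iff_ball.mp (h₁.and h₂)
  have hsub : ∀ {P Q}, P ∈ Metric.closedBall P₀ (r / 2) → Q ∈ Metric.closedBall P₀ (r / 2) →
      (P, Q) ∈ Metric.ball (P₀, P₀) r := by
    intro P Q hP hQ
    rw [← ball_prod_same]
    exact ⟨Metric.closedBall_subset_ball (half_lt_self hr) hP,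
      Metric.closedBall_subset_ball (half_lt_self hr) hQ⟩
  refine ⟨r / 2, max C₁ C₂, u₀, half_pos hr, ?_, ?_, ?_⟩
  · intro x y z h h'
    refine ((hball _ (hsub h h')).1 rfl).trans ?_
    gcongr
    exact le_max_left _ _
  · intro x z y h h'
    refine ((hball _ (hsub h h')).2 rfl).1.trans ?_
    gcongr
    exact le_max_right _ _
  · intro x z y h h'
    refine ((hball _ (hsub h h')).2 rfl).2.trans ?_
    gcongr
    exact le_max_right _ _

end LocalGeometry

end

noncomputable section

/-! ### Passage from squared norms to operator bounds, and finite sums. -/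

section Boundedness

variable {d : ℕ} {k l : Rn d × Rn d → ℂ}

lemma eLpNorm_two_eq_ofReal_sqrt {f : Rn d → ℂ} (hf : MemLp f 2 volume) :
    eLpNorm f 2 volume = ENNReal.ofReal (√(sqNorm f)) := by
  rw [eLpNorm_eq_lintegral_rpow_enorm_toReal two_ne_zero ENNReal.ofNat_ne_top, ENNReal.toReal_ofNat,
    Real.sqrt_eq_rpow, ← ENNReal.ofReal_rpow_of_nonneg (sqNorm_nonneg f) (by norm_num),
    ofReal_sqNorm hf]
  simp

lemma boundedOnL2_of_sqNorm_le (hk : Continuous k) (hkc : HasCompactSupport k) {B : ℝ}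
    (h : ∀ f, MemLp f 2 volume → sqNorm (kernelOp k f) ≤ B * sqNorm f) :
    BoundedOnL2 (kernelOp k) (√B) := by
  intro f hf
  have hTf := memLp_kernelOp hk hkc hf
  refine ⟨hTf, ?_⟩
  rw [eLpNorm_two_eq_ofReal_sqrt hTf, eLpNorm_two_eq_ofReal_sqrt hf,
    ← ENNReal.ofReal_mul (Real.sqrt_nonneg _), ← Real.sqrt_mul' _ (sqNorm_nonneg f)]
  exact ENNReal.ofReal_le_ofReal (Real.sqrt_le_sqrt (h f hf))

lemma BoundedOnL2.mono {T : (Rn d → ℂ) → Rn d → ℂ} {B B' : ℝ} (h : BoundedOnL2 T B)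
    (hB : B ≤ B') : BoundedOnL2 T B' := fun f hf =>
  ⟨(h f hf).1, (h f hf).2.trans (by gcongr)⟩

lemma boundedOnL2_kernelOp_add (hk : Continuous k) (hkc : HasCompactSupport k)
    (hl : Continuous l) (hlc : HasCompactSupport l) {A B : ℝ} (hA : 0 ≤ A) (hB : 0 ≤ B)
    (h : BoundedOnL2 (kernelOp k) A) (h' : BoundedOnL2 (kernelOp l) B) :
    BoundedOnL2 (kernelOp fun p => k p + l p) (A + B) := by
  intro f hf
  have h1 : (kernelOp (fun p => k p + l p) f) = kernelOp k f + kernelOp l f := by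
    funext x
    simp only [kernelOp, add_mul, Pi.add_apply]
    exact integral_add (integrable_slice_mul hk hkc hf x) (integrable_slice_mul hl hlc hf x)
  rw [h1]
  refine ⟨(h f hf).1.add (h' f hf).1, ?_⟩
  refine (eLpNorm_add_le (h f hf).1.1 (h' f hf).1.1 (by norm_num)).trans ?_
  rw [ENNReal.ofReal_add hA hB, add_mul]
  exact add_le_add (h f hf).2 (h' f hf).2

lemma boundedOnL2_kernelOp_sum {ι : Type*} (u : Finset ι) {k : ι → Rn d × Rn d → ℂ} {B : ι → ℝ}
    (hk : ∀ i ∈ u, Continuous (k i)) (hkc : ∀ i ∈ u, HasCompactSupport (k i))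
    (hB : ∀ i ∈ u, 0 ≤ B i) (h : ∀ i ∈ u, BoundedOnL2 (kernelOp (k i)) (B i)) :
    Continuous (fun p => ∑ i ∈ u, k i p) ∧ HasCompactSupport (fun p => ∑ i ∈ u, k i p) ∧
      BoundedOnL2 (kernelOp fun p => ∑ i ∈ u, k i p) (∑ i ∈ u, B i) := by
  classical
  induction u using Finset.induction_on with
  | empty =>
    refine ⟨by simpa using continuous_const, ?_, fun f hf => ?_⟩
    · simp only [Finset.sum_empty]
      exact HasCompactSupport.zero
    have h1 : (kernelOp (fun p : Rn d × Rn d => ∑ i ∈ (∅ : Finset ι), k i p) f) = 0 := by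
      funext x
      simp [kernelOp]
    rw [h1]
    exact ⟨MemLp.zero, by simp⟩
  | insert a s ha ih =>
    obtain ⟨h1, h2, h3⟩ := ih (fun i hi => hk i (Finset.mem_insert_of_mem hi))
      (fun i hi => hkc i (Finset.mem_insert_of_mem hi))
      (fun i hi => hB i (Finset.mem_insert_of_mem hi))
      (fun i hi => h i (Finset.mem_insert_of_mem hi))
    have ha' := Finset.mem_insert_self a s
    simp only [Finset.sum_insert ha]
    exact ⟨(hk a ha').add h1, (hkc a ha').add h2,
      boundedOnL2_kernelOp_add (hk a ha') (hkc a ha') h1 h2 (hB a ha')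
        (Finset.sum_nonneg fun i hi => hB i (Finset.mem_insert_of_mem hi)) (h a ha') h3⟩

lemma oscOp_eq_kernelOp (lam : ℝ) (φ : Rn d × Rn d → ℝ) (a : Rn d × Rn d → ℂ) :
    oscOp lam φ a = kernelOp (oscKernel lam φ a) := by
  funext f x
  exact integral_congr_ae (Filter.Eventually.of_forall fun y => mul_right_comm _ _ _)

lemma oscKernel_sum {ι : Type*} (u : Finset ι) (lam : ℝ) (φ : Rn d × Rn d → ℝ)
    (a : ι → Rn d × Rn d → ℂ) :
    oscKernel lam φ (fun P => ∑ i ∈ u, a i P) = fun P => ∑ i ∈ u, oscKernel lam φ (a i) P := by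
  funext P
  exact Finset.mul_sum _ _ _

end Boundedness

/-! ### Reduction to small balls by a partition of unity. -/

section Localization

open scoped Manifold

variable {d : ℕ}

/-- A smooth function supported in `U` is a finite sum of smooth functions supported in small
balls. -/
lemma exists_finite_decomposition {E : Type*} [NormedAddCommGroup E] [NormedSpace ℝ E]
    [FiniteDimensional ℝ E] {σ : E → ℂ} (hσ : ContDiff ℝ ∞ σ) (hσc : HasCompactSupport σ)
    {r : E → ℝ} (hr : ∀ P ∈ tsupport σ, 0 < r P) :
    ∃ (t : Finset E) (τ : t → E → ℂ), (∀ i : t, (i : E) ∈ tsupport σ) ∧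
      (∀ i, ContDiff ℝ ∞ (τ i)) ∧
      (∀ i : t, tsupport (τ i) ⊆ Metric.closedBall (i : E) (r i)) ∧ ∀ P, σ P = ∑ i, τ i P := by
  obtain ⟨t, ht, hcover⟩ := hσc.isCompact.elim_nhds_subcover (fun P => Metric.ball P (r P))
    fun P hP => Metric.ball_mem_nhds P (hr P hP)
  obtain ⟨ρ, hρ⟩ := SmoothPartitionOfUnity.exists_isSubordinate 𝓘(ℝ, E) (isClosed_tsupport σ)
    (fun i : t => Metric.ball (i : E) (r i)) (fun _ => Metric.isOpen_ball) (by
      intro P hP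
      obtain ⟨i, hi, hPi⟩ := Set.mem_iUnion₂.mp (hcover hP)
      exact Set.mem_iUnion.mpr ⟨⟨i, hi⟩, hPi⟩)
  have hρs : ∀ i, ContDiff ℝ ∞ (ρ i) := fun i => (ρ i).contMDiff.contDiff
  refine ⟨t, fun i P => (ρ i P : ℂ) * σ P, fun i => ht i i.2, fun i => ?_, fun i => ?_, fun P => ?_⟩
  · exact (Complex.ofRealCLM.contDiff.comp (hρs i)).mul hσ
  · refine (closure_mono fun P hP => ?_).trans ((hρ i).trans Metric.ball_subset_closedBall)
    intro h0
    exact hP (by simp [h0])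
  · rw [← Finset.sum_mul]
    by_cases hP : P ∈ tsupport σ
    · have h1 := ρ.sum_eq_one hP
      rw [finsum_eq_sum_of_fintype] at h1
      rw [← Complex.ofReal_sum, h1, Complex.ofReal_one, one_mul]
    · rw [image_eq_zero_of_notMem_tsupport hP, mul_zero]

/-- Common to both local estimates: `D` is the admissible range of `(lam, δ)` and `B` the bound for
the squared norm. The partition of unity depends on neither parameter, so the finitely many local
constants simply add up. -/
lemma exists_boundedOnL2_of_local {φ : Rn d × Rn d → ℝ} (hφ : Continuous φ)
    {h : Rn d × Rn d → ℝ} (hh : ContDiff ℝ ∞ h) {χ : ℝ → ℂ} (hχ : ContDiff ℝ ∞ χ)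
    {U : Set (Rn d × Rn d)} {D : ℝ → ℝ → Prop} {B : ℝ → ℝ → ℝ}
    (hloc : ∀ P₀ ∈ U, ∃ r : ℝ, 0 < r ∧ ∀ σ : Rn d × Rn d → ℂ, ContDiff ℝ ∞ σ →
      tsupport σ ⊆ Metric.closedBall P₀ r → ∃ C, 0 ≤ C ∧ ∀ lam δ, D lam δ →
        ∀ f, MemLp f 2 volume → sqNorm (kernelOp (oscKernel lam φ (locAmp σ h χ δ)) f)
          ≤ C * B lam δ * sqNorm f)
    {σ : Rn d × Rn d → ℂ} (hσ : ContDiff ℝ ∞ σ) (hσc : HasCompactSupport σ)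
    (hσU : tsupport σ ⊆ U) :
    ∃ C, 0 ≤ C ∧ ∀ lam δ, D lam δ →
      BoundedOnL2 (kernelOp (oscKernel lam φ (locAmp σ h χ δ))) (C * √(B lam δ)) := by
  choose! r hr hloc using hloc
  obtain ⟨t, τ, htσ, hτ, hτr, hsum⟩ := exists_finite_decomposition hσ hσc (r := r)
    fun P hP => hr P (hσU hP)
  choose C hC hCb using fun i : t => hloc i (hσU (htσ i)) (τ i) (hτ i) (hτr i)
  refine ⟨∑ i, √(C i), Finset.sum_nonneg fun i _ => Real.sqrt_nonneg _, fun lam δ hD => ?_⟩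
  have h1 : locAmp σ h χ δ = fun P => ∑ i, locAmp (τ i) h χ δ P := by
    funext P
    simp only [locAmp, ← Finset.sum_mul, ← hsum]
  rw [h1, oscKernel_sum, Finset.sum_mul]
  have hk : ∀ i, Continuous (oscKernel lam φ (locAmp (τ i) h χ δ)) := fun i =>
    continuous_oscKernel hφ (contDiff_locAmp (hτ i) hh hχ δ).continuous lam
  have hτc : ∀ i, HasCompactSupport (τ i) := fun i =>
    HasCompactSupport.of_support_subset_isCompact (isCompact_closedBall _ _)
      ((subset_tsupport _).trans (hτr i))
  have hkc : ∀ i, HasCompactSupport (oscKernel lam φ (locAmp (τ i) h χ δ)) := fun i =>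
    hasCompactSupport_oscKernel (hasCompactSupport_locAmp (hτc i) h χ δ) lam
  refine (boundedOnL2_kernelOp_sum _ (fun i _ => hk i) (fun i _ => hkc i) (fun i _ => by positivity)
    fun i _ => ?_).2.2
  rw [← Real.sqrt_mul (hC i)]
  exact boundedOnL2_of_sqNorm_le (hk i) (hkc i) (hCb i lam δ hD)

end Localization

/-! ### The annular pieces, the remainder, and their sums. -/

section DyadicPieces

variable {d : ℕ}

lemma sqrt_two_rpow (a : ℝ) : √((2 : ℝ) ^ a) = (2 : ℝ) ^ (a / 2) := by
  rw [Real.sqrt_eq_rpow, ← Real.rpow_mul two_pos.le, mul_one_div]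

/-- From `l (2 + ε) ≤ k` follows `k - 2l ≥ kε/(2 + ε)`, so `N ≥ d (2 + ε)/ε` integrations by parts
bring the distant cubes down to `2^{-dk}`. This is why `ℓ` has to stay away from `k/2`. -/
lemma far_term_le {k l N : ℕ} {d : ℕ} {ε : ℝ} (hε : 0 < ε) (hl : l * (2 + ε) ≤ k)
    (hN : d * (2 + ε) ≤ N * ε) :
    (((2 : ℝ) ^ k * (((2 : ℝ) ^ l)⁻¹) ^ 2)⁻¹) ^ N ≤ (2 : ℝ) ^ (-((d : ℝ) * k)) := by
  have h1 : ((2 : ℝ) ^ k * (((2 : ℝ) ^ l)⁻¹) ^ 2)⁻¹ = (2 : ℝ) ^ (2 * (l : ℝ) - k) := by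
    rw [Real.rpow_sub two_pos, mul_comm 2 (l : ℝ), Real.rpow_mul two_pos.le, Real.rpow_natCast,
      Real.rpow_natCast, Real.rpow_ofNat, mul_inv, inv_pow, inv_inv, mul_comm, div_eq_mul_inv]
  rw [h1, ← Real.rpow_natCast, ← Real.rpow_mul two_pos.le]
  refine Real.rpow_le_rpow_of_exponent_le one_le_two ?_
  have h2 : ε * k ≤ (k - 2 * l) * (2 + ε) := by linarith
  have h3 : (N : ℝ) * (ε * k) ≤ N * ((k - 2 * l) * (2 + ε)) :=
    mul_le_mul_of_nonneg_left h2 (Nat.cast_nonneg N)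
  have h4 : (d * (2 + ε)) * (k : ℝ) ≤ (N * ε) * k :=
    mul_le_mul_of_nonneg_right hN (Nat.cast_nonneg k)
  have h5 : (d * (k : ℝ)) * (2 + ε) ≤ (N * (k - 2 * l)) * (2 + ε) := by linarith
  have h6 := le_of_mul_le_mul_right h5 (by linarith)
  linarith

lemma abs_det_fderiv_gradR {φ : Rn d × Rn d → ℝ} (hφ : ContDiff ℝ ∞ φ) (x y : Rn d) :
    |(fderiv ℝ (fun x => gradR φ (x, y)) x).det| = |mixedHessianDet φ (x, y)| := by
  rw [(hasFDerivAt_gradR_slice hφ x y).fderiv, det_dxGradR hφ]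

/-- The bound for the pieces on which `|h| ~ 2⁻ˡ`. -/
theorem exists_boundedOnL2_piece {φ : Rn d × Rn d → ℝ} (hφ : ContDiff ℝ ∞ φ)
    {U : Set (Rn d × Rn d)} (hU : IsOpen U) (hL : IsWhitneyFoldOn (projL φ) U)
    (hR : IsBlowdownOn (projR φ) U) {σ : Rn d × Rn d → ℂ} (hσ : ContDiff ℝ ∞ σ)
    (hσc : HasCompactSupport σ) (hσU : tsupport σ ⊆ U) {χ : ℝ → ℂ} (hχ : ContDiff ℝ ∞ χ)
    (hχc : HasCompactSupport χ) (hχ0 : (0 : ℝ) ∉ tsupport χ) {ε : ℝ} (hε : 0 < ε) :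
    ∃ C, 0 ≤ C ∧ ∀ k l : ℕ, l * (2 + ε) ≤ k →
      BoundedOnL2 (kernelOp (oscKernel (2 ^ k) φ
        (locAmp σ (mixedHessianDet φ) χ ((2 : ℝ) ^ l)⁻¹)))
        (C * (2 : ℝ) ^ (((l : ℝ) - d * k) / 2)) := by
  have hh := contDiff_mixedHessianDet hφ
  set N := ⌈d * (2 + ε) / ε⌉₊ with hN
  have hNε : d * (2 + ε) ≤ N * ε := (div_le_iff₀ hε).mp (Nat.le_ceil _)
  obtain ⟨C, hC, hb⟩ := exists_boundedOnL2_of_local (φ := φ) (h := mixedHessianDet φ) (χ := χ)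
    (U := U) (D := fun lam δ => 1 ≤ lam ∧ 0 < δ ∧ δ ≤ 1)
    (B := fun lam δ => δ⁻¹ * (lam⁻¹) ^ d + ((lam * δ ^ 2)⁻¹) ^ N) hφ.continuous hh hχ
    (fun P₀ hP₀ => by
      obtain ⟨r, C₀, u₀, hr, hA, hC, -⟩ := exists_local_geometry hφ hU hL hR hP₀
      refine ⟨r, hr, fun σ hσ hσr => ?_⟩
      obtain ⟨C, hC, hb⟩ := exists_sqNorm_locAmp_le_of_zero_notMem_tsupport hφ
        (isCompact_closedBall P₀ r) (convex_closedBall P₀ r) hσ hσr hh hχ hχc hχ0 hA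
        (abs_det_fderiv_gradR hφ) hC N
      exact ⟨C, hC, fun lam δ h => hb h.1 h.2.1 h.2.2⟩)
    hσ hσc hσU
  refine ⟨C * √2, by positivity, fun k l hl => ?_⟩
  refine (hb (2 ^ k) ((2 : ℝ) ^ l)⁻¹ ⟨one_le_pow₀ one_le_two, by positivity,
    inv_le_one_of_one_le₀ (one_le_pow₀ one_le_two)⟩).mono ?_
  rw [mul_assoc, ← sqrt_two_rpow, ← Real.sqrt_mul two_pos.le]
  refine mul_le_mul_of_nonneg_left (Real.sqrt_le_sqrt ?_) hC
  -- The main term is exactly `2^{l - dk}`: the annular pieces do not need the loss `2^{lε}`.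
  have h1 : (((2 : ℝ) ^ l)⁻¹)⁻¹ * (((2 : ℝ) ^ k)⁻¹) ^ d = (2 : ℝ) ^ ((l : ℝ) - d * k) := by
    rw [Real.rpow_sub two_pos, mul_comm (d : ℝ), Real.rpow_mul two_pos.le, Real.rpow_natCast,
      Real.rpow_natCast, Real.rpow_natCast, inv_inv, inv_pow, div_eq_mul_inv]
  have h2 := far_term_le hε hl hNε
  have h3 : (2 : ℝ) ^ (-((d : ℝ) * k)) ≤ (2 : ℝ) ^ ((l : ℝ) - d * k) :=
    Real.rpow_le_rpow_of_exponent_le one_le_two (by linarith [(Nat.cast_nonneg l : (0 : ℝ) ≤ l)])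
  rw [h1]
  linarith

/-- The bound for the remaining part, on which `|h| ≲ 2⁻ˡ`. -/
theorem exists_boundedOnL2_remainder {φ : Rn d × Rn d → ℝ} (hφ : ContDiff ℝ ∞ φ)
    {U : Set (Rn d × Rn d)} (hU : IsOpen U) (hL : IsWhitneyFoldOn (projL φ) U)
    (hR : IsBlowdownOn (projR φ) U) {σ : Rn d × Rn d → ℂ} (hσ : ContDiff ℝ ∞ σ)
    (hσc : HasCompactSupport σ) (hσU : tsupport σ ⊆ U) {χ : ℝ → ℂ} (hχ : ContDiff ℝ ∞ χ)
    (hχc : HasCompactSupport χ) {ε : ℝ} (hε : 0 < ε) :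
    ∃ C, 0 ≤ C ∧ ∀ k l : ℕ, l * (2 + ε) ≤ k →
      BoundedOnL2 (kernelOp (oscKernel (2 ^ k) φ
        (locAmp σ (mixedHessianDet φ) χ ((2 : ℝ) ^ l)⁻¹)))
        (C * (2 : ℝ) ^ ((-(d * (l : ℝ)) + (k : ℝ) / 2 - d * (k / 2)) / 2)) := by
  have hh := contDiff_mixedHessianDet hφ
  set N := ⌈d * (2 + ε) / ε⌉₊ with hN
  have hNε : d * (2 + ε) ≤ N * ε := (div_le_iff₀ hε).mp (Nat.le_ceil _)
  obtain ⟨C, hC, hb⟩ := exists_boundedOnL2_of_local (φ := φ) (h := mixedHessianDet φ) (χ := χ)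
    (U := U) (D := fun lam δ => 1 ≤ lam ∧ 0 < δ ∧ δ ≤ 1 ∧ 1 ≤ lam * δ ^ 2)
    (B := fun lam δ => δ ^ d * (√lam * ((√lam)⁻¹) ^ d) + ((lam * δ ^ 2)⁻¹) ^ N)
    hφ.continuous hh hχ
    (fun P₀ hP₀ => by
      obtain ⟨r, C₀, u₀, hr, hA, -, hD⟩ := exists_local_geometry hφ hU hL hR hP₀
      refine ⟨r, hr, fun σ hσ hσr => ?_⟩
      obtain ⟨C, hC, hb⟩ := exists_sqNorm_locAmp_le_of_slabs hφ
        (isCompact_closedBall P₀ r) (convex_closedBall P₀ r) hσ hσr hh hχ hχc hA hD N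
      exact ⟨C, hC, fun lam δ h => hb h.1 h.2.1 h.2.2.1 h.2.2.2⟩)
    hσ hσc hσU
  refine ⟨C * √2, by positivity, fun k l hl => ?_⟩
  have hl0 : (0 : ℝ) ≤ l := Nat.cast_nonneg l
  have hk0 : (0 : ℝ) ≤ k := Nat.cast_nonneg k
  have hlk : 2 * l ≤ k := by
    have : (2 * l : ℝ) ≤ k := by nlinarith
    exact_mod_cast this
  -- Needed so that the scale `lam^{-1/2}` of the slabs does not exceed `δ`.
  have h1k : 1 ≤ (2 : ℝ) ^ k * (((2 : ℝ) ^ l)⁻¹) ^ 2 := by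
    rw [inv_pow, ← div_eq_mul_inv, one_le_div (by positivity), ← pow_mul]
    exact pow_le_pow_right₀ one_le_two (by omega)
  refine (hb (2 ^ k) ((2 : ℝ) ^ l)⁻¹ ⟨one_le_pow₀ one_le_two, by positivity,
    inv_le_one_of_one_le₀ (one_le_pow₀ one_le_two), h1k⟩).mono ?_
  rw [mul_assoc, ← sqrt_two_rpow, ← Real.sqrt_mul two_pos.le]
  refine mul_le_mul_of_nonneg_left (Real.sqrt_le_sqrt ?_) hC
  have h1 : (((2 : ℝ) ^ l)⁻¹) ^ d * (√((2 : ℝ) ^ k) * ((√((2 : ℝ) ^ k))⁻¹) ^ d)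
      = (2 : ℝ) ^ (-(d * (l : ℝ)) + (k : ℝ) / 2 - d * (k / 2)) := by
    rw [← Real.rpow_natCast 2 k, sqrt_two_rpow, Real.rpow_sub two_pos, Real.rpow_add two_pos,
      Real.rpow_neg two_pos.le, mul_comm (d : ℝ), mul_comm (d : ℝ), Real.rpow_mul two_pos.le,
      Real.rpow_mul two_pos.le, Real.rpow_natCast, Real.rpow_natCast, Real.rpow_natCast,
      inv_pow, inv_pow, ← div_eq_mul_inv, mul_div_assoc]
  have h2 := far_term_le hε hl hNε
  have h3 : (2 : ℝ) ^ (-((d : ℝ) * k)) ≤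
      (2 : ℝ) ^ (-(d * (l : ℝ)) + (k : ℝ) / 2 - d * (k / 2)) := by
    refine Real.rpow_le_rpow_of_exponent_le one_le_two ?_
    have h4 : (2 * l : ℝ) ≤ k := by exact_mod_cast hlk
    have h5 : (d : ℝ) * (2 * l) ≤ d * k := mul_le_mul_of_nonneg_left h4 (Nat.cast_nonneg d)
    linarith
  rw [h1]
  linarith

lemma sum_two_rpow_half_le (n : ℕ) :
    ∑ j ∈ Finset.range n, (2 : ℝ) ^ ((j : ℝ) / 2) ≤ 4 * (2 : ℝ) ^ ((n : ℝ) / 2) := by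
  induction n with
  | zero => simp
  | succ n ih =>
    rw [Finset.sum_range_succ]
    have h1 : (2 : ℝ) ^ (((n + 1 : ℕ) : ℝ) / 2) = √2 * (2 : ℝ) ^ ((n : ℝ) / 2) := by
      push_cast
      rw [add_div, Real.rpow_add two_pos, Real.sqrt_eq_rpow, mul_comm]
    -- The induction closes because `4 + 1 ≤ 4√2`.
    have h2 : (5 / 4 : ℝ) ≤ √2 := Real.le_sqrt_of_sq_le (by norm_num)
    have h3 : 0 < (2 : ℝ) ^ ((n : ℝ) / 2) := by positivity
    rw [h1]
    nlinarith

/-- Summation of the pieces. -/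
lemma exists_boundedOnL2_sum_pieces {φ : Rn d × Rn d → ℝ} (hφ : ContDiff ℝ ∞ φ)
    {U : Set (Rn d × Rn d)} (hU : IsOpen U) (hL : IsWhitneyFoldOn (projL φ) U)
    (hR : IsBlowdownOn (projR φ) U) {σ : Rn d × Rn d → ℂ} (hσ : ContDiff ℝ ∞ σ)
    (hσc : HasCompactSupport σ) (hσU : tsupport σ ⊆ U) {χ : ℝ → ℂ} (hχ : ContDiff ℝ ∞ χ)
    (hχc : HasCompactSupport χ) (hχ0 : (0 : ℝ) ∉ tsupport χ) {ε : ℝ} (hε : 0 < ε) :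
    ∃ C, 0 ≤ C ∧ ∀ k n : ℕ, n * (2 + ε) ≤ k →
      Continuous (fun P => ∑ j ∈ Finset.range n, oscKernel (2 ^ k) φ
        (locAmp σ (mixedHessianDet φ) χ ((2 : ℝ) ^ j)⁻¹) P) ∧
      HasCompactSupport (fun P => ∑ j ∈ Finset.range n, oscKernel (2 ^ k) φ
        (locAmp σ (mixedHessianDet φ) χ ((2 : ℝ) ^ j)⁻¹) P) ∧
      BoundedOnL2 (kernelOp (fun P => ∑ j ∈ Finset.range n, oscKernel (2 ^ k) φ
        (locAmp σ (mixedHessianDet φ) χ ((2 : ℝ) ^ j)⁻¹) P))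
        (C * (2 : ℝ) ^ (((n : ℝ) - d * k) / 2)) := by
  obtain ⟨C, hC, hb⟩ := exists_boundedOnL2_piece hφ hU hL hR hσ hσc hσU hχ hχc hχ0 hε
  have hh := contDiff_mixedHessianDet hφ
  refine ⟨C * 4, by positivity, fun k n hn => ?_⟩
  obtain ⟨h1, h2, h3⟩ := boundedOnL2_kernelOp_sum (Finset.range n)
    (k := fun j => oscKernel (2 ^ k) φ (locAmp σ (mixedHessianDet φ) χ ((2 : ℝ) ^ j)⁻¹))
    (B := fun j => C * (2 : ℝ) ^ (((j : ℝ) - d * k) / 2))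
    (fun j _ => continuous_oscKernel hφ.continuous (contDiff_locAmp hσ hh hχ _).continuous _)
    (fun j _ => hasCompactSupport_oscKernel (hasCompactSupport_locAmp hσc _ _ _) _)
    (fun j _ => by positivity)
    (fun j hj => hb k j (by
      have h4 : (j : ℝ) ≤ n := by exact_mod_cast (Finset.mem_range.mp hj).le
      nlinarith))
  refine ⟨h1, h2, h3.mono ?_⟩
  have h4 : ∀ j : ℕ, (2 : ℝ) ^ (((j : ℝ) - d * k) / 2) =
      (2 : ℝ) ^ ((j : ℝ) / 2) * (2 : ℝ) ^ (-(d * k : ℝ) / 2) := by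
    intro j
    rw [← Real.rpow_add two_pos]
    congr 1
    ring
  simp only [h4]
  rw [← Finset.mul_sum, ← Finset.sum_mul, mul_assoc C 4, ← mul_assoc 4]
  gcongr
  exact sum_two_rpow_half_le n

end DyadicPieces

end

noncomputable section

/-! ### The endpoint: comparison of exponents and assembly. -/

section Exponents

lemma natFloor_div_mul_le (k : ℕ) {a : ℝ} (ha : 0 < a) : (⌊(k : ℝ) / a⌋₊ : ℝ) * a ≤ k :=
  (le_div_iff₀ ha).mp (Nat.floor_le (by positivity))

lemma le_natFloor_div_add_one_mul (k : ℕ) {a : ℝ} (ha : 0 < a) :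
    (k : ℝ) ≤ (⌊(k : ℝ) / a⌋₊ + 1) * a :=
  ((div_lt_iff₀ ha).mp (Nat.lt_floor_add_one _)).le

/-- The auxiliary annuli run up to `l₁`, which may exceed `l₀`. Still `l₁ ≤ k/2 ≤ (l₀ + 1)(1 +
ε/2)`, and the excess fits into `2^{l₀ ε}` up to a constant. -/
lemma half_natFloor_le (k : ℕ) {ε ε' : ℝ} (hε : 0 < ε) (hε' : 0 < ε') :
    (⌊(k : ℝ) / (2 + ε')⌋₊ : ℝ) / 2 ≤ (⌊(k : ℝ) / (2 + ε)⌋₊ + 1) * (1 / 2 + ε) := by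
  have h1 := natFloor_div_mul_le k (a := 2 + ε') (by positivity)
  have h2 := le_natFloor_div_add_one_mul k (a := 2 + ε) (by positivity)
  set l₁ : ℝ := (⌊(k : ℝ) / (2 + ε')⌋₊ : ℝ)
  set l₀ : ℝ := (⌊(k : ℝ) / (2 + ε)⌋₊ : ℝ)
  have h3 : 0 ≤ l₁ := Nat.cast_nonneg _
  have h4 : 0 ≤ l₀ := Nat.cast_nonneg _
  nlinarith [mul_nonneg h3 hε'.le, mul_nonneg h4 hε.le]

/-- With `q = ε/(2 + ε)` and up to rounding, `l₁` falls short of `k/2` by at most `kε'/4`. This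
costs `k d ε'/4 ≤ kq/4`, by the choice of `ε'`. On the other side `l₀ (1 + 2ε)` exceeds `k/2` by
`3kq/2`, which is more than enough. -/
lemma remainder_exponent_le (k d : ℕ) {ε : ℝ} (hε : 0 < ε) :
    (d : ℝ) * (k / 2) + k / 2 ≤ d * (⌊(k : ℝ) / (2 + ε / ((d + 1) * (2 + ε)))⌋₊ + 1) +
      (⌊(k : ℝ) / (2 + ε)⌋₊ + 1) * (1 + 2 * ε) := by
  set q : ℝ := ε / (2 + ε) with hq
  set ε' : ℝ := ε / ((d + 1) * (2 + ε)) with hε'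
  have hq0 : 0 < q := by positivity
  have hε'0 : 0 < ε' := by positivity
  have hdε : d * ε' ≤ q := by
    have h1 : ε' = q / (d + 1) := by rw [hε', hq, div_div, mul_comm]
    rw [h1, mul_div_assoc', div_le_iff₀ (by positivity)]
    nlinarith
  have h1 := le_natFloor_div_add_one_mul k (a := 2 + ε') (by positivity)
  have h2 := le_natFloor_div_add_one_mul k (a := 2 + ε) (by positivity)
  set l₁ : ℝ := (⌊(k : ℝ) / (2 + ε')⌋₊ : ℝ)
  set l₀ : ℝ := (⌊(k : ℝ) / (2 + ε)⌋₊ : ℝ)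
  have hl₁ : 0 ≤ l₁ := Nat.cast_nonneg _
  have hk : (0 : ℝ) ≤ k := Nat.cast_nonneg k
  have hd : (0 : ℝ) ≤ d := Nat.cast_nonneg d
  have hA : k * (1 / 2 + 3 / 2 * q) ≤ (l₀ + 1) * (1 + 2 * ε) := by
    have h3 : (2 + ε) * (1 / 2 + 3 / 2 * q) = 1 + 2 * ε := by
      rw [hq]
      field_simp
      ring
    calc k * (1 / 2 + 3 / 2 * q) ≤ (l₀ + 1) * (2 + ε) * (1 / 2 + 3 / 2 * q) := by gcongr
      _ = _ := by rw [mul_assoc, h3]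
  have hB : k * (1 / 2 - ε' / 4) ≤ l₁ + 1 := by
    have h3 : k * (2 - ε') ≤ (l₁ + 1) * 4 := by
      by_cases h4 : 0 ≤ 2 - ε'
      · calc k * (2 - ε') ≤ (l₁ + 1) * (2 + ε') * (2 - ε') := by gcongr
          _ = (l₁ + 1) * (4 - ε' ^ 2) := by ring
          _ ≤ (l₁ + 1) * 4 := by gcongr; nlinarith
      · nlinarith
    linarith
  have hC := mul_le_mul_of_nonneg_left hB hd
  have hD : k * (d * ε') ≤ k * q := mul_le_mul_of_nonneg_left hdε hk
  nlinarith [mul_nonneg hk hq0.le]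

end Exponents

/-- A smooth cutoff equal to one on `[-R, R]`, and the annular function of the associated dyadic
decomposition. -/
lemma exists_dyadic_cutoff {R : ℝ} (hR : 0 < R) : ∃ η χ₀ : ℝ → ℂ, ContDiff ℝ ∞ η ∧
    HasCompactSupport η ∧ ContDiff ℝ ∞ χ₀ ∧ HasCompactSupport χ₀ ∧ (0 : ℝ) ∉ tsupport χ₀ ∧
    (∀ t, |t| ≤ R → η t = 1) ∧ ∀ t, χ₀ t = η t - η (2 * t) := by
  let ρ : ContDiffBump (0 : ℝ) := ⟨R, R + 1, hR, by linarith⟩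
  set η : ℝ → ℂ := fun t => ((ρ t : ℝ) : ℂ) with hη
  have hηs : ContDiff ℝ ∞ η := Complex.ofRealCLM.contDiff.comp ρ.contDiff
  have hηc : HasCompactSupport η :=
    ρ.hasCompactSupport.comp_left (g := fun t : ℝ => (t : ℂ)) (by simp)
  have hη1 : ∀ t, |t| ≤ R → η t = 1 := by
    intro t ht
    have h1 : ρ t = 1 := ρ.one_of_mem_closedBall (by simpa using ht)
    rw [hη]
    simp [h1]
  refine ⟨η, fun t => η t - η (2 * t), hηs, hηc, ?_, ?_, ?_, hη1, fun t => rfl⟩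
  · exact hηs.sub (hηs.comp (contDiff_const.mul contDiff_id))
  · refine HasCompactSupport.of_support_subset_isCompact
      (isCompact_closedBall (0 : ℝ) (R + 1)) fun t ht => ?_
    by_contra hcon
    rw [Metric.mem_closedBall, dist_zero_right, Real.norm_eq_abs, not_le] at hcon
    have h0 : ∀ s : ℝ, R + 1 ≤ |s| → η s = 0 := by
      intro s hs
      have h1 : ρ s = 0 := ρ.zero_of_le_dist (by simpa using hs)
      rw [hη]
      simp [h1]
    refine ht ?_
    have h2 : R + 1 ≤ |2 * t| := by
      rw [abs_mul, abs_two]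
      linarith [abs_nonneg t]
    simp only [h0 t hcon.le, h0 _ h2, sub_self]
  · rw [notMem_tsupport_iff_eventuallyEq]
    filter_upwards [Metric.ball_mem_nhds (0 : ℝ) (half_pos hR)] with t ht
    have h1 : |t| < R / 2 := by simpa using ht
    have h2 : |2 * t| ≤ R := by
      rw [abs_mul, abs_two]
      linarith
    rw [hη1 t (by linarith [abs_nonneg t]), hη1 _ h2, sub_self]
    rfl

/-- The remaining amplitude at the endpoint, decomposed into annular pieces, a part on which
`|h| ≲ 2⁻ⁿ`, and the subtracted pieces. -/
lemma endpoint_amplitude_eq {d : ℕ} {σ : Rn d × Rn d → ℂ} {h : Rn d × Rn d → ℝ} {R : ℝ}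
    (hR : ∀ P, σ P ≠ 0 → |h P| ≤ R) {η χ₀ χ : ℝ → ℂ} (hη : ∀ t, |t| ≤ R → η t = 1)
    (hχ₀ : ∀ t, χ₀ t = η t - η (2 * t)) (n m : ℕ) (P : Rn d × Rn d) :
    σ P * (1 - ∑ j ∈ Finset.range m, χ (2 ^ j * h P)) =
      (∑ j ∈ Finset.range n, locAmp σ h χ₀ ((2 : ℝ) ^ j)⁻¹ P) +
        (locAmp σ h η ((2 : ℝ) ^ n)⁻¹ P +
          ∑ j ∈ Finset.range m, locAmp σ h (fun t => -χ t) ((2 : ℝ) ^ j)⁻¹ P) := by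
  simp only [locAmp, inv_inv]
  by_cases hP : σ P = 0
  · simp [hP]
  -- Telescoping; the upper end `η(h)` equals `1` on the support of `σ`, by the choice of `R`.
  have h1 : ∑ j ∈ Finset.range n, χ₀ (2 ^ j * h P) = η (h P) - η (2 ^ n * h P) := by
    have h2 := Finset.sum_range_sub' (fun j => η (2 ^ j * h P)) n
    rw [pow_zero, one_mul] at h2
    rw [← h2]
    refine Finset.sum_congr rfl fun j _ => ?_
    rw [hχ₀, pow_succ', mul_assoc]
  rw [← Finset.mul_sum, ← Finset.mul_sum, h1, hη _ (hR P hP), Finset.sum_neg_distrib]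
  ring

theorem theorem6p1 (d : ℕ)
    (φ : Rn d × Rn d → ℝ) (hφ : ContDiff ℝ ∞ φ)
    (σ : Rn d × Rn d → ℂ) (hσ : ContDiff ℝ ∞ σ) (hσc : HasCompactSupport σ)
    (U : Set (Rn d × Rn d)) (hU : IsOpen U) (hσU : tsupport σ ⊆ U)
    (hL : IsWhitneyFoldOn (projL φ) U) (hR : IsBlowdownOn (projR φ) U)
    (χ : ℝ → ℂ) (hχ : ContDiff ℝ ∞ χ) (hχc : HasCompactSupport χ) (hχ0 : (0 : ℝ) ∉ tsupport χ)
    (ε : ℝ) (hε : 0 < ε) :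
    ∃ C : ℝ, 0 < C ∧ ∀ k : ℕ,
      (∀ ℓ : ℕ, ℓ ≤ ⌊(k : ℝ) / (2 + ε)⌋₊ →
        BoundedOnL2 (pieceOp φ σ χ k ℓ)
          (C * (2 : ℝ) ^ (((ℓ : ℝ) - (d : ℝ) * (k : ℝ)) / 2 + (ℓ : ℝ) * ε))) ∧
      (∀ ℓ₀ : ℕ, ℓ₀ = ⌊(k : ℝ) / (2 + ε)⌋₊ →
        BoundedOnL2 (endpointOp φ σ χ k ℓ₀)
          (C * (2 : ℝ) ^ (((ℓ₀ : ℝ) - (d : ℝ) * (k : ℝ)) / 2 + (ℓ₀ : ℝ) * ε))) := by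
  have hh := contDiff_mixedHessianDet hφ
  obtain ⟨R, hR0, hRb⟩ : ∃ R : ℝ, 0 < R ∧ ∀ P, σ P ≠ 0 → |mixedHessianDet φ P| ≤ R := by
    obtain ⟨R, hR⟩ := hσc.isCompact.exists_bound_of_continuousOn hh.continuous.continuousOn
    exact ⟨max R 1, by positivity, fun P hP =>
      (hR P (subset_tsupport σ hP)).trans (le_max_left _ _)⟩
  obtain ⟨η, χ₀, hη, hηc, hχ₀, hχ₀c, hχ₀0, hη1, hχ₀eq⟩ := exists_dyadic_cutoff hR0
  -- The auxiliary decomposition goes closer to `|h| ~ 2^{-k/2}` than `ℓ₀` does. The factor `d + 1`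
  -- ensures `d ε' ≤ ε/(2 + ε)`.
  set ε' : ℝ := ε / ((d + 1) * (2 + ε)) with hε'
  have hε'0 : 0 < ε' := by positivity
  have hneg : tsupport (fun t => -χ t) = tsupport χ := by
    rw [tsupport, tsupport]
    congr 1
    ext t
    simp
  obtain ⟨C₁, hC₁, hpiece⟩ := exists_boundedOnL2_piece hφ hU hL hR hσ hσc hσU hχ hχc hχ0 hε
  obtain ⟨C₂, hC₂, hann⟩ :=
    exists_boundedOnL2_sum_pieces hφ hU hL hR hσ hσc hσU hχ₀ hχ₀c hχ₀0 hε'0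
  obtain ⟨C₃, hC₃, hrem⟩ := exists_boundedOnL2_remainder hφ hU hL hR hσ hσc hσU hη hηc hε'0
  obtain ⟨C₄, hC₄, hsub⟩ := exists_boundedOnL2_sum_pieces hφ hU hL hR hσ hσc hσU
    (χ := fun t => -χ t) hχ.neg (by rw [HasCompactSupport, hneg]; exact hχc)
    (by rw [hneg]; exact hχ0) hε
  -- `2^s` pays for the `+ 1`s that come from rounding down `l₀` and `l₁`.
  set s : ℝ := (d + 1 + 2 * ε) / 2 with hs
  have hs0 : 0 ≤ s := by positivity
  have hs1 : 1 ≤ (2 : ℝ) ^ s := Real.one_le_rpow one_le_two hs0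
  refine ⟨(C₁ + C₂ + C₃ + C₄ + 1) * 2 ^ s, by positivity, fun k => ⟨fun l hl => ?_, ?_⟩⟩
  · have hlk : (l : ℝ) * (2 + ε) ≤ k := by
      have h1 := natFloor_div_mul_le k (a := 2 + ε) (by positivity)
      have h2 : (l : ℝ) ≤ ⌊(k : ℝ) / (2 + ε)⌋₊ := by exact_mod_cast hl
      nlinarith
    have h1 : pieceOp φ σ χ k l = kernelOp (oscKernel (2 ^ k) φ
        (locAmp σ (mixedHessianDet φ) χ ((2 : ℝ) ^ l)⁻¹)) := by
      have h2 : locAmp σ (mixedHessianDet φ) χ ((2 : ℝ) ^ l)⁻¹ =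
          fun P => σ P * χ (2 ^ l * mixedHessianDet φ P) := by
        funext P
        rw [locAmp, inv_inv]
      rw [pieceOp, oscOp_eq_kernelOp, h2]
    rw [h1]
    refine (hpiece k l hlk).mono ?_
    calc C₁ * (2 : ℝ) ^ (((l : ℝ) - d * k) / 2)
        ≤ (C₁ + C₂ + C₃ + C₄ + 1) * 2 ^ s * (2 : ℝ) ^ (((l : ℝ) - d * k) / 2) := by
          gcongr
          nlinarith
      _ ≤ _ := by
          gcongr
          · exact one_le_two
          · have : 0 ≤ (l : ℝ) * ε := by positivity
            linarith
  · rintro l₀ rfl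
    set l₀ := ⌊(k : ℝ) / (2 + ε)⌋₊ with hl₀
    set l₁ := ⌊(k : ℝ) / (2 + ε')⌋₊ with hl₁
    have hl₀k : (l₀ : ℝ) * (2 + ε) ≤ k := natFloor_div_mul_le k (by positivity)
    have hl₁k : (l₁ : ℝ) * (2 + ε') ≤ k := natFloor_div_mul_le k (by positivity)
    obtain ⟨c₁, s₁, b₁⟩ := hann k l₁ hl₁k
    obtain ⟨c₂, s₂, b₂⟩ := hsub k l₀ hl₀k
    have b₃ := hrem k l₁ hl₁k
    have c₃ : Continuous (oscKernel (2 ^ k) φ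
        (locAmp σ (mixedHessianDet φ) η ((2 : ℝ) ^ l₁)⁻¹)) :=
      continuous_oscKernel hφ.continuous (contDiff_locAmp hσ hh hη _).continuous _
    have s₃ : HasCompactSupport (oscKernel (2 ^ k) φ
        (locAmp σ (mixedHessianDet φ) η ((2 : ℝ) ^ l₁)⁻¹)) :=
      hasCompactSupport_oscKernel (hasCompactSupport_locAmp hσc _ _ _) _
    -- Three groups: auxiliary annuli up to `l₁`, the part with `|h| ≲ 2^{-l₁}`, and the subtracted
    -- `χ` pieces up to `l₀`, each covered by its own estimate.
    have hkernel : endpointOp φ σ χ k l₀ = kernelOp fun P =>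
        (∑ j ∈ Finset.range l₁, oscKernel (2 ^ k) φ
          (locAmp σ (mixedHessianDet φ) χ₀ ((2 : ℝ) ^ j)⁻¹) P) +
        (oscKernel (2 ^ k) φ (locAmp σ (mixedHessianDet φ) η ((2 : ℝ) ^ l₁)⁻¹) P +
          ∑ j ∈ Finset.range l₀, oscKernel (2 ^ k) φ
            (locAmp σ (mixedHessianDet φ) (fun t => -χ t) ((2 : ℝ) ^ j)⁻¹) P) := by
      rw [endpointOp, oscOp_eq_kernelOp]
      congr 1
      funext P
      rw [oscKernel, endpoint_amplitude_eq hRb hη1 hχ₀eq l₁ l₀ P]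
      simp only [oscKernel, ← Finset.mul_sum, ← mul_add]
    rw [hkernel]
    refine (boundedOnL2_kernelOp_add c₁ s₁ (c₃.add c₂) (s₃.add s₂) (by positivity) (by positivity)
      b₁ (boundedOnL2_kernelOp_add c₃ s₃ c₂ s₂ (by positivity) (by positivity) b₃ b₂)).mono ?_
    set X : ℝ := ((l₀ : ℝ) - d * k) / 2 + l₀ * ε with hX
    have hpow : ∀ a : ℝ, a ≤ s + X → (2 : ℝ) ^ a ≤ 2 ^ s * 2 ^ X := by
      intro a ha
      rw [← Real.rpow_add two_pos]
      exact Real.rpow_le_rpow_of_exponent_le one_le_two ha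
    have hd : (0 : ℝ) ≤ d := Nat.cast_nonneg d
    have e₁ : (2 : ℝ) ^ (((l₁ : ℝ) - d * k) / 2) ≤ 2 ^ s * 2 ^ X := by
      refine hpow _ ?_
      have h1 := half_natFloor_le k hε hε'0
      rw [← hl₀, ← hl₁] at h1
      rw [hs, hX]
      linarith
    have e₂ : (2 : ℝ) ^ ((-(d * (l₁ : ℝ)) + (k : ℝ) / 2 - d * (k / 2)) / 2) ≤ 2 ^ s * 2 ^ X := by
      refine hpow _ ?_
      have h1 := remainder_exponent_le k d hε
      rw [← hε', ← hl₀, ← hl₁] at h1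
      rw [hs, hX]
      linarith
    have e₃ : (2 : ℝ) ^ (((l₀ : ℝ) - d * k) / 2) ≤ 2 ^ s * 2 ^ X := by
      refine hpow _ ?_
      have h1 : 0 ≤ (l₀ : ℝ) * ε := by positivity
      rw [hX]
      linarith
    set Y : ℝ := 2 ^ s * 2 ^ X
    have hY : 0 ≤ Y := by positivity
    calc C₂ * (2 : ℝ) ^ (((l₁ : ℝ) - d * k) / 2)
          + (C₃ * (2 : ℝ) ^ ((-(d * (l₁ : ℝ)) + (k : ℝ) / 2 - d * (k / 2)) / 2)
            + C₄ * (2 : ℝ) ^ (((l₀ : ℝ) - d * k) / 2))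
        ≤ C₂ * Y + (C₃ * Y + C₄ * Y) := by gcongr
      _ ≤ (C₁ + C₂ + C₃ + C₄ + 1) * Y := by nlinarith [mul_nonneg hC₁ hY]
      _ = _ := by rw [mul_assoc]

end
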